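/- **Proposition 4.13.** Let $(M,g)$ be a compact smooth Riemannian manifold without boundary, of dimension $N\ge 1$, with Riemannian measure $dv_g$. Let $W\colon\mathbb R\to[0,+\infty)$ be a double well potential: $W$ is of class $C^2$, its global minimum points are exactly $0$ and $1$, its only local maximum point is $\tfrac12$, and $$W(0)=W'(0)=W(1)=W'(1)=0,\qquad W''(0)>0,\quad W''(1)>0 .$$ Assume moreover that $W$ satisfies the growth condition: there are constants $c_1,c_2,t_0>0$ and $p_1,p_2\in\mathbb R$ with $$c_1|t|^{p_1}<W(t)<c_2|t|^{p_2}\quad\text{whenever } |t|\ge t_0,\qquad 2<p_1<\tfrac12\,2^*+1,\qquad p_1\le p_2\le 2(p_1-1),$$ where $2^*=\frac{2N}{N-2}$ if $N\ge 3$ and $2^*=+\infty$ if $N\in\{1,2\}$. For $\varepsilon>0$ and $u$ in the Sobolev space $H^1(M)$ put $$E_\varepsilon(u)=\frac\varepsilon2\int_M|\nabla u|^2\,dv_g+\frac1\varepsilon\int_M W(u)\,dv_g .$$ For $u\in L^1(M)$ let $$|Du|(M)=\sup\Big\{\int_M u\,\mathrm{div}_g X\,dv_g:\ X \text{ a smooth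 vector field on } M,\ \sup_{M}|X|_g\le1\Big\}\in[0,+\infty],$$ let $BV(M)=\{u\in L^1(M): |Du|(M)<+\infty\}$, and say that a measurable set $\Omega\subseteq M$ has finite perimeter if $|D\chi_\Omega|(M)<+\infty$. Let $E^*>0$, let $(\varepsilon_i)_{i\in\mathbb N}$ be a sequence of positive numbers with $\varepsilon_i\to0$, and let $u_{\varepsilon_i}\in H^1(M)$ satisfy $E_{\varepsilon_i}(u_{\varepsilon_i})\le E^*$ for all $i\in\mathbb N$. Then a subsequence of $(u_{\varepsilon_i})_i$ converges in $L^1(M)$ to a function $u_\infty\in BV(M)$, and there is a set $\Omega\subseteq M$ of finite perimeter such that $$u_\infty=\chi_\Omega\qquad\text{and}\qquad |Du_\infty|(M)\le\frac{E^*}{\sigma},\qquad\text{where } \sigma=\int_0^1\sqrt{2W(s)}\,ds .$$ -/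

import Mathlib

open scoped Manifold ContDiff ENNReal Topology
open MeasureTheory Filter

noncomputable section

namespace AllenCahn

/-- A smooth Riemannian metric on a smooth manifold `M` (without boundary) of dimension `N`. -/
abbrev Metric (N : ℕ) (M : Type*) [TopologicalSpace M]
    [ChartedSpace (EuclideanSpace ℝ (Fin N)) M] [IsManifold (𝓡 N) ∞ M] : Type _ :=
  Bundle.ContMDiffRiemannianMetric (𝓡 N) ∞ (EuclideanSpace ℝ (Fin N))
    (fun x : M => TangentSpace (𝓡 N) x)

/-- A (not necessarily continuous) vector field on `M`. -/
abbrev VectorField (N : ℕ) (M : Type*) [TopologicalSpace M]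
    [ChartedSpace (EuclideanSpace ℝ (Fin N)) M] : Type _ :=
  (x : M) → TangentSpace (𝓡 N) x

section Geometry

variable {N : ℕ} {M : Type*} [TopologicalSpace M] [ChartedSpace (EuclideanSpace ℝ (Fin N)) M]

/-- The `i`-th coordinate vector `∂ᵢ` of the chart centred at `p`, at the point of `M` with
coordinates `z`. -/
def coordVector (p : M) (z : EuclideanSpace ℝ (Fin N)) (i : Fin N) :
    TangentSpace (𝓡 N) ((extChartAt (𝓡 N) p).symm z) :=
  mfderiv 𝓘(ℝ, EuclideanSpace ℝ (Fin N)) (𝓡 N) (extChartAt (𝓡 N) p).symm z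
    (EuclideanSpace.single i (1 : ℝ))

/-- The components at `x` of the vector field `X` in the chart centred at `p`, for `x` in the
domain of this chart: the image of `X x` under the derivative of the chart. -/
def components (p : M) (X : VectorField N M) (x : M) : EuclideanSpace ℝ (Fin N) :=
  mfderiv (𝓡 N) 𝓘(ℝ, EuclideanSpace ℝ (Fin N)) (extChartAt (𝓡 N) p) x (X x)

variable [IsManifold (𝓡 N) ∞ M]

/-- The vector field `X` is smooth, as a section of the tangent bundle. -/
def IsSmoothField (X : VectorField N M) : Prop :=
  ContMDiff (𝓡 N) (𝓡 N).tangent ∞ (fun x => (⟨x, X x⟩ : TangentBundle (𝓡 N) M))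

/-- The Gram matrix `gᵢⱼ = g(∂ᵢ, ∂ⱼ)` in the chart centred at `p`. -/
def gram (g : Metric N M) (p : M) (z : EuclideanSpace ℝ (Fin N)) : Matrix (Fin N) (Fin N) ℝ :=
  Matrix.of fun i j =>
    g.inner ((extChartAt (𝓡 N) p).symm z) (coordVector p z i) (coordVector p z j)

/-- The Riemannian volume density `√(det gᵢⱼ)` in the chart centred at `p`. -/
def density (g : Metric N M) (p : M) (z : EuclideanSpace ℝ (Fin N)) : ℝ :=
  Real.sqrt (gram g p z).det

/-- The divergence `(√det g)⁻¹ ∑ᵢ ∂ᵢ (√det g Xⁱ)` of a vector field, computed at `x` in the chart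
centred at `x`. -/
def divergence (g : Metric N M) (X : VectorField N M) (x : M) : ℝ :=
  (density g x (extChartAt (𝓡 N) x x))⁻¹ *
    ∑ i : Fin N, fderiv ℝ
      (fun z => density g x z * components x X ((extChartAt (𝓡 N) x).symm z) i)
      (extChartAt (𝓡 N) x x) (EuclideanSpace.single i (1 : ℝ))

variable [MeasurableSpace M]

/-- The Riemannian volume of the domain of the chart centred at `p`, extended by zero to `M`:
the measure `√(det gᵢⱼ) dz` on the image of the chart, transported to `M`. -/
def chartVolume (g : Metric N M) (p : M) : Measure M :=
  ((volume.restrict (extChartAt (𝓡 N) p).target).withDensity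
    (fun z => ENNReal.ofReal (density g p z))).map (extChartAt (𝓡 N) p).symm

/-- The Riemannian measure: the least measure that dominates the Riemannian volume of every chart
domain. As the chart volumes agree on overlaps, it is the measure that coincides with
`√(det gᵢⱼ) dz` in each of these charts. -/
def vol (g : Metric N M) : Measure M :=
  ⨆ p : M, chartVolume g p

/-- The variation `|Du|(M)`, the supremum of `∫ u div X` over the smooth vector fields `X` with
`|X| ≤ 1` everywhere. The manifold is meant to be compact, so that every vector field has compact
support. The supremum is nonnegative (take `X = 0`) and is taken in `[0, ∞]`. -/
def variation (g : Metric N M) (u : M → ℝ) : ℝ≥0∞ :=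
  ⨆ (X : VectorField N M) (_ : IsSmoothField X) (_ : ∀ x, Real.sqrt (g.inner x (X x) (X x)) ≤ 1),
    ENNReal.ofReal (∫ x, u x * divergence g X x ∂(vol g))

/-- Functions of bounded variation: `u ∈ L¹(M)` and `|Du|(M) < ∞`. -/
def MemBV (g : Metric N M) (u : M → ℝ) : Prop :=
  Integrable u (vol g) ∧ variation g u < ⊤

/-- The perimeter of `S` in `M`, which is `|Dχ_S|(M)`. -/
def perimeter (g : Metric N M) (S : Set M) : ℝ≥0∞ :=
  variation g (S.indicator fun _ => (1 : ℝ))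

/-- `S` is a set of finite perimeter: measurable for the Riemannian measure, with finite
perimeter. -/
def HasFinitePerimeter (g : Metric N M) (S : Set M) : Prop :=
  NullMeasurableSet S (vol g) ∧ perimeter g S < ⊤

/-- `Y` is a square integrable vector field that is the weak gradient of `u`:
`∫ g(Y, X) = -∫ u div X` for every smooth vector field `X` on the compact manifold `M`.
Measurability of `Y` is that of its components in charts. -/
structure IsWeakGradient (g : Metric N M) (u : M → ℝ) (Y : VectorField N M) : Prop where
  aemeasurable : ∀ p : M,
    AEMeasurable (components p Y) ((vol g).restrict (extChartAt (𝓡 N) p).source)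
  sq_integrable : ∫⁻ x, ENNReal.ofReal (g.inner x (Y x) (Y x)) ∂(vol g) < ⊤
  integral_eq : ∀ X : VectorField N M, IsSmoothField X →
    ∫ x, g.inner x (Y x) (X x) ∂(vol g) = -∫ x, u x * divergence g X x ∂(vol g)

/-- The Sobolev space `H¹(M)`: square integrable functions with a square integrable weak
gradient. -/
def MemH1 (g : Metric N M) (u : M → ℝ) : Prop :=
  MemLp u 2 (vol g) ∧ ∃ Y : VectorField N M, IsWeakGradient g u Y

open Classical in
/-- The weak gradient of a function in `H¹(M)` (unique up to null sets). -/
def weakGradient (g : Metric N M) (u : M → ℝ) : VectorField N M :=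
  if h : ∃ Y : VectorField N M, IsWeakGradient g u Y then h.choose else fun _ => 0

/-- The energy `E_ε(u) = ε/2 ∫ |∇u|² + 1/ε ∫ W(u)` of `u ∈ H¹(M)`, for `ε > 0` and `W ≥ 0`, as an
element of `[0, ∞]`. -/
def energy (g : Metric N M) (W : ℝ → ℝ) (ε : ℝ) (u : M → ℝ) : ℝ≥0∞ :=
  ENNReal.ofReal (ε / 2) *
      ∫⁻ x, ENNReal.ofReal (g.inner x (weakGradient g u x) (weakGradient g u x)) ∂(vol g) +
    ENNReal.ofReal (1 / ε) * ∫⁻ x, ENNReal.ofReal (W (u x)) ∂(vol g)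

end Geometry

/-- Double well potentials: `W : ℝ → [0, ∞)` is of class `C²`, its global minimum points are
exactly `0` and `1`, its only local maximum point is `1/2`, and
`W(0) = W'(0) = W(1) = W'(1) = 0`, `W''(0) > 0`, `W''(1) > 0`. -/
structure IsDoubleWell (W : ℝ → ℝ) : Prop where
  contDiff : ContDiff ℝ 2 W
  nonneg : ∀ s, 0 ≤ W s
  global_min : ∀ s, (∀ t, W s ≤ W t) ↔ s = 0 ∨ s = 1
  local_max : ∀ s, IsLocalMax W s ↔ s = 1 / 2
  zero : W 0 = 0
  one : W 1 = 0
  deriv_zero : deriv W 0 = 0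
  deriv_one : deriv W 1 = 0
  deriv2_zero : 0 < deriv (deriv W) 0
  deriv2_one : 0 < deriv (deriv W) 1

/-- The critical Sobolev exponent `2* = 2N/(N-2)`, which is `∞` in dimensions one and two. -/
def criticalExponent (N : ℕ) : EReal :=
  if N ≤ 2 then ⊤ else ((2 * N / (N - 2) : ℝ) : EReal)

/-- The growth condition: `c₁ |t|^p₁ < W(t) < c₂ |t|^p₂` for `|t| ≥ t₀`, where
`2 < p₁ < 2*/2 + 1` and `p₁ ≤ p₂ ≤ 2 (p₁ - 1)`. -/
def GrowthCondition (N : ℕ) (W : ℝ → ℝ) : Prop :=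
  ∃ c₁ c₂ t₀ p₁ p₂ : ℝ, 0 < c₁ ∧ 0 < c₂ ∧ 0 < t₀ ∧
    2 < p₁ ∧ (p₁ : EReal) < criticalExponent N / 2 + 1 ∧ p₁ ≤ p₂ ∧ p₂ ≤ 2 * (p₁ - 1) ∧
    ∀ t : ℝ, t₀ ≤ |t| → c₁ * |t| ^ p₁ < W t ∧ W t < c₂ * |t| ^ p₂

/-- The surface tension `σ = ∫₀¹ √(2 W(s)) ds`. -/
def surfaceTension (W : ℝ → ℝ) : ℝ :=
  ∫ s in (0 : ℝ)..1, Real.sqrt (2 * W s)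

end AllenCahn

end

/-! The argument is that of Modica and Mortola. Let `Φ = wellPrimitive W` be the primitive of
`√(2W)`, with the integrand set to zero outside `[0, 1]`. Completing a square gives `|∇(Φ ∘ u)| =
Φ'(u)|∇u| ≤ ε/2 |∇u|² + W(u)/ε`, so the energy bounds the `L¹` norm of the weak gradient of `Φ ∘ u`
by `E*` (`MemH1.lintegral_wellSlope_smul_le`). The cut-off makes `Φ` and `Φ'` bounded, so `Φ ∘ u` is
bounded by `σ` and the chain rule for weak gradients (`IsWeakGradient.comp`) needs only an
integrable field.

A Rellich type theorem (`exists_subseq_tendsto_of_weakDeriv`) then yields a subsequence along which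
`Φ ∘ u` converges in `L¹` to some `v`. Also `∫ W(u) ≤ ε E*` tends to zero, so along a further
subsequence both `Φ(u) → v` and `W(u) → 0` almost everywhere. By the growth of `W` such values of
`u` stay bounded, their cluster points are wells, and `Φ` takes the different values `0` and `σ` at
the two wells. Hence `u` converges almost everywhere to `0` or `1` (`IsDoubleWell.tendsto_well`),
that is to `χ_Ω` with `Ω = {v > σ/2}`, and `v = σ χ_Ω`. Convergence in `L¹` follows from `|t| ≤ R +
c W(t)`: a truncation is handled by dominated convergence and the excess by `∫ W(u) → 0`. The bound
on the variation is the limit of `∫ Φ(u) div X ≤ E*`, divided by `σ`.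

The compactness theorem rests on mollification in coordinates. A uniformly bounded sequence has a
weak limit in `L²`, so all its localized mollifications converge pointwise, while an `L¹` bound on
weak derivatives makes the mollifications close to the functions uniformly along the sequence.

To use this on the manifold, the global definitions are translated into charts. The Riemannian
measure is the density times Lebesgue measure in each chart (`restrict_vol`), and the divergence may
be computed in any fixed chart (`divergence_eq`), by the Piola identity. Then the weak gradient
amounts to weak partial derivatives in charts, and a partition of unity returns to the manifold. -/

set_option linter.unusedSectionVars false

namespace AllenCahn

/-! ### Mollification in a finite-dimensional space. -/

section Mollification

variable {E : Type*} [NormedAddCommGroup E] [NormedSpace ℝ E] [FiniteDimensional ℝ E]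

/-- A sequence of bump functions whose supports shrink to the origin. -/
noncomputable def mollifier (E : Type*) [NormedAddCommGroup E] [NormedSpace ℝ E]
    [FiniteDimensional ℝ E] (n : ℕ) : ContDiffBump (0 : E) where
  -- The ratio of the radii stays equal to two; a bounded ratio is required for almost everywhere
  -- convergence in `ae_tendsto_mollify`.
  rIn := 1 / (2 * (n + 1))
  rOut := 1 / (n + 1)
  rIn_pos := by positivity
  rIn_lt_rOut := by
    apply one_div_lt_one_div_of_lt <;> linarith [n.cast_nonneg (α := ℝ)]

theorem tendsto_mollifier_rOut :
    Tendsto (fun n => (mollifier E n).rOut) atTop (𝓝 0) :=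
  tendsto_one_div_add_atTop_nhds_zero_nat

variable [MeasurableSpace E] [BorelSpace E]

/-- The convolution of a function with the bump functions `mollifier`. -/
noncomputable def mollify (μ : Measure E) (n : ℕ) (f : E → ℝ) : E → ℝ :=
  MeasureTheory.convolution ((mollifier E n).normed μ) f (ContinuousLinearMap.lsmul ℝ ℝ) μ

variable {μ : Measure E} [μ.IsAddHaarMeasure]

theorem mollify_apply (n : ℕ) (f : E → ℝ) (z : E) :
    mollify μ n f z = ∫ t, (mollifier E n).normed μ t * f (z - t) ∂μ := rfl

theorem mollify_apply_swap (n : ℕ) (f : E → ℝ) (z : E) :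
    mollify μ n f z = ∫ t, (mollifier E n).normed μ (z - t) * f t ∂μ :=
  convolution_lsmul_swap

theorem integrable_mollifier_mul (n : ℕ) {f : E → ℝ} (hf : Integrable f μ) (z : E) :
    Integrable (fun t => (mollifier E n).normed μ t * f (z - t)) μ := by
  have h := (mollifier E n).hasCompactSupport_normed (μ := μ)
  exact (h.convolutionExists_left (ContinuousLinearMap.lsmul ℝ ℝ)
    ((mollifier E n).continuous_normed) hf.locallyIntegrable z)

/-- Averages against a mollifier do not increase bounds of `L¹` norms. -/
theorem lintegral_mollifier_average_le (n : ℕ) {F : E → E → ℝ} {C : ℝ≥0∞}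
    (hF : AEStronglyMeasurable (Function.uncurry F) (μ.prod μ))
    (hC : ∀ t, ‖t‖ ≤ 1 / ((n : ℝ) + 1) → ∫⁻ z, ‖F z t‖ₑ ∂μ ≤ C) :
    ∫⁻ z, ‖∫ t, (mollifier E n).normed μ t * F z t ∂μ‖ₑ ∂μ ≤ C := by
  set ρ := (mollifier E n).normed μ with hρ
  have hρm : Measurable ρ := (mollifier E n).continuous_normed.measurable
  calc ∫⁻ z, ‖∫ t, ρ t * F z t ∂μ‖ₑ ∂μ
      ≤ ∫⁻ z, ∫⁻ t, ‖ρ t‖ₑ * ‖F z t‖ₑ ∂μ ∂μ := by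
        refine lintegral_mono fun z => (enorm_integral_le_lintegral_enorm _).trans_eq ?_
        simp only [enorm_mul]
    _ = ∫⁻ t, ∫⁻ z, ‖ρ t‖ₑ * ‖F z t‖ₑ ∂μ ∂μ := by
        refine lintegral_lintegral_swap ?_
        exact (hρm.enorm.comp measurable_snd).aemeasurable.mul hF.enorm
    _ = ∫⁻ t, ‖ρ t‖ₑ * ∫⁻ z, ‖F z t‖ₑ ∂μ ∂μ := by
        refine lintegral_congr fun t => lintegral_const_mul' _ _ enorm_ne_top
    _ ≤ ∫⁻ t, ‖ρ t‖ₑ * C ∂μ := by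
        refine lintegral_mono fun t => ?_
        by_cases ht : ‖t‖ ≤ 1 / ((n : ℝ) + 1)
        · exact mul_le_mul_right (hC t ht) _
        · have : ρ t = 0 := by
            rw [← Function.notMem_support, hρ, ContDiffBump.support_normed_eq]
            simp only [Metric.mem_ball, dist_zero_right]
            exact fun h => ht h.le
          simp [this]
    _ = C := by
        rw [lintegral_mul_const _ hρm.enorm]
        have : ∫⁻ t, ‖ρ t‖ₑ ∂μ = ENNReal.ofReal (∫ t, ρ t ∂μ) := by
          rw [ofReal_integral_eq_lintegral_ofReal (mollifier E n).integrable_normed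
            (Eventually.of_forall fun t => (mollifier E n).nonneg_normed t)]
          exact lintegral_congr fun t => Real.enorm_of_nonneg ((mollifier E n).nonneg_normed t)
        rw [this, (mollifier E n).integral_normed]
        simp

theorem aestronglyMeasurable_sub {f : E → ℝ} (hf : AEStronglyMeasurable f μ) :
    AEStronglyMeasurable (Function.uncurry fun z t => f (z - t)) (μ.prod μ) :=
  hf.comp_quasiMeasurePreserving (quasiMeasurePreserving_sub_of_right_invariant μ μ)

theorem lintegral_mollify_le (n : ℕ) {f : E → ℝ} (hf : AEStronglyMeasurable f μ) :
    ∫⁻ z, ‖mollify μ n f z‖ₑ ∂μ ≤ ∫⁻ z, ‖f z‖ₑ ∂μ :=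
  lintegral_mollifier_average_le n (aestronglyMeasurable_sub hf) fun t _ =>
    (lintegral_sub_right_eq_self (fun z => ‖f z‖ₑ) t).le

/-- The kernel has mass one, so the error of mollification is an average of the differences between
`f` and its translates by vectors in the support of the kernel. -/
theorem lintegral_mollify_sub_le (n : ℕ) {f : E → ℝ} (hf : Integrable f μ) {C : ℝ≥0∞}
    (hC : ∀ t, ‖t‖ ≤ 1 / ((n : ℝ) + 1) → ∫⁻ z, ‖f (z - t) - f z‖ₑ ∂μ ≤ C) :
    ∫⁻ z, ‖mollify μ n f z - f z‖ₑ ∂μ ≤ C := by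
  refine le_trans (le_of_eq ?_) (lintegral_mollifier_average_le n (F := fun z t => f (z - t) - f z)
    ((aestronglyMeasurable_sub hf.1).sub hf.1.comp_fst) hC)
  refine lintegral_congr fun z => ?_
  simp only [mul_sub]
  rw [integral_sub (integrable_mollifier_mul n hf z)
    ((mollifier E n).integrable_normed.mul_const _), integral_mul_const,
    (mollifier E n).integral_normed, one_mul, mollify_apply]

theorem mollify_sub (n : ℕ) {f h : E → ℝ} (hf : Integrable f μ) (hh : Integrable h μ) (z : E) :
    mollify μ n (fun x => f x - h x) z = mollify μ n f z - mollify μ n h z := by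
  simp only [mollify_apply, mul_sub]
  exact integral_sub (integrable_mollifier_mul n hf z) (integrable_mollifier_mul n hh z)

theorem integrable_mollify (n : ℕ) {f : E → ℝ} (hf : Integrable f μ) :
    Integrable (mollify μ n f) μ :=
  (mollifier E n).integrable_normed.integrable_convolution _ hf

theorem contDiff_mollify (n : ℕ) {f : E → ℝ} (hf : LocallyIntegrable f μ) :
    ContDiff ℝ ∞ (mollify μ n f) :=
  (mollifier E n).hasCompactSupport_normed.contDiff_convolution_left _
    (mollifier E n).contDiff_normed hf

theorem abs_mollify_le (n : ℕ) {f : E → ℝ} (hf : AEStronglyMeasurable f μ) {C : ℝ}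
    (hC : ∀ x, |f x| ≤ C)
    (z : E) : |mollify μ n f z| ≤ C := by
  have := (mollifier E n).dist_normed_convolution_le (g := fun x => f x) (μ := μ) (x₀ := z)
    (ε := C) hf
  have hC0 : 0 ≤ C := (abs_nonneg _).trans (hC z)
  have h := dist_convolution_le (μ := μ) (g := f) (x₀ := z) (z₀ := 0) hC0
    (mollifier E n).support_normed_eq.subset (mollifier E n).nonneg_normed
    (mollifier E n).integral_normed hf (fun x _ => by simpa using hC x)
  simpa [mollify] using h

/-- All kernels live in the unit ball, so one thickening, by `1`, serves every `n` in the dominated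
convergence arguments. -/
theorem mollify_eq_zero (n : ℕ) {f : E → ℝ} {K : Set E} (hf : ∀ x ∉ K, f x = 0) {z : E}
    (hz : z ∉ Metric.cthickening 1 K) : mollify μ n f z = 0 := by
  rw [mollify_apply]
  refine integral_eq_zero_of_ae (Eventually.of_forall fun t => ?_)
  by_cases ht : ‖t‖ < 1 / ((n : ℝ) + 1)
  · have : z - t ∉ K := fun h => hz <| Metric.mem_cthickening_of_dist_le _ _ _ _ h <| by
      have : (1 : ℝ) / (n + 1) ≤ 1 := by
        rw [div_le_one (by positivity)]; linarith [n.cast_nonneg (α := ℝ)]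
      simpa [dist_eq_norm] using ht.le.trans this
    simp [hf _ this]
  · have : (mollifier E n).normed μ t = 0 := by
      rw [← Function.notMem_support, ContDiffBump.support_normed_eq]
      simpa [mollifier] using ht
    simp [this]

theorem tendsto_lintegral_mollify_sub_of_continuous {h : E → ℝ} (hc : Continuous h)
    (hs : HasCompactSupport h) :
    Tendsto (fun n => ∫⁻ z, ‖mollify μ n h z - h z‖ₑ ∂μ) atTop (𝓝 0) := by
  obtain ⟨C, hC⟩ := hs.exists_bound_of_continuous hc
  set K := Metric.cthickening 1 (tsupport h)
  have hK : IsCompact K := IsCompact.cthickening hs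
  have hcn : ∀ n, Continuous (mollify μ n h) :=
    fun n => (contDiff_mollify n hc.locallyIntegrable).continuous
  have := tendsto_lintegral_of_dominated_convergence (μ := μ) (f := fun _ => 0)
    (F := fun n z => ‖mollify μ n h z - h z‖ₑ) (K.indicator fun _ => ENNReal.ofReal (C + C))
    (fun n => ((hcn n).sub hc).measurable.enorm) (fun n => Eventually.of_forall fun z => ?_) ?_
    (Eventually.of_forall fun z => ?_)
  · simpa using this
  · by_cases hz : z ∈ K
    · simp only [Set.indicator_of_mem hz]
      rw [← ofReal_norm]
      refine ENNReal.ofReal_le_ofReal ((norm_sub_le _ _).trans (add_le_add ?_ (hC z)))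
      exact abs_mollify_le n hc.aestronglyMeasurable hC z
    · have h1 : mollify μ n h z = 0 := mollify_eq_zero n (fun x hx => image_eq_zero_of_notMem_tsupport hx) hz
      have h2 : h z = 0 := image_eq_zero_of_notMem_tsupport
        (fun hx => hz (Metric.self_subset_cthickening _ hx))
      simp [h1, h2]
  · rw [lintegral_indicator hK.measurableSet, setLIntegral_const]
    exact ENNReal.mul_ne_top ENNReal.ofReal_ne_top hK.measure_lt_top.ne
  · have := (ContDiffBump.convolution_tendsto_right_of_continuous (μ := μ)
      (tendsto_mollifier_rOut (E := E)) hc z).sub_const (h z)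
    rw [sub_self] at this
    simpa [mollify] using this.enorm

/-- Continuous functions of compact support are dense in `L¹`, and mollification is a contraction of
`L¹`. -/
theorem tendsto_lintegral_mollify_sub {f : E → ℝ} (hf : Integrable f μ) :
    Tendsto (fun n => ∫⁻ z, ‖mollify μ n f z - f z‖ₑ ∂μ) atTop (𝓝 0) := by
  rw [ENNReal.tendsto_nhds_zero]
  intro ε hε
  obtain ⟨h, hs, hle, hc, hi⟩ := hf.exists_hasCompactSupport_lintegral_sub_le
    (ε := ε / 3) (ENNReal.div_pos hε.ne' (by norm_num)).ne'
  have hle' : ∫⁻ z, ‖h z - f z‖ₑ ∂μ ≤ ε / 3 := by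
    simpa only [enorm_sub_rev] using hle
  have hev := (ENNReal.tendsto_nhds_zero.1
    (tendsto_lintegral_mollify_sub_of_continuous (μ := μ) hc hs)) (ε / 3)
    (ENNReal.div_pos hε.ne' (by norm_num))
  filter_upwards [hev] with n hn
  have hfh : Integrable (fun x => f x - h x) μ := hf.sub hi
  calc ∫⁻ z, ‖mollify μ n f z - f z‖ₑ ∂μ
      ≤ ∫⁻ z, (‖mollify μ n (fun x => f x - h x) z‖ₑ +
          ‖mollify μ n h z - h z‖ₑ) + ‖h z - f z‖ₑ ∂μ := by
        refine lintegral_mono fun z => ?_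
        rw [mollify_sub n hf hi]
        refine le_trans (le_of_eq ?_) ((enorm_add_le _ _).trans
          (add_le_add_left (enorm_add_le _ _) _))
        congr 1; ring
    _ = (∫⁻ z, ‖mollify μ n (fun x => f x - h x) z‖ₑ ∂μ +
          ∫⁻ z, ‖mollify μ n h z - h z‖ₑ ∂μ) + ∫⁻ z, ‖h z - f z‖ₑ ∂μ := by
        have hm : AEMeasurable (fun z => ‖h z - f z‖ₑ) μ := (hi.sub hf).1.enorm
        rw [lintegral_add_right' _ hm,
          lintegral_add_left' (integrable_mollify n hfh).1.enorm]
    _ ≤ (ε / 3 + ε / 3) + ε / 3 := by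
        gcongr
        exact (lintegral_mollify_le n hfh.1).trans hle
    _ = ε := ENNReal.add_thirds ε

/-- `G` is the weak derivative of `f` in the direction `v` on the set `T`. -/
def HasWeakDerivOn (μ : Measure E) (T : Set E) (v : E) (f G : E → ℝ) : Prop :=
  ∀ η : E → ℝ, ContDiff ℝ ∞ η → HasCompactSupport η → tsupport η ⊆ T →
    ∫ x, f x * fderiv ℝ η x v ∂μ = -∫ x, G x * η x ∂μ

/-- The derivative of a convolution falls on the kernel, and the reflected kernel `t ↦ ρ (z - t)` is
a test function for the weak derivative; the reflection absorbs the minus sign. -/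
theorem fderiv_mollify {f G : E → ℝ} {v : E} (hf : LocallyIntegrable f μ)
    (h : HasWeakDerivOn μ Set.univ v f G) (n : ℕ) (z : E) :
    fderiv ℝ (mollify μ n f) z v = mollify μ n G z := by
  set ρ := (mollifier E n).normed μ with hρ
  have hρc : ContDiff ℝ ∞ ρ := (mollifier E n).contDiff_normed
  have hρs : HasCompactSupport ρ := (mollifier E n).hasCompactSupport_normed
  have hd := hρs.hasFDerivAt_convolution_left (ContinuousLinearMap.lsmul ℝ ℝ) (μ := μ)
    (hρc.of_le (by simp)) hf z
  have hd' : HasFDerivAt (mollify μ n f) _ z := hd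
  rw [hd'.fderiv]
  have hex : ConvolutionExistsAt (fderiv ℝ ρ) f z
      ((ContinuousLinearMap.lsmul ℝ ℝ).precompL E) μ :=
    (hρs.fderiv ℝ).convolutionExists_left _ (hρc.continuous_fderiv (by simp)) hf z
  rw [convolution_eq_swap, ContinuousLinearMap.integral_apply hex.integrable_swap,
    mollify_apply_swap]
  have hη : ContDiff ℝ ∞ (fun t => ρ (z - t)) := hρc.comp (contDiff_const.sub contDiff_id)
  have hηs : HasCompactSupport (fun t => ρ (z - t)) :=
    hρs.comp_homeomorph (Homeomorph.subLeft z)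
  have key := h _ hη hηs (Set.subset_univ _)
  have hfd : ∀ t, fderiv ℝ (fun t => ρ (z - t)) t v = -fderiv ℝ ρ (z - t) v := fun t => by
    have h1 : HasFDerivAt ρ (fderiv ℝ ρ (z - t)) (z - t) :=
      (hρc.differentiable (by simp) _).hasFDerivAt
    have h2 := h1.comp t ((hasFDerivAt_id t).const_sub z)
    have h3 : HasFDerivAt (fun t => ρ (z - t)) _ t := h2
    rw [h3.fderiv]; simp
  simp only [hfd, mul_neg, integral_neg, neg_inj] at key
  calc _ = ∫ x, f x * fderiv ℝ ρ (z - x) v ∂μ :=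
        integral_congr_ae (Eventually.of_forall fun x => by
          simp [ContinuousLinearMap.precompL_apply, mul_comm])
    _ = _ := by rw [key]; exact integral_congr_ae (Eventually.of_forall fun x => mul_comm _ _)

end Mollification

/-! ### Weak derivatives: chain rule, cut-offs and translations. -/

section WeakDerivative

variable {E : Type*} [NormedAddCommGroup E] [NormedSpace ℝ E] [FiniteDimensional ℝ E]
  [MeasurableSpace E] [BorelSpace E] {μ : Measure E} [μ.IsAddHaarMeasure]

theorem integrable_mul_of_tsupport_subset {T : Set E} {f c : E → ℝ}
    (hf : LocallyIntegrableOn f T μ) (hc : Continuous c) (hcs : HasCompactSupport c)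
    (hcT : tsupport c ⊆ T) : Integrable (fun x => f x * c x) μ := by
  have h1 : IntegrableOn f (tsupport c) μ := hf.integrableOn_compact_subset hcT hcs
  have h2 : IntegrableOn (fun x => f x * c x) (tsupport c) μ :=
    h1.mul_continuousOn hc.continuousOn hcs
  refine (integrableOn_iff_integrable_of_support_subset fun x hx => ?_).1 h2
  exact subset_tsupport c fun h => hx (by simp [h])

theorem continuous_fderiv_apply {η : E → ℝ} (hη : ContDiff ℝ ∞ η) (v : E) :
    Continuous fun x => fderiv ℝ η x v :=
  (hη.continuous_fderiv (by simp)).clm_apply continuous_const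

theorem hasCompactSupport_fderiv_apply {η : E → ℝ} (hs : HasCompactSupport η) (v : E) :
    HasCompactSupport fun x => fderiv ℝ η x v :=
  (hs.fderiv ℝ).comp_left (g := fun L : E →L[ℝ] ℝ => L v) rfl

theorem tsupport_fderiv_apply_subset (η : E → ℝ) (v : E) :
    tsupport (fun x => fderiv ℝ η x v) ⊆ tsupport η :=
  (closure_mono (t := Function.support (fderiv ℝ η))
    fun x (hx : fderiv ℝ η x v ≠ 0) h => hx (by rw [h]; rfl)).trans (tsupport_fderiv_subset ℝ)

theorem ae_tendsto_mollify {f : E → ℝ} (hf : LocallyIntegrable f μ) :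
    ∀ᵐ z ∂μ, Tendsto (fun n => mollify μ n f z) atTop (𝓝 (f z)) := by
  refine ContDiffBump.ae_convolution_tendsto_right_of_locallyIntegrable (K := 2)
    tendsto_mollifier_rOut (Eventually.of_forall fun n => le_of_eq ?_) hf
  simp only [mollifier]
  field_simp

/-- The chain rule for integrable functions with an integrable weak derivative. -/
theorem HasWeakDerivOn.comp_univ {f G : E → ℝ} {v : E} (hf : Integrable f μ) (hG : Integrable G μ)
    (h : HasWeakDerivOn μ Set.univ v f G) {ψ ψ' : ℝ → ℝ} {C : ℝ}
    (hψ : ∀ t, HasDerivAt ψ (ψ' t) t) (hψ' : Continuous ψ') (hC : ∀ t, |ψ t| ≤ C)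
    (hC' : ∀ t, |ψ' t| ≤ C) :
    HasWeakDerivOn μ Set.univ v (fun x => ψ (f x)) (fun x => ψ' (f x) * G x) := by
  intro η hη hηs _
  have hψc : Continuous ψ := continuous_iff_continuousAt.2 fun t => (hψ t).continuousAt
  set F : ℕ → E → ℝ := fun n => mollify μ n f
  have hFs : ∀ n, ContDiff ℝ ∞ (F n) := fun n => contDiff_mollify n hf.locallyIntegrable
  have hFc : ∀ n, Continuous (F n) := fun n => (hFs n).continuous
  have hGc : ∀ n, Continuous (mollify μ n G) :=
    fun n => (contDiff_mollify n hG.locallyIntegrable).continuous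
  have hηc := hη.continuous
  have hfd : ∀ n x, HasFDerivAt (fun x => ψ (F n x)) (ψ' (F n x) • fderiv ℝ (F n) x) x :=
    fun n x => (hψ _).comp_hasFDerivAt x ((hFs n).differentiable (by simp) x).hasFDerivAt
  have hfdv : ∀ n x, fderiv ℝ (fun x => ψ (F n x)) x v = ψ' (F n x) * mollify μ n G x :=
    fun n x => by
      rw [(hfd n x).fderiv, ← fderiv_mollify hf.locallyIntegrable h]; rfl
  have hdη := continuous_fderiv_apply hη v
  have hdηs := hasCompactSupport_fderiv_apply hηs v
  have hC0 : 0 ≤ C := (abs_nonneg _).trans (hC 0)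
  -- For the smooth mollifications this is the classical chain rule and integration by parts; the
  -- rest of the proof lets `n` tend to infinity.
  have ibp : ∀ n, ∫ x, ψ (F n x) * fderiv ℝ η x v ∂μ =
      -∫ x, ψ' (F n x) * mollify μ n G x * η x ∂μ := fun n => by
    have := integral_mul_fderiv_eq_neg_fderiv_mul_of_integrable (μ := μ)
      (f := fun x => ψ (F n x)) (g := η) (v := v) ?_ ?_ ?_
      (fun x _ => (hfd n x).differentiableAt) (fun x _ => hη.differentiable (by simp) x)
    · simpa only [hfdv] using this
    · simp only [hfdv]
      exact (((hψ'.comp (hFc n)).mul (hGc n)).mul hηc).integrable_of_hasCompactSupport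
        hηs.mul_left
    · exact ((hψc.comp (hFc n)).mul hdη).integrable_of_hasCompactSupport hdηs.mul_left
    · exact ((hψc.comp (hFc n)).mul hηc).integrable_of_hasCompactSupport hηs.mul_left
  have hae := ae_tendsto_mollify (μ := μ) hf.locallyIntegrable
  have lim1 : Tendsto (fun n => ∫ x, ψ (F n x) * fderiv ℝ η x v ∂μ) atTop
      (𝓝 (∫ x, ψ (f x) * fderiv ℝ η x v ∂μ)) := by
    refine tendsto_integral_of_dominated_convergence (fun x => C * |fderiv ℝ η x v|)
      (fun n => ((hψc.comp (hFc n)).mul hdη).aestronglyMeasurable)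
      ((hdη.integrable_of_hasCompactSupport hdηs).abs.const_mul C)
      (fun n => Eventually.of_forall fun x => ?_) ?_
    · rw [Real.norm_eq_abs, abs_mul]
      exact mul_le_mul_of_nonneg_right (hC _) (abs_nonneg _)
    · filter_upwards [hae] with x hx
      exact ((hψc.tendsto _).comp hx).mul_const _
  obtain ⟨B, hB⟩ := hηs.exists_bound_of_continuous hηc
  have hB0 : 0 ≤ B := (norm_nonneg _).trans (hB 0)
  have bdd : ∀ n x, ‖ψ' (F n x) * η x‖ ≤ C * B := fun n x => by
    rw [norm_mul]
    exact mul_le_mul (hC' _) (hB _) (norm_nonneg _) hC0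
  have cont : ∀ n, Continuous fun x => ψ' (F n x) * η x :=
    fun n => (hψ'.comp (hFc n)).mul hηc
  -- The mollified derivative is split as `(Gₙ - G) + G`: the first part vanishes by convergence in
  -- `L¹` against a bounded factor, and in the second only `ψ' (Fₙ)` varies, dominated by a multiple
  -- of `|G|`.
  have i1 : ∀ n, Integrable (fun x => (mollify μ n G x - G x) * (ψ' (F n x) * η x)) μ := fun n =>
    ((integrable_mollify n hG).sub hG).mul_bdd (cont n).aestronglyMeasurable
      (Eventually.of_forall (bdd n))
  have i2 : ∀ n, Integrable (fun x => G x * (ψ' (F n x) * η x)) μ := fun n =>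
    hG.mul_bdd (cont n).aestronglyMeasurable (Eventually.of_forall (bdd n))
  have lim2 : Tendsto (fun n => ∫ x, (mollify μ n G x - G x) * (ψ' (F n x) * η x) ∂μ) atTop
      (𝓝 0) := by
    rw [tendsto_zero_iff_enorm_tendsto_zero]
    have hz : Tendsto (fun n => (∫⁻ z, ‖mollify μ n G z - G z‖ₑ ∂μ) * ENNReal.ofReal (C * B)) atTop
        (𝓝 0) := by
      simpa using ENNReal.Tendsto.mul_const (tendsto_lintegral_mollify_sub hG)
        (Or.inr ENNReal.ofReal_ne_top)
    refine tendsto_of_tendsto_of_tendsto_of_le_of_le tendsto_const_nhds hz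
      (fun _ => zero_le) fun n => ?_
    refine (enorm_integral_le_lintegral_enorm _).trans ?_
    rw [← lintegral_mul_const' _ _ ENNReal.ofReal_ne_top]
    refine lintegral_mono fun x => ?_
    rw [enorm_mul]
    gcongr
    rw [← ofReal_norm]
    exact ENNReal.ofReal_le_ofReal (bdd n x)
  have lim3 : Tendsto (fun n => ∫ x, G x * (ψ' (F n x) * η x) ∂μ) atTop
      (𝓝 (∫ x, G x * (ψ' (f x) * η x) ∂μ)) := by
    refine tendsto_integral_of_dominated_convergence (fun x => |G x| * (C * B))
      (fun n => (i2 n).1) (hG.abs.mul_const _)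
      (fun n => Eventually.of_forall fun x => ?_) ?_
    · rw [norm_mul]
      exact mul_le_mul_of_nonneg_left (bdd n x) (norm_nonneg _)
    · filter_upwards [hae] with x hx
      exact (((hψ'.tendsto _).comp hx).mul_const _).const_mul _
  have lim4 : Tendsto (fun n => ∫ x, ψ (F n x) * fderiv ℝ η x v ∂μ) atTop
      (𝓝 (-(0 + ∫ x, G x * (ψ' (f x) * η x) ∂μ))) := by
    refine (lim2.add lim3).neg.congr fun n => ?_
    rw [ibp n, ← integral_add (i1 n) (i2 n)]
    congr 1
    exact integral_congr_ae (Eventually.of_forall fun x => by simp only; ring)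
  rw [tendsto_nhds_unique lim1 lim4, zero_add]
  congr 1
  exact integral_congr_ae (Eventually.of_forall fun x => by simp only; ring)

/-- Multiplication by a cut-off function extends weak derivatives to the whole space. -/
theorem HasWeakDerivOn.mul_cutoff {T : Set E} {f G χ : E → ℝ} {v : E}
    (hf : LocallyIntegrableOn f T μ) (hG : LocallyIntegrableOn G T μ)
    (h : HasWeakDerivOn μ T v f G) (hχ : ContDiff ℝ ∞ χ) (hχs : HasCompactSupport χ)
    (hχT : tsupport χ ⊆ T) :
    HasWeakDerivOn μ Set.univ v (fun x => f x * χ x)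
      (fun x => G x * χ x + f x * fderiv ℝ χ x v) := by
  intro η hη hηs _
  -- The product with the cut-off is an admissible test function on `T`, whatever the support of
  -- `η`.
  have key := h (fun x => χ x * η x) (hχ.mul hη) hχs.mul_right
    ((tsupport_mul_subset_left).trans hχT)
  have hfd : ∀ x, fderiv ℝ (fun x => χ x * η x) x v =
      χ x * fderiv ℝ η x v + η x * fderiv ℝ χ x v := fun x => by
    rw [fderiv_fun_mul (hχ.differentiable (by simp) x) (hη.differentiable (by simp) x)]
    simp
  simp only [hfd] at key
  have hdχ := continuous_fderiv_apply hχ v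
  have hdη := continuous_fderiv_apply hη v
  have i1 : Integrable (fun x => f x * (χ x * fderiv ℝ η x v)) μ :=
    integrable_mul_of_tsupport_subset hf (hχ.continuous.mul hdη) hχs.mul_right
      ((tsupport_mul_subset_left).trans hχT)
  have i2 : Integrable (fun x => f x * (fderiv ℝ χ x v * η x)) μ :=
    integrable_mul_of_tsupport_subset hf (hdχ.mul hη.continuous)
      (hasCompactSupport_fderiv_apply hχs v).mul_right
      ((tsupport_mul_subset_left).trans ((tsupport_fderiv_apply_subset χ v).trans hχT))
  have i3 : Integrable (fun x => G x * (χ x * η x)) μ :=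
    integrable_mul_of_tsupport_subset hG (hχ.continuous.mul hη.continuous) hχs.mul_right
      ((tsupport_mul_subset_left).trans hχT)
  have e1 : ∫ x, f x * (χ x * fderiv ℝ η x v + η x * fderiv ℝ χ x v) ∂μ =
      ∫ x, f x * (χ x * fderiv ℝ η x v) ∂μ + ∫ x, f x * (fderiv ℝ χ x v * η x) ∂μ := by
    rw [← integral_add i1 i2]
    exact integral_congr_ae (Eventually.of_forall fun x => by simp only; ring)
  have e2 : ∫ x, (G x * χ x + f x * fderiv ℝ χ x v) * η x ∂μ =
      ∫ x, G x * (χ x * η x) ∂μ + ∫ x, f x * (fderiv ℝ χ x v * η x) ∂μ := by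
    rw [← integral_add i3 i2]
    exact integral_congr_ae (Eventually.of_forall fun x => by simp only; ring)
  have e3 : ∫ x, f x * χ x * fderiv ℝ η x v ∂μ = ∫ x, f x * (χ x * fderiv ℝ η x v) ∂μ :=
    integral_congr_ae (Eventually.of_forall fun x => by simp only; ring)
  rw [e1] at key
  rw [e2, e3]
  linarith

/-- The value `1` on a neighbourhood of `K`, not only on `K`, makes the derivative of the cut-off
vanish on `K`. -/
theorem exists_smooth_cutoff {K T : Set E} (hK : IsCompact K) (hT : IsOpen T) (hKT : K ⊆ T) :
    ∃ χ : E → ℝ, ContDiff ℝ ∞ χ ∧ HasCompactSupport χ ∧ tsupport χ ⊆ T ∧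
      ∀ᶠ x in 𝓝ˢ K, χ x = 1 := by
  obtain ⟨L, hL, hKL, hLT⟩ := exists_compact_between hK hT hKT
  obtain ⟨χ, h1, h0, -⟩ := exists_contMDiffMap_one_nhds_of_subset_interior (n := (⊤ : ℕ∞)) 𝓘(ℝ, E)
    hK.isClosed hKL
  have hsub : tsupport χ ⊆ L := closure_minimal
    (fun x hx => by_contra fun h => hx (h0 x h)) hL.isClosed
  exact ⟨χ, χ.contMDiff.contDiff, hL.of_isClosed_subset (isClosed_tsupport _) hsub,
    hsub.trans hLT, h1⟩

/-- The chain rule for weak derivatives on an open set. -/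
theorem HasWeakDerivOn.comp {T : Set E} (hT : IsOpen T) {f G : E → ℝ} {v : E}
    (hf : LocallyIntegrableOn f T μ) (hG : LocallyIntegrableOn G T μ)
    (h : HasWeakDerivOn μ T v f G) {ψ ψ' : ℝ → ℝ} {C : ℝ}
    (hψ : ∀ t, HasDerivAt ψ (ψ' t) t) (hψ' : Continuous ψ') (hC : ∀ t, |ψ t| ≤ C)
    (hC' : ∀ t, |ψ' t| ≤ C) :
    HasWeakDerivOn μ T v (fun x => ψ (f x)) (fun x => ψ' (f x) * G x) := by
  intro η hη hηs hηT
  obtain ⟨χ, hχ, hχs, hχT, h1⟩ := exists_smooth_cutoff hηs hT hηT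
  have hdχ := continuous_fderiv_apply hχ v
  have i1 := integrable_mul_of_tsupport_subset hf hχ.continuous hχs hχT
  have i2 := integrable_mul_of_tsupport_subset hG hχ.continuous hχs hχT
  have i3 := integrable_mul_of_tsupport_subset hf hdχ (hasCompactSupport_fderiv_apply hχs v)
    ((tsupport_fderiv_apply_subset χ v).trans hχT)
  -- The global chain rule is applied to `f χ`. On the support of `η` the cut-off is `1` with zero
  -- derivative, so it disappears from both integrals.
  have key := (h.mul_cutoff hf hG hχ hχs hχT).comp_univ i1 (i2.add i3) hψ hψ' hC hC' η hη hηs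
    (Set.subset_univ _)
  rw [eventually_nhdsSet_iff_forall] at h1
  have e1 : ∀ x ∈ tsupport η, χ x = 1 := fun x hx => by
    have h2 : χ =ᶠ[𝓝 x] fun _ => (1 : ℝ) := h1 x hx
    exact h2.self_of_nhds
  have e2 : ∀ x ∈ tsupport η, fderiv ℝ χ x v = 0 := fun x hx => by
    have h2 : χ =ᶠ[𝓝 x] fun _ => (1 : ℝ) := h1 x hx
    rw [h2.fderiv_eq]; simp
  convert key using 1
  · refine integral_congr_ae (Eventually.of_forall fun x => ?_)
    by_cases hx : x ∈ tsupport η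
    · simp [e1 x hx]
    · have : fderiv ℝ η x v = 0 :=
        image_eq_zero_of_notMem_tsupport (f := fun x => fderiv ℝ η x v)
          fun h => hx (tsupport_fderiv_apply_subset η v h)
      simp [this]
  · congr 1
    refine integral_congr_ae (Eventually.of_forall fun x => ?_)
    by_cases hx : x ∈ tsupport η
    · simp [e1 x hx, e2 x hx]
    · simp [image_eq_zero_of_notMem_tsupport hx]

/-- The difference is the integral of the derivative along the segment from `z` to `z - y`; after
Tonelli, every point of the segment contributes the same integral by translation invariance. -/
theorem lintegral_translate_sub_le_of_contDiff {h : E → ℝ} (hh : ContDiff ℝ ∞ h) (y : E) :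
    ∫⁻ z, ‖h (z - y) - h z‖ₑ ∂μ ≤ ∫⁻ z, ‖fderiv ℝ h z y‖ₑ ∂μ := by
  have hc : Continuous fun x => fderiv ℝ h x y := continuous_fderiv_apply hh y
  have hft : ∀ z, h (z - y) - h z = ∫ s in (0 : ℝ)..1, -fderiv ℝ h (z - s • y) y := fun z => by
    have hd : ∀ s ∈ Set.uIcc (0 : ℝ) 1, HasDerivAt (fun s : ℝ => h (z - s • y))
        (-fderiv ℝ h (z - s • y) y) s := fun s _ => by
      have h1 : HasFDerivAt h (fderiv ℝ h (z - s • y)) (z - s • y) :=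
        (hh.differentiable (by simp) _).hasFDerivAt
      have h2 : HasDerivAt (fun s : ℝ => z - s • y) (-y) s := by
        simpa using ((hasDerivAt_id s).smul_const y).const_sub z
      have := h1.comp_hasDerivAt s h2
      simpa [Function.comp_def] using this
    rw [intervalIntegral.integral_eq_sub_of_hasDerivAt hd]
    · simp
    · refine Continuous.intervalIntegrable ?_ _ _
      exact (hc.comp (by fun_prop : Continuous fun s : ℝ => z - s • y)).neg
  calc ∫⁻ z, ‖h (z - y) - h z‖ₑ ∂μ
      ≤ ∫⁻ z, ∫⁻ s in Set.Ioc (0 : ℝ) 1, ‖fderiv ℝ h (z - s • y) y‖ₑ ∂volume ∂μ := by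
        refine lintegral_mono fun z => ?_
        rw [hft z, intervalIntegral.integral_of_le zero_le_one]
        refine (enorm_integral_le_lintegral_enorm _).trans_eq ?_
        simp only [enorm_neg]
    _ = ∫⁻ s in Set.Ioc (0 : ℝ) 1, ∫⁻ z, ‖fderiv ℝ h (z - s • y) y‖ₑ ∂μ ∂volume := by
        refine lintegral_lintegral_swap ?_
        exact (hc.comp (by fun_prop : Continuous fun p : E × ℝ => p.1 - p.2 • y)).enorm.measurable.aemeasurable
    _ = ∫⁻ s in Set.Ioc (0 : ℝ) 1, ∫⁻ z, ‖fderiv ℝ h z y‖ₑ ∂μ ∂volume :=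
        lintegral_congr fun s =>
          lintegral_sub_right_eq_self (fun z => ‖fderiv ℝ h z y‖ₑ) (s • y)
    _ = ∫⁻ z, ‖fderiv ℝ h z y‖ₑ ∂μ := by simp

end WeakDerivative

/-! ### Rellich's theorem in Euclidean space. -/

section Compactness

variable {N : ℕ}

local notation "E" => EuclideanSpace ℝ (Fin N)

/-- The smooth estimate holds for each mollification with a bound that does not depend on `n`,
because mollification does not increase the `L¹` norms of the `G i`; convergence in `L¹` carries it
to `f`. -/
theorem lintegral_translate_sub_le {f : E → ℝ} {G : Fin N → E → ℝ} (hf : Integrable f)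
    (hG : ∀ i, Integrable (G i))
    (h : ∀ i, HasWeakDerivOn volume Set.univ (EuclideanSpace.single i (1 : ℝ)) f (G i)) (y : E) :
    ∫⁻ z, ‖f (z - y) - f z‖ₑ ≤ ‖y‖ₑ * ∑ i, ∫⁻ z, ‖G i z‖ₑ := by
  have smooth : ∀ n, ∫⁻ z, ‖mollify volume n f (z - y) - mollify volume n f z‖ₑ ≤
      ‖y‖ₑ * ∑ i, ∫⁻ z, ‖G i z‖ₑ := fun n => by
    have hs := contDiff_mollify (μ := volume) n hf.locallyIntegrable
    refine (lintegral_translate_sub_le_of_contDiff hs y).trans ?_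
    calc ∫⁻ z, ‖fderiv ℝ (mollify volume n f) z y‖ₑ
        ≤ ∫⁻ z, ‖y‖ₑ * ∑ i, ‖mollify volume n (G i) z‖ₑ := by
          refine lintegral_mono fun z => ?_
          have hy : y = ∑ i, y i • EuclideanSpace.single i (1 : ℝ) := by
            conv_lhs => rw [← (EuclideanSpace.basisFun (Fin N) ℝ).sum_repr y]
            simp
          have : fderiv ℝ (mollify volume n f) z y = ∑ i, y i * mollify volume n (G i) z := by
            conv_lhs => rw [hy]
            rw [map_sum]
            refine Finset.sum_congr rfl fun i _ => ?_
            rw [map_smul, fderiv_mollify hf.locallyIntegrable (h i), smul_eq_mul]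
          rw [this, Finset.mul_sum]
          refine (enorm_sum_le _ _).trans (Finset.sum_le_sum fun i _ => ?_)
          rw [enorm_mul]
          gcongr
          rw [← ofReal_norm, ← ofReal_norm]
          exact ENNReal.ofReal_le_ofReal (PiLp.norm_apply_le y i)
      _ = ‖y‖ₑ * ∑ i, ∫⁻ z, ‖mollify volume n (G i) z‖ₑ := by
          rw [lintegral_const_mul' _ _ enorm_ne_top, lintegral_finsetSum']
          exact fun i _ => (integrable_mollify n (hG i)).1.enorm
      _ ≤ _ := by
          exact mul_le_mul_right (Finset.sum_le_sum fun i _ => lintegral_mollify_le n (hG i).1) _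
  have hlim := tendsto_lintegral_mollify_sub (μ := volume) hf
  have hle : ∀ n, ∫⁻ z, ‖f (z - y) - f z‖ₑ ≤
      ((∫⁻ z, ‖mollify volume n f z - f z‖ₑ) + ‖y‖ₑ * ∑ i, ∫⁻ z, ‖G i z‖ₑ) +
        ∫⁻ z, ‖mollify volume n f z - f z‖ₑ := fun n => by
    have hc := (contDiff_mollify (μ := volume) n hf.locallyIntegrable).continuous
    have m1 : AEMeasurable (fun z => ‖mollify volume n f z - f z‖ₑ) volume :=
      (hc.aestronglyMeasurable.sub hf.1).enorm
    have m2 : AEMeasurable (fun z => ‖mollify volume n f (z - y) - mollify volume n f z‖ₑ)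
        volume :=
      ((hc.comp (continuous_id.sub continuous_const)).sub hc).enorm.measurable.aemeasurable
    have e : ∫⁻ z, ‖mollify volume n f (z - y) - f (z - y)‖ₑ =
        ∫⁻ z, ‖mollify volume n f z - f z‖ₑ :=
      lintegral_sub_right_eq_self (fun z => ‖mollify volume n f z - f z‖ₑ) y
    calc ∫⁻ z, ‖f (z - y) - f z‖ₑ
        ≤ ∫⁻ z, (‖mollify volume n f (z - y) - f (z - y)‖ₑ +
            ‖mollify volume n f (z - y) - mollify volume n f z‖ₑ) +
            ‖mollify volume n f z - f z‖ₑ := by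
          refine lintegral_mono fun z => ?_
          rw [enorm_sub_rev (mollify volume n f (z - y)) (f (z - y))]
          refine le_trans (le_of_eq ?_) ((enorm_add_le _ _).trans
            (add_le_add_left (enorm_add_le _ _) _))
          congr 1; ring
      _ = ((∫⁻ z, ‖mollify volume n f (z - y) - f (z - y)‖ₑ) +
            ∫⁻ z, ‖mollify volume n f (z - y) - mollify volume n f z‖ₑ) +
            ∫⁻ z, ‖mollify volume n f z - f z‖ₑ := by
          rw [lintegral_add_right' _ m1, lintegral_add_right' _ m2]
      _ ≤ _ := by
          rw [e]
          gcongr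
          exact smooth n
  have := (hlim.add (tendsto_const_nhds (x := ‖y‖ₑ * ∑ i, ∫⁻ z, ‖G i z‖ₑ))).add hlim
  rw [zero_add, add_zero] at this
  exact ge_of_tendsto' this hle

/-- A form of Rellich's theorem: convergence of all mollifications improves to convergence
in `L¹`, for functions with common compact support whose weak derivatives are bounded in `L¹`. -/
theorem tendsto_lintegral_sub_of_weakDeriv {f : ℕ → E → ℝ} {G : ℕ → Fin N → E → ℝ} {F : E → ℝ}
    {K : Set E} (hK : IsCompact K) {B : ℝ} (hB : ∀ i x, |f i x| ≤ B)
    (hsupp : ∀ i, ∀ x ∉ K, f i x = 0)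
    (hf : ∀ i, Integrable (f i)) (hG : ∀ i j, Integrable (G i j))
    (h : ∀ i j, HasWeakDerivOn volume Set.univ (EuclideanSpace.single j (1 : ℝ)) (f i) (G i j))
    {C : ℝ≥0∞} (hCtop : C ≠ ⊤) (hC : ∀ i, ∑ j, ∫⁻ z, ‖G i j z‖ₑ ≤ C) (hF : Integrable F)
    (hlim : ∀ n z, Tendsto (fun i => mollify volume n (f i) z) atTop (𝓝 (mollify volume n F z))) :
    Tendsto (fun i => ∫⁻ z, ‖f i z - F z‖ₑ) atTop (𝓝 0) := by
  have hK1 : IsCompact (Metric.cthickening 1 K) := hK.cthickening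
  -- This bound is uniform in `i`, so the scale `n` can be fixed first and only then `i` sent to
  -- infinity.
  have near : ∀ n i, ∫⁻ z, ‖mollify volume n (f i) z - f i z‖ₑ ≤
      ENNReal.ofReal (1 / ((n : ℝ) + 1)) * C := fun n i => by
    refine lintegral_mollify_sub_le n (hf i) fun t ht => ?_
    refine (lintegral_translate_sub_le (hf i) (hG i) (h i) t).trans ?_
    refine mul_le_mul' ?_ (hC i)
    rw [← ofReal_norm]
    exact ENNReal.ofReal_le_ofReal ht
  -- At a fixed scale, pointwise convergence improves to `L¹` by domination: the mollifications are
  -- bounded by `B` and vanish off the unit thickening of `K`.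
  have mid : ∀ n, Tendsto (fun i => ∫⁻ z, ‖mollify volume n (f i) z - mollify volume n F z‖ₑ)
      atTop (𝓝 0) := fun n => by
    have hFi := integrable_mollify n hF
    have hc : ∀ i, Continuous (mollify volume n (f i)) :=
      fun i => (contDiff_mollify n (hf i).locallyIntegrable).continuous
    have := tendsto_lintegral_of_dominated_convergence' (μ := volume) (f := fun _ => 0)
      (F := fun i z => ‖mollify volume n (f i) z - mollify volume n F z‖ₑ)
      (fun z => (Metric.cthickening 1 K).indicator (fun _ => ENNReal.ofReal B) z +
        ‖mollify volume n F z‖ₑ)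
      (fun i => ((hc i).aestronglyMeasurable.sub hFi.1).enorm)
      (fun i => Eventually.of_forall fun z => ?_) ?_ (Eventually.of_forall fun z => ?_)
    · simpa using this
    · refine (enorm_sub_le).trans (add_le_add ?_ le_rfl)
      by_cases hz : z ∈ Metric.cthickening 1 K
      · rw [Set.indicator_of_mem hz, ← ofReal_norm]
        exact ENNReal.ofReal_le_ofReal (abs_mollify_le n (hf i).1 (hB i) z)
      · rw [mollify_eq_zero n (hsupp i) hz]; simp
    · rw [lintegral_add_left (measurable_const.indicator hK1.measurableSet),
        lintegral_indicator hK1.measurableSet, setLIntegral_const]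
      exact ENNReal.add_ne_top.2 ⟨ENNReal.mul_ne_top ENNReal.ofReal_ne_top hK1.measure_lt_top.ne,
        hFi.2.ne⟩
    · have := ((hlim n z).sub_const (mollify volume n F z)).enorm
      simpa using this
  have hFn := tendsto_lintegral_mollify_sub (μ := volume) hF
  have hn : Tendsto (fun n : ℕ => ENNReal.ofReal (1 / ((n : ℝ) + 1)) * C) atTop (𝓝 0) := by
    have := ENNReal.Tendsto.mul_const (b := C) (ENNReal.tendsto_ofReal
      (tendsto_one_div_add_atTop_nhds_zero_nat (𝕜 := ℝ))) (Or.inr hCtop)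
    simpa using this
  rw [ENNReal.tendsto_nhds_zero]
  intro ε hε
  have hε3 : 0 < ε / 3 := ENNReal.div_pos hε.ne' (by norm_num)
  obtain ⟨n, hn1, hn2⟩ := ((ENNReal.tendsto_nhds_zero.1 hn _ hε3).and
    (ENNReal.tendsto_nhds_zero.1 hFn _ hε3)).exists
  filter_upwards [ENNReal.tendsto_nhds_zero.1 (mid n) _ hε3] with i hi
  have hc : Continuous (mollify volume n (f i)) :=
    (contDiff_mollify n (hf i).locallyIntegrable).continuous
  have hFi := integrable_mollify n hF
  have m1 : AEMeasurable (fun z => ‖mollify volume n F z - F z‖ₑ) volume :=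
    (hFi.1.sub hF.1).enorm
  have m2 : AEMeasurable (fun z => ‖mollify volume n (f i) z - mollify volume n F z‖ₑ) volume :=
    (hc.aestronglyMeasurable.sub hFi.1).enorm
  calc ∫⁻ z, ‖f i z - F z‖ₑ
      ≤ ∫⁻ z, (‖mollify volume n (f i) z - f i z‖ₑ +
          ‖mollify volume n (f i) z - mollify volume n F z‖ₑ) +
          ‖mollify volume n F z - F z‖ₑ := by
        refine lintegral_mono fun z => ?_
        rw [enorm_sub_rev (mollify volume n (f i) z) (f i z)]
        refine le_trans (le_of_eq ?_) ((enorm_add_le _ _).trans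
          (add_le_add_left (enorm_add_le _ _) _))
        congr 1; ring
    _ = ((∫⁻ z, ‖mollify volume n (f i) z - f i z‖ₑ) +
          ∫⁻ z, ‖mollify volume n (f i) z - mollify volume n F z‖ₑ) +
          ∫⁻ z, ‖mollify volume n F z - F z‖ₑ := by
        rw [lintegral_add_right' _ m1, lintegral_add_right' _ m2]
    _ ≤ (ε / 3 + ε / 3) + ε / 3 := by
        gcongr
        exact (near n i).trans hn1
    _ = ε := ENNReal.add_thirds ε

end Compactness
-- The double well potential and the primitive of its root.
/-- The integrand `√(2W)`, cut off outside the interval between the wells. -/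
noncomputable def wellSlope (W : ℝ → ℝ) (t : ℝ) : ℝ := Real.sqrt (2 * W (max 0 (min t 1)))

/-- The primitive of `wellSlope`. -/
noncomputable def wellPrimitive (W : ℝ → ℝ) (t : ℝ) : ℝ := ∫ s in (0 : ℝ)..t, wellSlope W s

section Potential

variable {W : ℝ → ℝ}

theorem IsDoubleWell.continuous (hW : IsDoubleWell W) : Continuous W := hW.contDiff.continuous

theorem IsDoubleWell.eq_zero_iff (hW : IsDoubleWell W) {s : ℝ} : W s = 0 ↔ s = 0 ∨ s = 1 := by
  rw [← hW.global_min s]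
  refine ⟨fun h t => h ▸ hW.nonneg t, fun h => le_antisymm (hW.zero ▸ h 0) (hW.nonneg s)⟩

theorem IsDoubleWell.continuous_wellSlope (hW : IsDoubleWell W) : Continuous (wellSlope W) := by
  have := hW.continuous
  unfold wellSlope
  fun_prop

theorem wellSlope_nonneg (t : ℝ) : 0 ≤ wellSlope W t := Real.sqrt_nonneg _

theorem wellSlope_of_mem {t : ℝ} (ht : t ∈ Set.Icc (0 : ℝ) 1) :
    wellSlope W t = Real.sqrt (2 * W t) := by
  rw [wellSlope, min_eq_left ht.2, max_eq_right ht.1]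

theorem IsDoubleWell.wellSlope_of_nonpos (hW : IsDoubleWell W) {t : ℝ} (ht : t ≤ 0) :
    wellSlope W t = 0 := by
  rw [wellSlope, min_eq_left (ht.trans zero_le_one), max_eq_left ht, hW.zero]; simp

theorem IsDoubleWell.wellSlope_of_one_le (hW : IsDoubleWell W) {t : ℝ} (ht : 1 ≤ t) :
    wellSlope W t = 0 := by
  rw [wellSlope, min_eq_right ht, max_eq_right zero_le_one, hW.one]; simp

/-- Outside `[0, 1]` the argument is clamped to a well, where the potential vanishes, so the cut-off
can only decrease the integrand. -/
theorem IsDoubleWell.wellSlope_le (hW : IsDoubleWell W) (t : ℝ) :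
    wellSlope W t ≤ Real.sqrt (2 * W t) := by
  rcases le_total t 0 with h | h
  · rw [hW.wellSlope_of_nonpos h]; exact Real.sqrt_nonneg _
  rcases le_total 1 t with h1 | h1
  · rw [hW.wellSlope_of_one_le h1]; exact Real.sqrt_nonneg _
  · rw [wellSlope_of_mem ⟨h, h1⟩]

theorem IsDoubleWell.exists_wellSlope_le (hW : IsDoubleWell W) : ∃ C, ∀ t, |wellSlope W t| ≤ C := by
  obtain ⟨C, hC⟩ := (isCompact_Icc (a := (0 : ℝ)) (b := 1)).exists_bound_of_continuousOn
    (f := fun t => Real.sqrt (2 * W t))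
    (by have := hW.continuous; fun_prop)
  exact ⟨C, fun t => hC _ ⟨le_max_left _ _, max_le zero_le_one (min_le_right _ _)⟩⟩

theorem IsDoubleWell.hasDerivAt_wellPrimitive (hW : IsDoubleWell W) (t : ℝ) :
    HasDerivAt (wellPrimitive W) (wellSlope W t) t :=
  hW.continuous_wellSlope.integral_hasStrictDerivAt 0 t |>.hasDerivAt

theorem IsDoubleWell.continuous_wellPrimitive (hW : IsDoubleWell W) :
    Continuous (wellPrimitive W) :=
  continuous_iff_continuousAt.2 fun t => (hW.hasDerivAt_wellPrimitive t).continuousAt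

theorem wellPrimitive_zero : wellPrimitive W 0 = 0 := intervalIntegral.integral_same

theorem wellPrimitive_one : wellPrimitive W 1 = surfaceTension W := by
  refine intervalIntegral.integral_congr fun t ht => ?_
  rw [Set.uIcc_of_le zero_le_one] at ht
  exact wellSlope_of_mem ht

theorem IsDoubleWell.surfaceTension_pos (hW : IsDoubleWell W) : 0 < surfaceTension W := by
  rw [← wellPrimitive_one, wellPrimitive]
  refine intervalIntegral.intervalIntegral_pos_of_pos_on
    (hW.continuous_wellSlope.intervalIntegrable _ _) (fun t ht => ?_) zero_lt_one
  rw [wellSlope_of_mem ⟨ht.1.le, ht.2.le⟩]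
  refine Real.sqrt_pos.2 (mul_pos two_pos ((hW.nonneg t).lt_of_ne fun h => ?_))
  rcases hW.eq_zero_iff.1 h.symm with h | h
  · exact ht.1.ne' h
  · exact ht.2.ne h

theorem IsDoubleWell.monotone_wellPrimitive (hW : IsDoubleWell W) : Monotone (wellPrimitive W) :=
  monotone_of_deriv_nonneg (fun t => (hW.hasDerivAt_wellPrimitive t).differentiableAt)
    fun t => (hW.hasDerivAt_wellPrimitive t).deriv ▸ wellSlope_nonneg t

theorem IsDoubleWell.wellPrimitive_of_nonpos (hW : IsDoubleWell W) {t : ℝ} (ht : t ≤ 0) :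
    wellPrimitive W t = 0 := by
  rw [wellPrimitive, intervalIntegral.integral_symm, neg_eq_zero]
  refine intervalIntegral.integral_zero_ae (Eventually.of_forall fun s hs => ?_)
  rw [Set.uIoc_of_le ht] at hs
  exact hW.wellSlope_of_nonpos hs.2

theorem IsDoubleWell.wellPrimitive_of_one_le (hW : IsDoubleWell W) {t : ℝ} (ht : 1 ≤ t) :
    wellPrimitive W t = surfaceTension W := by
  rw [← wellPrimitive_one, wellPrimitive, wellPrimitive,
    ← intervalIntegral.integral_add_adjacent_intervals
      (hW.continuous_wellSlope.intervalIntegrable 0 1)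
      (hW.continuous_wellSlope.intervalIntegrable 1 t), add_eq_left]
  refine intervalIntegral.integral_zero_ae (Eventually.of_forall fun s hs => ?_)
  rw [Set.uIoc_of_le ht] at hs
  exact hW.wellSlope_of_one_le hs.1.le

theorem IsDoubleWell.wellPrimitive_nonneg (hW : IsDoubleWell W) (t : ℝ) : 0 ≤ wellPrimitive W t := by
  rcases le_total t 0 with h | h
  · rw [hW.wellPrimitive_of_nonpos h]
  · exact wellPrimitive_zero (W := W) ▸ hW.monotone_wellPrimitive h

theorem IsDoubleWell.abs_wellPrimitive_le (hW : IsDoubleWell W) (t : ℝ) :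
    |wellPrimitive W t| ≤ surfaceTension W := by
  rw [abs_of_nonneg (hW.wellPrimitive_nonneg t)]
  rcases le_total 1 t with h | h
  · rw [hW.wellPrimitive_of_one_le h]
  · exact wellPrimitive_one (W := W) ▸ hW.monotone_wellPrimitive h

/-- Since `p₁ > 1`, `|t| ≤ |t| ^ p₁` when `|t| ≥ 1`. The first bound gives control in `L¹` by the
potential; the second confines any values along which the potential tends to zero. -/
theorem GrowthCondition.exists_abs_le {N : ℕ} (h : GrowthCondition N W)
    (hW : IsDoubleWell W) : ∃ R c : ℝ, 0 < R ∧ 0 < c ∧ (∀ t, |t| ≤ R + c * W t) ∧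
      ∀ t, R < |t| → 1 ≤ c * W t := by
  obtain ⟨c₁, c₂, t₀, p₁, p₂, hc₁, -, ht₀, hp, -, -, -, hg⟩ := h
  have hbig : ∀ t : ℝ, max t₀ 1 ≤ |t| → |t| ≤ c₁⁻¹ * W t := fun t ht => by
    have h1 : 1 ≤ |t| := (le_max_right _ _).trans ht
    have h2 := (hg t ((le_max_left _ _).trans ht)).1
    have h3 : |t| ≤ |t| ^ p₁ := by
      simpa using Real.rpow_le_rpow_of_exponent_le h1 (by linarith : (1 : ℝ) ≤ p₁)
    rw [inv_mul_eq_div, le_div_iff₀ hc₁]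
    nlinarith
  refine ⟨max t₀ 1, c₁⁻¹, by positivity, by positivity, fun t => ?_, fun t ht => ?_⟩
  · rcases le_total (max t₀ 1) |t| with ht | ht
    · have := hbig t ht
      have : 0 ≤ max t₀ 1 := by positivity
      linarith
    · have : 0 ≤ c₁⁻¹ * W t := mul_nonneg (by positivity) (hW.nonneg t)
      linarith
  · exact ((le_max_right _ _).trans ht.le).trans (hbig t ht.le)

/-- If the potential and the primitive converge along a sequence, to zero and to some limit, the
sequence converges to a well, which the limit determines. -/
theorem IsDoubleWell.tendsto_well {N : ℕ} (hW : IsDoubleWell W) (h : GrowthCondition N W)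
    {t : ℕ → ℝ} {l : ℝ} (ht : Tendsto (fun n => W (t n)) atTop (𝓝 0))
    (hl : Tendsto (fun n => wellPrimitive W (t n)) atTop (𝓝 l)) :
    ∃ a : ℝ, Tendsto t atTop (𝓝 a) ∧ (a = 0 ∧ l = 0 ∨ a = 1 ∧ l = surfaceTension W) := by
  obtain ⟨R, c, -, hc, -, hlarge⟩ := h.exists_abs_le hW
  have hev : ∀ᶠ n in atTop, t n ∈ Metric.closedBall (0 : ℝ) R := by
    have : ∀ᶠ n in atTop, W (t n) < c⁻¹ := ht.eventually_lt_const (by positivity)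
    filter_upwards [this] with n hn
    rw [mem_closedBall_zero_iff, Real.norm_eq_abs]
    by_contra hR
    have := hlarge _ (not_le.1 hR)
    have h2 : c * W (t n) < c * c⁻¹ := mul_lt_mul_of_pos_left hn hc
    rw [mul_inv_cancel₀ hc.ne'] at h2
    linarith
  -- Continuity along a subsequence transfers both limits to any cluster point. As `σ > 0`, the
  -- number `l` then selects one well, so the cluster point in the compact ball is unique.
  have hcl : ∀ a, MapClusterPt a atTop t → W a = 0 ∧ wellPrimitive W a = l := fun a ha => by
    obtain ⟨φ, hφ, hφa⟩ := ha.tendsto_subseq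
    exact ⟨tendsto_nhds_unique ((hW.continuous.tendsto a).comp hφa) (ht.comp hφ.tendsto_atTop),
      tendsto_nhds_unique ((hW.continuous_wellPrimitive.tendsto a).comp hφa)
        (hl.comp hφ.tendsto_atTop)⟩
  have hcl' : ∀ a, MapClusterPt a atTop t → a = 0 ∧ l = 0 ∨ a = 1 ∧ l = surfaceTension W :=
    fun a ha => by
      obtain ⟨h1, h2⟩ := hcl a ha
      rcases hW.eq_zero_iff.1 h1 with rfl | rfl
      · exact Or.inl ⟨rfl, by rw [← h2, wellPrimitive_zero]⟩
      · exact Or.inr ⟨rfl, by rw [← h2, wellPrimitive_one]⟩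
  obtain ⟨a, -, ha⟩ := (isCompact_closedBall (0 : ℝ) R).exists_mapClusterPt
    (tendsto_principal.2 hev)
  refine ⟨a, (isCompact_closedBall (0 : ℝ) R).tendsto_nhds_of_unique_mapClusterPt hev
    fun b _ hb => ?_, hcl' a ha⟩
  have := hW.surfaceTension_pos
  rcases hcl' a ha with ⟨h1, h2⟩ | ⟨h1, h2⟩ <;> rcases hcl' b hb with ⟨h3, h4⟩ | ⟨h3, h4⟩ <;>
    first | (exfalso; linarith) | rw [h1, h3]

end Potential

/-! ### Coordinate frames, Gram matrix and density in a chart. -/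

section Charts

variable {N : ℕ} {M : Type*} [TopologicalSpace M] [ChartedSpace (EuclideanSpace ℝ (Fin N)) M]

local notation "𝔼" => EuclideanSpace ℝ (Fin N)

theorem isOpen_target (p : M) : IsOpen (extChartAt (𝓡 N) p).target := isOpen_extChartAt_target p

theorem isOpen_source (p : M) : IsOpen (extChartAt (𝓡 N) p).source := isOpen_extChartAt_source p

variable [IsManifold (𝓡 N) ∞ M]

/-- The coordinate frame of the chart centred at `p`, as a linear map onto the tangent space. -/
noncomputable def frame (p x : M) : 𝔼 →L[ℝ] TangentSpace (𝓡 N) x :=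
  (trivializationAt 𝔼 (TangentSpace (𝓡 N)) p).symmL ℝ x

theorem mem_baseSet {p x : M} (hx : x ∈ (extChartAt (𝓡 N) p).source) :
    x ∈ (trivializationAt 𝔼 (TangentSpace (𝓡 N)) p).baseSet := by
  rwa [TangentBundle.trivializationAt_baseSet, ← extChartAt_source (𝓡 N)]

theorem continuousLinearMapAt_frame {p x : M} (hx : x ∈ (extChartAt (𝓡 N) p).source) (v : 𝔼) :
    (trivializationAt 𝔼 (TangentSpace (𝓡 N)) p).continuousLinearMapAt ℝ x (frame p x v) = v :=
  (trivializationAt 𝔼 (TangentSpace (𝓡 N)) p).continuousLinearMapAt_symmL (mem_baseSet hx) v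

theorem trivializationAt_snd {p x : M} (hx : x ∈ (extChartAt (𝓡 N) p).source)
    (v : TangentSpace (𝓡 N) x) :
    (trivializationAt 𝔼 (TangentSpace (𝓡 N)) p ⟨x, v⟩).2 =
      (trivializationAt 𝔼 (TangentSpace (𝓡 N)) p).continuousLinearMapAt ℝ x v :=
  (congrFun ((trivializationAt 𝔼 (TangentSpace (𝓡 N)) p).coe_linearMapAt_of_mem (R := ℝ)
    (mem_baseSet hx)) v).symm

/-- The derivative of the chart is the fibre map of the trivialization of the tangent bundle,
through which smoothness of sections is characterized. -/
theorem components_eq {p x : M} (hx : x ∈ (extChartAt (𝓡 N) p).source) (X : VectorField N M) :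
    components p X x =
      (trivializationAt 𝔼 (TangentSpace (𝓡 N)) p).continuousLinearMapAt ℝ x (X x) := by
  rw [TangentBundle.continuousLinearMapAt_trivializationAt (by rwa [← extChartAt_source (𝓡 N)])]
  rfl

theorem coordVector_eq {p : M} {z : 𝔼} (hz : z ∈ (extChartAt (𝓡 N) p).target) (i : Fin N) :
    coordVector p z i =
      frame p ((extChartAt (𝓡 N) p).symm z) (EuclideanSpace.single i (1 : ℝ)) := by
  have hx := (extChartAt (𝓡 N) p).map_target hz
  rw [frame, TangentBundle.symmL_trivializationAt (by rwa [← extChartAt_source (𝓡 N)]),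
    (extChartAt (𝓡 N) p).right_inv hz]
  simp only [coordVector, modelWithCornersSelf_coe, Set.range_id, mfderivWithin_univ]
  rfl

theorem frame_components {p x : M} (hx : x ∈ (extChartAt (𝓡 N) p).source) (X : VectorField N M) :
    frame p x (components p X x) = X x := by
  rw [components_eq hx]
  exact (trivializationAt 𝔼 (TangentSpace (𝓡 N)) p).symmL_continuousLinearMapAt (mem_baseSet hx) _

theorem components_eq_of_frame {p x : M} (hx : x ∈ (extChartAt (𝓡 N) p).source)
    {X : VectorField N M} {v : 𝔼} (h : X x = frame p x v) : components p X x = v := by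
  rw [components_eq hx, h, continuousLinearMapAt_frame hx]

theorem frame_ne_zero {p x : M} (hx : x ∈ (extChartAt (𝓡 N) p).source) {v : 𝔼} (hv : v ≠ 0) :
    frame p x v ≠ 0 := fun h => hv <| by
  rw [← continuousLinearMapAt_frame hx v, h, map_zero]

theorem gram_apply (g : Metric N M) {p x : M} (hx : x ∈ (extChartAt (𝓡 N) p).source)
    (i j : Fin N) : gram g p (extChartAt (𝓡 N) p x) i j =
      g.inner x (frame p x (EuclideanSpace.single i 1)) (frame p x (EuclideanSpace.single j 1)) := by
  have hz := (extChartAt (𝓡 N) p).map_source hx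
  rw [gram, Matrix.of_apply, coordVector_eq hz, coordVector_eq hz,
    (extChartAt (𝓡 N) p).left_inv hx]

theorem inner_frame (g : Metric N M) {p x : M} (hx : x ∈ (extChartAt (𝓡 N) p).source) (v w : 𝔼) :
    g.inner x (frame p x v) (frame p x w) =
      ∑ i, ∑ j, v i * w j * gram g p (extChartAt (𝓡 N) p x) i j := by
  have h : ∀ v : 𝔼, frame p x v = ∑ i, v i • frame p x (EuclideanSpace.single i (1 : ℝ)) :=
    fun v => by
      conv_lhs => rw [← (EuclideanSpace.basisFun (Fin N) ℝ).sum_repr v]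
      simp [map_sum]
  rw [h v, h w]
  simp only [map_sum, map_smul, FunLike.coe_sum, FunLike.coe_smul,
    Finset.sum_apply, Pi.smul_apply, smul_eq_mul, gram_apply g hx]
  rw [Finset.sum_comm]
  simp only [Finset.mul_sum]
  exact Finset.sum_congr rfl fun i _ => Finset.sum_congr rfl fun j _ => by ring

/-- The frame is injective, so positivity of the metric passes to coordinates. It makes the
determinant positive, hence its square root smooth and the density invertible. -/
theorem posDef_gram (g : Metric N M) {p : M} {z : 𝔼} (hz : z ∈ (extChartAt (𝓡 N) p).target) :
    (gram g p z).PosDef := by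
  obtain ⟨x, hx, rfl⟩ : ∃ x ∈ (extChartAt (𝓡 N) p).source, extChartAt (𝓡 N) p x = z :=
    ⟨_, (extChartAt (𝓡 N) p).map_target hz, (extChartAt (𝓡 N) p).right_inv hz⟩
  refine Matrix.PosDef.of_dotProduct_mulVec_pos ?_ fun v hv => ?_
  · ext i j
    simp only [Matrix.conjTranspose_apply, star_trivial, gram_apply g hx]
    exact g.symm _ _ _
  · have h := g.pos x (frame p x (WithLp.toLp 2 v)) (frame_ne_zero hx (by simpa using hv))
    rw [inner_frame g hx] at h
    refine h.trans_eq ?_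
    simp only [dotProduct, Matrix.mulVec, Pi.star_apply, star_trivial, Finset.mul_sum]
    exact Finset.sum_congr rfl fun i _ => Finset.sum_congr rfl fun j _ => by ring

theorem density_pos (g : Metric N M) {p : M} {z : 𝔼} (hz : z ∈ (extChartAt (𝓡 N) p).target) :
    0 < density g p z :=
  Real.sqrt_pos.2 (posDef_gram g hz).det_pos

theorem contMDiffOn_frame (p : M) (v : 𝔼) :
    ContMDiffOn (𝓡 N) (𝓡 N).tangent ∞
      (fun x => (⟨x, frame p x v⟩ : TangentBundle (𝓡 N) M)) (extChartAt (𝓡 N) p).source := by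
  refine (((trivializationAt 𝔼 (TangentSpace (𝓡 N)) p).contMDiffOn_section_iff (n := ∞)
    (IB := 𝓡 N) (isOpen_source p) fun x hx => mem_baseSet hx).2 ?_)
  refine (contMDiffOn_const (c := v)).congr fun x hx => ?_
  rw [trivializationAt_snd hx]
  exact continuousLinearMapAt_frame hx v

theorem contMDiffOn_inner (g : Metric N M) {X Y : VectorField N M} {S : Set M}
    (hX : ContMDiffOn (𝓡 N) (𝓡 N).tangent ∞ (fun x => (⟨x, X x⟩ : TangentBundle (𝓡 N) M)) S)
    (hY : ContMDiffOn (𝓡 N) (𝓡 N).tangent ∞ (fun x => (⟨x, Y x⟩ : TangentBundle (𝓡 N) M)) S) :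
    ContMDiffOn (𝓡 N) 𝓘(ℝ, ℝ) ∞ (fun x => g.inner x (X x) (Y x)) S := by
  intro x hx
  have : ContMDiffWithinAt (𝓡 N) ((𝓡 N).prod 𝓘(ℝ)) ∞
      (fun m ↦ Bundle.TotalSpace.mk' ℝ (E := Bundle.Trivial M ℝ) m (g.inner m (X m) (Y m))) S x := by
    apply ContMDiffWithinAt.clm_bundle_apply₂ (F₁ := 𝔼) (F₂ := 𝔼)
    · exact g.contMDiff.contMDiffAt.contMDiffWithinAt
    · exact hX x hx
    · exact hY x hx
  simp only [Bundle.contMDiffWithinAt_totalSpace] at this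
  exact this.2

theorem contMDiffOn_comp_symm {p : M} {f : M → ℝ}
    (hf : ContMDiffOn (𝓡 N) 𝓘(ℝ, ℝ) ∞ f (extChartAt (𝓡 N) p).source) :
    ContDiffOn ℝ ∞ (fun z => f ((extChartAt (𝓡 N) p).symm z)) (extChartAt (𝓡 N) p).target :=
  (hf.comp (contMDiffOn_extChartAt_symm p) fun _ hz =>
    (extChartAt (𝓡 N) p).map_target hz).contDiffOn

theorem contDiffOn_gram (g : Metric N M) (p : M) (i j : Fin N) :
    ContDiffOn ℝ ∞ (fun z => gram g p z i j) (extChartAt (𝓡 N) p).target := by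
  refine (contMDiffOn_comp_symm (contMDiffOn_inner g
    (contMDiffOn_frame p (EuclideanSpace.single i 1))
    (contMDiffOn_frame p (EuclideanSpace.single j 1)))).congr fun z hz => ?_
  have := gram_apply g ((extChartAt (𝓡 N) p).map_target hz) i j
  rwa [(extChartAt (𝓡 N) p).right_inv hz] at this

theorem contDiffOn_density (g : Metric N M) (p : M) :
    ContDiffOn ℝ ∞ (density g p) (extChartAt (𝓡 N) p).target := by
  refine ContDiffOn.sqrt ?_ fun z hz => (posDef_gram g hz).det_pos.ne'
  simp only [Matrix.det_apply']
  refine ContDiffOn.sum fun σ _ => contDiffOn_const.mul ?_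
  exact contDiffOn_prod fun i _ => contDiffOn_gram g p _ _

theorem continuousOn_density (g : Metric N M) (p : M) :
    ContinuousOn (density g p) (extChartAt (𝓡 N) p).target :=
  (contDiffOn_density g p).continuousOn

theorem contMDiffOn_components {X : VectorField N M} {p : M}
    (hX : ContMDiffOn (𝓡 N) (𝓡 N).tangent ∞ (fun x => (⟨x, X x⟩ : TangentBundle (𝓡 N) M))
      (extChartAt (𝓡 N) p).source) :
    ContMDiffOn (𝓡 N) 𝓘(ℝ, 𝔼) ∞ (components p X) (extChartAt (𝓡 N) p).source := by
  refine (((trivializationAt 𝔼 (TangentSpace (𝓡 N)) p).contMDiffOn_section_iff (n := ∞)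
    (IB := 𝓡 N) (isOpen_source p) fun x hx => mem_baseSet hx).1 hX).congr fun x hx => ?_
  rw [components_eq hx, trivializationAt_snd hx]

theorem contDiffOn_components {X : VectorField N M} (hX : IsSmoothField X) (p : M) :
    ContDiffOn ℝ ∞ (fun z => components p X ((extChartAt (𝓡 N) p).symm z))
      (extChartAt (𝓡 N) p).target :=
  ((contMDiffOn_components hX.contMDiffOn).comp (contMDiffOn_extChartAt_symm p) fun _ hz =>
    (extChartAt (𝓡 N) p).map_target hz).contDiffOn

end Charts

/-! ### Jacobi's formula and the Piola identity. -/

section Piola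

variable {E : Type*} [NormedAddCommGroup E] [NormedSpace ℝ E] [FiniteDimensional ℝ E]

theorem det_eq_toMatrix (A : E →L[ℝ] E) :
    A.det = (LinearMap.toMatrix (Module.finBasis ℝ E) (Module.finBasis ℝ E)
      (A : E →ₗ[ℝ] E)).det :=
  (LinearMap.det_toMatrix _ _).symm

theorem contDiff_det : ContDiff ℝ ∞ (fun A : E →L[ℝ] E => A.det) := by
  simp only [det_eq_toMatrix, Matrix.det_apply']
  refine ContDiff.sum fun σ _ => contDiff_const.mul ?_
  refine contDiff_prod fun i _ => ?_
  simp only [LinearMap.toMatrix_apply]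
  exact ((LinearMap.toContinuousLinearMap
    ((Module.finBasis ℝ E).coord (σ i))).contDiff).comp (contDiff_id.clm_apply contDiff_const)

/-- The trace is the linear coefficient of the polynomial `det (1 + t H)`. -/
theorem fderiv_det_one (H : E →L[ℝ] E) :
    fderiv ℝ (fun A : E →L[ℝ] E => A.det) 1 H = LinearMap.trace ℝ E (H : E →ₗ[ℝ] E) := by
  have h1 : HasFDerivAt (fun A : E →L[ℝ] E => A.det) (fderiv ℝ (fun A : E →L[ℝ] E => A.det) 1)
      ((1 : E →L[ℝ] E) + (0 : ℝ) • H) := by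
    rw [zero_smul, add_zero]
    exact (contDiff_det.differentiable (by simp) _).hasFDerivAt
  have h2 : HasDerivAt (fun t : ℝ => (1 : E →L[ℝ] E) + t • H) H 0 := by
    simpa using ((hasDerivAt_id (0 : ℝ)).smul_const H).const_add (1 : E →L[ℝ] E)
  have h3 := h1.comp_hasDerivAt 0 h2
  set b := Module.finBasis ℝ E
  set m := LinearMap.toMatrix b b (H : E →ₗ[ℝ] E)
  -- `P` collects the terms of degree at least two, divided by `t ^ 2`; they do not contribute to
  -- the derivative at zero.
  set P := (Matrix.det (1 + (Polynomial.X : Polynomial ℝ) •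
    m.map Polynomial.C)).divX.divX
  have h4 : ∀ t : ℝ, ((1 : E →L[ℝ] E) + t • H).det = 1 + m.trace * t + P.eval t * t ^ 2 := by
    intro t
    rw [← Matrix.det_one_add_smul, det_eq_toMatrix]
    congr 1
    have : (((1 : E →L[ℝ] E) + t • H : E →L[ℝ] E) : E →ₗ[ℝ] E) = 1 + t • (H : E →ₗ[ℝ] E) := rfl
    rw [this, map_add, map_smul, LinearMap.toMatrix_one]
  have h5 : HasDerivAt (fun t : ℝ => ((1 : E →L[ℝ] E) + t • H).det) m.trace 0 := by
    simp only [h4]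
    have h6 := (((hasDerivAt_id (0 : ℝ)).const_mul m.trace).const_add 1).add
      ((P.hasDerivAt 0).mul (hasDerivAt_pow 2 (0 : ℝ)))
    have h7 : HasDerivAt (fun t : ℝ => 1 + m.trace * t + P.eval t * t ^ 2) _ 0 := h6
    exact h7.congr_deriv (by simp)
  rw [LinearMap.trace_eq_matrix_trace ℝ b]
  exact h3.unique h5

/-- **Jacobi's formula** for the derivative of the determinant. -/
theorem hasFDerivAt_det {F : Type*} [NormedAddCommGroup F] [NormedSpace ℝ F] {A : F → E →L[ℝ] E}
    {A' : F →L[ℝ] E →L[ℝ] E} {x : F} (hA : HasFDerivAt A A' x) {B : E →L[ℝ] E}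
    (hBA : B.comp (A x) = 1) :
    ∃ L : F →L[ℝ] ℝ, HasFDerivAt (fun y => (A y).det) L x ∧
      ∀ w, L w = (A x).det * LinearMap.trace ℝ E (B.comp (A' w) : E →L[ℝ] E) := by
  -- Composition with the inverse `B` moves the base point to the identity, where the derivative of
  -- the determinant is the trace; the factor `(A x).det` undoes `B.det`.
  have h1 : HasFDerivAt (fun y => B.comp (A y))
      ((ContinuousLinearMap.compL ℝ E E E B).comp A') x :=
    (ContinuousLinearMap.compL ℝ E E E B).hasFDerivAt.comp x hA
  have h2 : HasFDerivAt (fun A : E →L[ℝ] E => A.det) (fderiv ℝ (fun A : E →L[ℝ] E => A.det) 1)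
      (B.comp (A x)) := by
    rw [hBA]
    exact (contDiff_det.differentiable (by simp) _).hasFDerivAt
  have h3 := (h2.comp x h1).const_mul (A x).det
  have hdet : ∀ C : E →L[ℝ] E, (B.comp C).det = B.det * C.det := fun C => LinearMap.det_comp _ _
  have h1' : B.det * (A x).det = 1 := by
    rw [← hdet, hBA]; exact LinearMap.det_id
  refine ⟨_, h3.congr_of_eventuallyEq (Eventually.of_forall fun y => ?_), fun w => ?_⟩
  · simp only [Function.comp_apply, hdet]
    linear_combination -((A y).det * h1')
  · simp only [FunLike.coe_smul, Pi.smul_apply, smul_eq_mul, ContinuousLinearMap.comp_apply,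
      fderiv_det_one]
    rfl

/-- The Piola identity: the divergence of a vector density is invariant under changes of
coordinates. -/
theorem trace_fderiv_change {τ F G : E → E} {z : E} (hτ : ContDiffAt ℝ 2 τ z)
    {B : E →L[ℝ] E} (hBA : B.comp (fderiv ℝ τ z) = 1) (hAB : (fderiv ℝ τ z).comp B = 1)
    (hF : DifferentiableAt ℝ F z) (hG : DifferentiableAt ℝ G (τ z))
    (h : ∀ᶠ y in 𝓝 z, fderiv ℝ τ y (F y) = |(fderiv ℝ τ y).det| • G (τ y)) :
    LinearMap.trace ℝ E (fderiv ℝ F z : E →L[ℝ] E) =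
      |(fderiv ℝ τ z).det| * LinearMap.trace ℝ E (fderiv ℝ G (τ z) : E →L[ℝ] E) := by
  set A := fderiv ℝ τ z with hAdef
  have hdτ : DifferentiableAt ℝ (fderiv ℝ τ) z :=
    (hτ.fderiv_right (m := 1) (by norm_num)).differentiableAt (by simp)
  set A' := fderiv ℝ (fderiv ℝ τ) z with hA'
  have hsymm : ∀ v w, A' v w = A' w v := fun v w =>
    (hτ.isSymmSndFDerivAt (by simp)).eq v w
  obtain ⟨L, hL, hLw⟩ := hasFDerivAt_det hdτ.hasFDerivAt hBA
  have hdet0 : A.det ≠ 0 := by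
    have : B.det * A.det = 1 := by
      have := congrArg ContinuousLinearMap.det hBA
      rw [show (B.comp A).det = B.det * A.det from LinearMap.det_comp _ _] at this
      rw [this]; exact LinearMap.det_id
    exact right_ne_zero_of_mul_eq_one this
  -- `s` is the sign of the determinant, which is constant near `z`.
  obtain ⟨s, hs, hsA⟩ : ∃ s : ℝ, HasFDerivAt (fun y => |(fderiv ℝ τ y).det|) (s • L) z ∧
      s * A.det = |A.det| := by
    rcases hdet0.lt_or_gt with h0 | h0
    · refine ⟨-1, ?_, by rw [abs_of_neg h0]; ring⟩
      rw [show (-1 : ℝ) • L = -L from neg_one_smul ℝ L]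
      refine hL.neg.congr_of_eventuallyEq ?_
      filter_upwards [hL.continuousAt.eventually_lt_const h0] with y hy using abs_of_neg hy
    · refine ⟨1, ?_, by rw [abs_of_pos h0]; ring⟩
      rw [show (1 : ℝ) • L = L from one_smul ℝ L]
      refine hL.congr_of_eventuallyEq ?_
      filter_upwards [hL.continuousAt.eventually_const_lt h0] with y hy using abs_of_pos hy
  have e1 : HasFDerivAt (fun y => fderiv ℝ τ y (F y)) _ z :=
    hdτ.hasFDerivAt.clm_apply hF.hasFDerivAt
  have hτd : HasFDerivAt τ A z := (hτ.differentiableAt (by simp)).hasFDerivAt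
  have e2 : HasFDerivAt (fun y => |(fderiv ℝ τ y).det| • G (τ y)) _ z :=
    hs.smul (hG.hasFDerivAt.comp z hτd)
  have key := e1.unique (e2.congr_of_eventuallyEq h)
  have hz := h.self_of_nhds
  set a := |A.det| with ha
  have ha0 : a ≠ 0 := abs_ne_zero.2 hdet0
  have hFz : F z = a • B (G (τ z)) := by
    have := congrArg B hz
    rw [map_smul] at this
    rw [← this]
    exact (congrArg (fun C : E →L[ℝ] E => C (F z)) hBA).symm
  -- The hypothesis, differentiated at `z` and composed with `B`. Symmetry of the second derivative
  -- turns `A' v (F z)` into `A' (F z) v`, so that every term is an operator applied to `v`.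
  have op : (fderiv ℝ F z : E →L[ℝ] E) + B.comp (A' (F z)) =
      (s • L).smulRight (B (G (τ z))) + a • (B.comp ((fderiv ℝ G (τ z)).comp A)) := by
    ext v
    have kv := congrArg (fun C : E →L[ℝ] E => B (C v)) key
    have hB : ∀ w, B (A w) = w := fun w => congrArg (fun C : E →L[ℝ] E => C w) hBA
    simp only [FunLike.coe_add, Pi.add_apply, ContinuousLinearMap.comp_apply,
      ContinuousLinearMap.flip_apply, FunLike.coe_smul, Pi.smul_apply,
      ContinuousLinearMap.smulRight_apply, map_add, map_smul, ← hA', ← hAdef, hB] at kv ⊢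
    rw [hsymm (F z) v, kv, add_comm]
  have tr := congrArg (fun C : E →L[ℝ] E => LinearMap.trace ℝ E (C : E →ₗ[ℝ] E)) op
  simp only [ContinuousLinearMap.toLinearMap_add, ContinuousLinearMap.toLinearMap_smul,
    map_add, map_smul, smul_eq_mul] at tr
  have t1 : LinearMap.trace ℝ E (((s • L).smulRight (B (G (τ z))) : E →L[ℝ] E) : E →ₗ[ℝ] E) =
      s * L (B (G (τ z))) := LinearMap.trace_smulRight ((s • L : E →L[ℝ] ℝ) : E →ₗ[ℝ] ℝ) _
  have t2 : LinearMap.trace ℝ E ((B.comp ((fderiv ℝ G (τ z)).comp A) : E →L[ℝ] E) : E →ₗ[ℝ] E) =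
      LinearMap.trace ℝ E (fderiv ℝ G (τ z) : E →L[ℝ] E) := by
    have h1 := LinearMap.trace_mul_comm ℝ (B : E →ₗ[ℝ] E)
      (((fderiv ℝ G (τ z)).comp A : E →L[ℝ] E) : E →ₗ[ℝ] E)
    refine h1.trans (congrArg (LinearMap.trace ℝ E) ?_)
    ext v
    exact congrArg (fderiv ℝ G (τ z)) (congrArg (fun C : E →L[ℝ] E => C v) hAB)
  -- By Jacobi's formula the trace of the second-derivative term equals the term from
  -- differentiating `|det|`. The two cancel, and the traces of the first derivatives remain.
  have t3 : LinearMap.trace ℝ E ((B.comp (A' (F z)) : E →L[ℝ] E) : E →ₗ[ℝ] E) =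
      s * L (B (G (τ z))) := by
    rw [hLw, hFz, map_smul, ContinuousLinearMap.comp_smul, ContinuousLinearMap.toLinearMap_smul,
      map_smul, smul_eq_mul, ← hsA]
    ring
  rw [t1, t2, t3] at tr
  linarith

end Piola

/-! ### Behaviour under a change of charts. -/

section Charts

variable {N : ℕ} {M : Type*} [TopologicalSpace M] [ChartedSpace (EuclideanSpace ℝ (Fin N)) M]
  [IsManifold (𝓡 N) ∞ M]

local notation "𝔼" => EuclideanSpace ℝ (Fin N)

theorem hasFDerivAt_chart_change {p q x : M} (hp : x ∈ (extChartAt (𝓡 N) p).source)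
    (hq : x ∈ (extChartAt (𝓡 N) q).source) :
    HasFDerivAt (fun z => extChartAt (𝓡 N) q ((extChartAt (𝓡 N) p).symm z))
      (tangentCoordChange (𝓡 N) p q x) (extChartAt (𝓡 N) p x) := by
  have := hasFDerivWithinAt_tangentCoordChange (I := 𝓡 N) (x := p) (y := q) (z := x) ⟨hp, hq⟩
  simpa only [modelWithCornersSelf_coe, Set.range_id, hasFDerivWithinAt_univ] using! this

theorem contDiffAt_chart_change {p q x : M} (hp : x ∈ (extChartAt (𝓡 N) p).source)
    (hq : x ∈ (extChartAt (𝓡 N) q).source) :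
    ContDiffAt ℝ ∞ (fun z => extChartAt (𝓡 N) q ((extChartAt (𝓡 N) p).symm z))
      (extChartAt (𝓡 N) p x) := by
  have := contDiffWithinAt_ext_coord_change (I := 𝓡 N) (n := ∞) q p (y := extChartAt (𝓡 N) p x)
    (by
      rw [PartialEquiv.trans_source, PartialEquiv.symm_source]
      refine ⟨(extChartAt (𝓡 N) p).map_source hp, ?_⟩
      rwa [Set.mem_preimage, (extChartAt (𝓡 N) p).left_inv hp])
  simpa only [modelWithCornersSelf_coe, Set.range_id, contDiffWithinAt_univ] using! this

theorem tangentCoordChange_comp_self {p q x : M} (hp : x ∈ (extChartAt (𝓡 N) p).source)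
    (hq : x ∈ (extChartAt (𝓡 N) q).source) :
    (tangentCoordChange (𝓡 N) q p x).comp (tangentCoordChange (𝓡 N) p q x) =
      (1 : 𝔼 →L[ℝ] 𝔼) := by
  ext1 v
  exact (tangentCoordChange_comp ⟨⟨hp, hq⟩, hp⟩).trans (tangentCoordChange_self hp)

theorem frame_change {p q x : M} (hp : x ∈ (extChartAt (𝓡 N) p).source)
    (hq : x ∈ (extChartAt (𝓡 N) q).source) (v : 𝔼) :
    frame q x (tangentCoordChange (𝓡 N) p q x v) = frame p x v := by
  have hp' := hp
  have hq' := hq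
  rw [extChartAt_source] at hp' hq'
  rw [frame, frame, TangentBundle.symmL_trivializationAt_eq_core hp',
    TangentBundle.symmL_trivializationAt_eq_core hq']
  have h := tangentCoordChange_comp (I := 𝓡 N) (v := v) ⟨⟨hp, hq⟩, mem_extChartAt_source x⟩
  exact h

theorem components_change {p q x : M} (hp : x ∈ (extChartAt (𝓡 N) p).source)
    (hq : x ∈ (extChartAt (𝓡 N) q).source) (X : VectorField N M) :
    tangentCoordChange (𝓡 N) p q x (components p X x) = components q X x :=
  (components_eq_of_frame hq (by rw [frame_change hp hq, frame_components hp])).symm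

theorem gram_change (g : Metric N M) {p q x : M} (hp : x ∈ (extChartAt (𝓡 N) p).source)
    (hq : x ∈ (extChartAt (𝓡 N) q).source) :
    gram g p (extChartAt (𝓡 N) p x) =
      (LinearMap.toMatrix (EuclideanSpace.basisFun (Fin N) ℝ).toBasis
        (EuclideanSpace.basisFun (Fin N) ℝ).toBasis
        (tangentCoordChange (𝓡 N) p q x : 𝔼 →ₗ[ℝ] 𝔼)).transpose *
      gram g q (extChartAt (𝓡 N) q x) *
      LinearMap.toMatrix (EuclideanSpace.basisFun (Fin N) ℝ).toBasis
        (EuclideanSpace.basisFun (Fin N) ℝ).toBasis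
        (tangentCoordChange (𝓡 N) p q x : 𝔼 →ₗ[ℝ] 𝔼) := by
  ext i j
  rw [gram_apply g hp, ← frame_change hp hq, ← frame_change hp hq, inner_frame g hq]
  simp only [Matrix.mul_apply, Matrix.transpose_apply, LinearMap.toMatrix_apply, Finset.sum_mul]
  rw [Finset.sum_comm]
  refine Finset.sum_congr rfl fun k _ => Finset.sum_congr rfl fun l _ => ?_
  simp [mul_right_comm]

/-- The Gram matrix changes by congruence with the Jacobian matrix, so its determinant gains the
square of the Jacobian determinant. -/
theorem density_change (g : Metric N M) {p q x : M} (hp : x ∈ (extChartAt (𝓡 N) p).source)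
    (hq : x ∈ (extChartAt (𝓡 N) q).source) :
    density g p (extChartAt (𝓡 N) p x) =
      |(tangentCoordChange (𝓡 N) p q x).det| * density g q (extChartAt (𝓡 N) q x) := by
  rw [density, density, gram_change g hp hq, Matrix.det_mul, Matrix.det_mul,
    Matrix.det_transpose, LinearMap.det_toMatrix, mul_right_comm,
    Real.sqrt_mul (mul_self_nonneg _), Real.sqrt_mul_self_eq_abs]

end Charts

/-! ### The divergence of a smooth field in an arbitrary chart. -/

section Divergence

variable {N : ℕ} {M : Type*} [TopologicalSpace M] [ChartedSpace (EuclideanSpace ℝ (Fin N)) M]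
  [IsManifold (𝓡 N) ∞ M]

local notation "𝔼" => EuclideanSpace ℝ (Fin N)

/-- The vector density `√det g X`, in the chart centred at `p`. -/
noncomputable def flux (g : Metric N M) (p : M) (X : VectorField N M) (z : 𝔼) : 𝔼 :=
  density g p z • components p X ((extChartAt (𝓡 N) p).symm z)

theorem contDiffOn_flux (g : Metric N M) {X : VectorField N M} (hX : IsSmoothField X) (p : M) :
    ContDiffOn ℝ ∞ (flux g p X) (extChartAt (𝓡 N) p).target :=
  (contDiffOn_density g p).smul (contDiffOn_components hX p)

theorem contDiffAt_flux (g : Metric N M) {X : VectorField N M} (hX : IsSmoothField X) {p : M}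
    {z : 𝔼} (hz : z ∈ (extChartAt (𝓡 N) p).target) : ContDiffAt ℝ ∞ (flux g p X) z :=
  (contDiffOn_flux g hX p).contDiffAt ((isOpen_target p).mem_nhds hz)

theorem differentiableAt_flux (g : Metric N M) {X : VectorField N M} (hX : IsSmoothField X) {p : M}
    {z : 𝔼} (hz : z ∈ (extChartAt (𝓡 N) p).target) : DifferentiableAt ℝ (flux g p X) z :=
  (contDiffAt_flux g hX hz).differentiableAt (by simp)

theorem fderiv_coord {F : 𝔼 → 𝔼} {z : 𝔼} (hF : DifferentiableAt ℝ F z) (i : Fin N) (v : 𝔼) :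
    fderiv ℝ (fun y => F y i) z v = fderiv ℝ F z v i := by
  have h : HasFDerivAt (fun y => F y i) ((EuclideanSpace.proj i).comp (fderiv ℝ F z)) z :=
    (EuclideanSpace.proj (𝕜 := ℝ) i).hasFDerivAt.comp z hF.hasFDerivAt
  rw [h.fderiv]; rfl

theorem trace_eq_sum (L : 𝔼 →L[ℝ] 𝔼) :
    LinearMap.trace ℝ 𝔼 (L : 𝔼 →ₗ[ℝ] 𝔼) = ∑ i, L (EuclideanSpace.single i 1) i := by
  rw [LinearMap.trace_eq_matrix_trace ℝ (EuclideanSpace.basisFun (Fin N) ℝ).toBasis, Matrix.trace]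
  simp [LinearMap.toMatrix_apply]

theorem sum_fderiv_coord {F : 𝔼 → 𝔼} {z : 𝔼} (hF : DifferentiableAt ℝ F z) :
    ∑ i, fderiv ℝ (fun y => F y i) z (EuclideanSpace.single i 1) =
      LinearMap.trace ℝ 𝔼 (fderiv ℝ F z : 𝔼 →L[ℝ] 𝔼) := by
  rw [trace_eq_sum]
  exact Finset.sum_congr rfl fun i _ => fderiv_coord hF i _

theorem divergence_eq_self (g : Metric N M) {X : VectorField N M} (hX : IsSmoothField X) (x : M) :
    divergence g X x = (density g x (extChartAt (𝓡 N) x x))⁻¹ *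
      LinearMap.trace ℝ 𝔼 (fderiv ℝ (flux g x X) (extChartAt (𝓡 N) x x) : 𝔼 →L[ℝ] 𝔼) := by
  rw [← sum_fderiv_coord (differentiableAt_flux g hX (mem_extChartAt_target x))]
  rfl

/-- The divergence may be computed in any chart. -/
theorem divergence_eq (g : Metric N M) {X : VectorField N M} (hX : IsSmoothField X) {p x : M}
    (hp : x ∈ (extChartAt (𝓡 N) p).source) :
    divergence g X x = (density g p (extChartAt (𝓡 N) p x))⁻¹ *
      LinearMap.trace ℝ 𝔼 (fderiv ℝ (flux g p X) (extChartAt (𝓡 N) p x) : 𝔼 →L[ℝ] 𝔼) := by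
  have hx := mem_extChartAt_source (I := 𝓡 N) x
  have hpz := (extChartAt (𝓡 N) p).map_source hp
  have hleft := (extChartAt (𝓡 N) p).left_inv hp
  set τ : 𝔼 → 𝔼 := fun z => extChartAt (𝓡 N) x ((extChartAt (𝓡 N) p).symm z) with hτ
  have hτz : τ (extChartAt (𝓡 N) p x) = extChartAt (𝓡 N) x x := by rw [hτ]; simp only [hleft]
  have hfd : fderiv ℝ τ (extChartAt (𝓡 N) p x) = tangentCoordChange (𝓡 N) p x x :=
    (hasFDerivAt_chart_change hp hx).fderiv
  have key := trace_fderiv_change (τ := τ) (F := flux g p X) (G := flux g x X)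
    (z := extChartAt (𝓡 N) p x) ((contDiffAt_chart_change hp hx).of_le (by norm_cast))
    (B := tangentCoordChange (𝓡 N) x p x)
    (by rw [hfd]; exact tangentCoordChange_comp_self hp hx)
    (by rw [hfd]; exact tangentCoordChange_comp_self hx hp)
    (differentiableAt_flux g hX hpz)
    (by rw [hτz]; exact differentiableAt_flux g hX (mem_extChartAt_target x)) ?_
  · rw [divergence_eq_self g hX, key, hfd, hτz, density_change g hp hx, mul_inv]
    have hne : |(tangentCoordChange (𝓡 N) p x x).det| ≠ 0 := fun h => by
      have := density_pos g hpz
      rw [density_change g hp hx, h, zero_mul] at this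
      exact this.false
    field_simp
  -- The transformation rule for the fluxes is needed near the point, not only at it; it holds on
  -- the whole chart overlap, which is open.
  · have hopen : IsOpen ((extChartAt (𝓡 N) p).target ∩
        (extChartAt (𝓡 N) p).symm ⁻¹' (extChartAt (𝓡 N) x).source) :=
      (continuousOn_extChartAt_symm p).isOpen_inter_preimage (isOpen_target p) (isOpen_source x)
    filter_upwards [hopen.mem_nhds ⟨hpz, by rwa [Set.mem_preimage, hleft]⟩] with z hz
    have hz1 := (extChartAt (𝓡 N) p).map_target hz.1
    have hz2 := (extChartAt (𝓡 N) p).right_inv hz.1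
    have hfdz : fderiv ℝ τ z = tangentCoordChange (𝓡 N) p x ((extChartAt (𝓡 N) p).symm z) := by
      have := (hasFDerivAt_chart_change hz1 hz.2).fderiv
      rwa [hz2] at this
    have hd := density_change g hz1 hz.2
    rw [hz2] at hd
    rw [hfdz, flux, flux, map_smul, components_change hz1 hz.2, hd, mul_smul]
    simp only [hτ, (extChartAt (𝓡 N) x).left_inv hz.2]

/-- The definition uses a chart that moves with the point. Near `p` it may be replaced by the fixed
chart at `p`, where the formula is visibly continuous. -/
theorem continuous_divergence (g : Metric N M) {X : VectorField N M} (hX : IsSmoothField X) :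
    Continuous (divergence g X) := by
  refine continuous_iff_continuousAt.2 fun p => ?_
  have hc : ContinuousAt (fun z => (density g p z)⁻¹ *
      LinearMap.trace ℝ 𝔼 (fderiv ℝ (flux g p X) z : 𝔼 →L[ℝ] 𝔼)) (extChartAt (𝓡 N) p p) := by
    have ht := mem_extChartAt_target (I := 𝓡 N) p
    refine ContinuousAt.mul (((continuousOn_density g p).continuousAt
      ((isOpen_target p).mem_nhds ht)).inv₀ (density_pos g ht).ne') ?_
    simp only [trace_eq_sum]
    refine tendsto_finsetSum _ fun i _ => ?_
    have h1 : ContinuousAt (fderiv ℝ (flux g p X)) (extChartAt (𝓡 N) p p) :=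
      ((contDiffAt_flux g hX ht).fderiv_right (m := 0) (by simp)).continuousAt
    exact ((EuclideanSpace.proj (𝕜 := ℝ) i).continuous.continuousAt).comp
      (h1.clm_apply continuousAt_const)
  refine (hc.comp (continuousAt_extChartAt p)).congr ?_
  filter_upwards [extChartAt_source_mem_nhds (I := 𝓡 N) p] with x hx
  exact (divergence_eq g hX hx).symm

theorem components_sum {ι : Type*} (s : Finset ι) (p : M) (X : ι → VectorField N M) (x : M) :
    components p (fun x => ∑ k ∈ s, X k x) x = ∑ k ∈ s, components p (X k) x :=
  map_sum (mfderiv (𝓡 N) 𝓘(ℝ, 𝔼) (extChartAt (𝓡 N) p) x) (fun k => X k x) s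

theorem divergence_sum {ι : Type*} (s : Finset ι) (g : Metric N M) {X : ι → VectorField N M}
    (hX : ∀ k, IsSmoothField (X k)) (hs : IsSmoothField fun x => ∑ k ∈ s, X k x) (x : M) :
    divergence g (fun x => ∑ k ∈ s, X k x) x = ∑ k ∈ s, divergence g (X k) x := by
  have ht := mem_extChartAt_target (I := 𝓡 N) x
  have h1 : flux g x (fun x => ∑ k ∈ s, X k x) = fun z => ∑ k ∈ s, flux g x (X k) z := by
    ext1 z
    simp only [flux, components_sum, Finset.smul_sum]
  simp only [divergence_eq_self g hs, divergence_eq_self g (hX _), h1, trace_eq_sum]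
  rw [fderiv_fun_sum fun k _ => differentiableAt_flux g (hX k) ht, ← Finset.mul_sum,
    Finset.sum_comm]
  simp

end Divergence
-- The Riemannian measure in charts.
/-- The supremum of a family of measures that live on sets and agree on the overlaps restricts to
each of them. -/
theorem restrict_iSup_of_compatible {ι α : Type*} [MeasurableSpace α] {μ : ι → Measure α}
    {S : ι → Set α} (hS : ∀ i, MeasurableSet (S i)) (hsupp : ∀ i, μ i (S i)ᶜ = 0)
    (hcompat : ∀ i j A, MeasurableSet A → A ⊆ S i → A ⊆ S j → μ i A = μ j A) {q : ℕ → ι}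
    (hq : ⋃ n, S (q n) = Set.univ) (p : ι) : (⨆ i, μ i).restrict (S p) = μ p := by
  set D : ℕ → Set α := disjointed fun n => S (q n) with hD
  have hDm : ∀ n, MeasurableSet (D n) := fun n => MeasurableSet.disjointed (fun n => hS (q n)) n
  have hDS : ∀ n, D n ⊆ S (q n) := fun n => disjointed_subset _ n
  have hDU : ⋃ n, D n = Set.univ := by rw [hD, iUnion_disjointed, hq]
  -- `ν` is glued from disjoint pieces of a countable cover. Compatibility makes it agree with `μ i`
  -- inside `S i`, so it dominates every `μ i` and therefore the supremum.
  set ν : Measure α := Measure.sum fun n => (μ (q n)).restrict (D n)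
  have hν : ∀ i A, MeasurableSet A → A ⊆ S i → ν A = μ i A := fun i A hA hAi => by
    rw [Measure.sum_apply _ hA]
    have h1 : ∀ n, (μ (q n)).restrict (D n) A = μ i (A ∩ D n) := fun n => by
      rw [Measure.restrict_apply hA]
      exact hcompat _ _ _ (hA.inter (hDm n)) (Set.inter_subset_right.trans (hDS n))
        (Set.inter_subset_left.trans hAi)
    simp only [h1]
    rw [← measure_iUnion (fun m n hmn => ((disjoint_disjointed _ hmn).mono
      Set.inter_subset_right Set.inter_subset_right)) fun n => hA.inter (hDm n),
      ← Set.inter_iUnion, hDU, Set.inter_univ]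
  have hinter : ∀ i A, μ i A = μ i (A ∩ S i) := fun i A => by
    refine le_antisymm ?_ (measure_mono Set.inter_subset_left)
    calc μ i A ≤ μ i (A ∩ S i) + μ i (A \ S i) := measure_le_inter_add_sdiff _ _ _
      _ ≤ μ i (A ∩ S i) + μ i (S i)ᶜ := by gcongr; exact fun x hx => hx.2
      _ = μ i (A ∩ S i) := by rw [hsupp, add_zero]
  have hle : (⨆ i, μ i) ≤ ν := iSup_le fun i => Measure.le_iff.2 fun A hA => by
    rw [hinter, ← hν i _ (hA.inter (hS i)) Set.inter_subset_right]
    exact measure_mono Set.inter_subset_left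
  ext A hA
  rw [Measure.restrict_apply hA]
  refine le_antisymm ((hle _).trans_eq ?_) ?_
  · rw [hν p _ (hA.inter (hS p)) Set.inter_subset_right, ← hinter]
  · rw [hinter]
    exact le_iSup μ p _

section Volume

variable {N : ℕ} {M : Type*} [TopologicalSpace M] [ChartedSpace (EuclideanSpace ℝ (Fin N)) M]

local notation "𝔼" => EuclideanSpace ℝ (Fin N)

theorem measurableSet_target (p : M) : MeasurableSet (extChartAt (𝓡 N) p).target :=
  (isOpen_target p).measurableSet

variable [MeasurableSpace M] [BorelSpace M]

theorem measurableSet_source (p : M) : MeasurableSet (extChartAt (𝓡 N) p).source :=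
  (isOpen_source p).measurableSet

/-- The inverse chart is known to be continuous only on the target; extending it by a constant
outside gives a measurable map. -/
theorem measurableSet_target_inter_preimage (p : M) {A : Set M} (hA : MeasurableSet A) :
    MeasurableSet ((extChartAt (𝓡 N) p).target ∩ (extChartAt (𝓡 N) p).symm ⁻¹' A) := by
  classical
  have h : Measurable ((extChartAt (𝓡 N) p).target.piecewise (extChartAt (𝓡 N) p).symm
      fun _ => p) :=
    (continuousOn_extChartAt_symm p).measurable_piecewise continuousOn_const
      (measurableSet_target p)
  convert (measurableSet_target p).inter (h hA) using 1
  ext z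
  by_cases hz : z ∈ (extChartAt (𝓡 N) p).target <;> simp [hz, -extChartAt]

variable [IsManifold (𝓡 N) ∞ M]

theorem aemeasurable_symm (p : M) : AEMeasurable (extChartAt (𝓡 N) p).symm
    ((volume : Measure 𝔼).restrict (extChartAt (𝓡 N) p).target) :=
  (continuousOn_extChartAt_symm p).aemeasurable (measurableSet_target p)

theorem aemeasurable_density (g : Metric N M) (p : M) :
    AEMeasurable (fun z => ENNReal.ofReal (density g p z))
      ((volume : Measure 𝔼).restrict (extChartAt (𝓡 N) p).target) :=
  ((continuousOn_density g p).aemeasurable (measurableSet_target p)).ennreal_ofReal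

/-- The Riemannian volume in the coordinates of the chart centred at `p`. -/
noncomputable def coordVolume (g : Metric N M) (p : M) : Measure 𝔼 :=
  (volume.restrict (extChartAt (𝓡 N) p).target).withDensity
    fun z => ENNReal.ofReal (density g p z)

theorem coordVolume_absolutelyContinuous (g : Metric N M) (p : M) :
    coordVolume g p ≪ (volume : Measure 𝔼).restrict (extChartAt (𝓡 N) p).target :=
  withDensity_absolutelyContinuous _ _

theorem absolutelyContinuous_coordVolume (g : Metric N M) (p : M) :
    (volume : Measure 𝔼).restrict (extChartAt (𝓡 N) p).target ≪ coordVolume g p := by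
  refine withDensity_absolutelyContinuous' (aemeasurable_density g p) ?_
  filter_upwards [ae_restrict_mem (measurableSet_target p)] with z hz
  simpa using density_pos g hz

theorem aemeasurable_symm_coordVolume (g : Metric N M) (p : M) :
    AEMeasurable (extChartAt (𝓡 N) p).symm (coordVolume g p) :=
  (aemeasurable_symm p).mono_ac (coordVolume_absolutelyContinuous g p)

theorem chartVolume_eq_map (g : Metric N M) (p : M) :
    chartVolume g p = (coordVolume g p).map (extChartAt (𝓡 N) p).symm := rfl

theorem chartVolume_apply (g : Metric N M) (p : M) {A : Set M} (hA : MeasurableSet A) :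
    chartVolume g p A = ∫⁻ z in (extChartAt (𝓡 N) p).target ∩ (extChartAt (𝓡 N) p).symm ⁻¹' A,
      ENNReal.ofReal (density g p z) := by
  rw [chartVolume_eq_map, Measure.map_apply_of_aemeasurable (aemeasurable_symm_coordVolume g p) hA,
    coordVolume, withDensity_apply', Measure.restrict_restrict₀, Set.inter_comm]
  exact (aemeasurable_symm p).nullMeasurable hA

/-- The Jacobian factor in the change of variables formula for the transition map is exactly the
ratio of the two densities. -/
theorem chartVolume_compatible (g : Metric N M) {p q : M} {A : Set M} (hA : MeasurableSet A)
    (hp : A ⊆ (extChartAt (𝓡 N) p).source) (hq : A ⊆ (extChartAt (𝓡 N) q).source) :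
    chartVolume g p A = chartVolume g q A := by
  rw [chartVolume_apply g p hA, chartVolume_apply g q hA]
  set B := (extChartAt (𝓡 N) p).target ∩ (extChartAt (𝓡 N) p).symm ⁻¹' A
  set τ : 𝔼 → 𝔼 := fun z => extChartAt (𝓡 N) q ((extChartAt (𝓡 N) p).symm z) with hτ
  have himg : (extChartAt (𝓡 N) q).target ∩ (extChartAt (𝓡 N) q).symm ⁻¹' A = τ '' B := by
    ext w
    constructor
    · rintro ⟨hw1, hw2⟩
      refine ⟨extChartAt (𝓡 N) p ((extChartAt (𝓡 N) q).symm w),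
        ⟨(extChartAt (𝓡 N) p).map_source (hp hw2), ?_⟩, ?_⟩
      · rwa [Set.mem_preimage, (extChartAt (𝓡 N) p).left_inv (hp hw2)]
      · simp only [hτ, (extChartAt (𝓡 N) p).left_inv (hp hw2),
          (extChartAt (𝓡 N) q).right_inv hw1]
    · rintro ⟨z, ⟨-, hz2⟩, rfl⟩
      refine ⟨(extChartAt (𝓡 N) q).map_source (hq hz2), ?_⟩
      rwa [Set.mem_preimage, (extChartAt (𝓡 N) q).left_inv (hq hz2)]
  have hinj : Set.InjOn τ B := fun z hz w hw h =>
    (extChartAt (𝓡 N) p).symm.injOn hz.1 hw.1 ((extChartAt (𝓡 N) q).injOn (hq hz.2) (hq hw.2) h)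
  have hder : ∀ z ∈ B, HasFDerivWithinAt τ
      (tangentCoordChange (𝓡 N) p q ((extChartAt (𝓡 N) p).symm z)) B z := fun z hz => by
    have := hasFDerivAt_chart_change (hp hz.2) (hq hz.2)
    rw [(extChartAt (𝓡 N) p).right_inv hz.1] at this
    exact this.hasFDerivWithinAt
  have hB : MeasurableSet B := measurableSet_target_inter_preimage p hA
  rw [himg, lintegral_image_eq_lintegral_abs_det_fderiv_mul volume hB hder hinj]
  refine setLIntegral_congr_fun hB fun z hz => ?_
  have := density_change g (hp hz.2) (hq hz.2)
  rw [(extChartAt (𝓡 N) p).right_inv hz.1] at this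
  simp only [this, ENNReal.ofReal_mul (abs_nonneg _), hτ]

theorem chartVolume_compl (g : Metric N M) (p : M) :
    chartVolume g p (extChartAt (𝓡 N) p).sourceᶜ = 0 := by
  rw [chartVolume_apply g p (measurableSet_source p).compl]
  have : (extChartAt (𝓡 N) p).target ∩ (extChartAt (𝓡 N) p).symm ⁻¹'
      (extChartAt (𝓡 N) p).sourceᶜ = ∅ := by
    ext z
    simp only [Set.mem_inter_iff, Set.mem_preimage, Set.mem_compl_iff, Set.mem_empty_iff_false,
      iff_false, not_and, not_not]
    exact fun hz => (extChartAt (𝓡 N) p).map_target hz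
  rw [this]; simp

variable [CompactSpace M]

theorem secondCountable (N : ℕ) (M : Type*) [TopologicalSpace M]
    [ChartedSpace (EuclideanSpace ℝ (Fin N)) M] [CompactSpace M] : SecondCountableTopology M :=
  ChartedSpace.secondCountable_of_sigmaCompact (EuclideanSpace ℝ (Fin N)) M

/-- The manifold is second countable, so countably many chart domains cover it. The point `p`
excludes the empty manifold, which admits no sequence of points. -/
theorem exists_seq_iUnion_source (p : M) :
    ∃ q : ℕ → M, ⋃ n, (extChartAt (𝓡 N) (q n)).source = Set.univ := by
  have := secondCountable N M
  obtain ⟨s, hs, hsU⟩ := TopologicalSpace.countable_cover_nhds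
    fun x : M => extChartAt_source_mem_nhds (I := 𝓡 N) x
  have hne : s.Nonempty := by
    by_contra h
    rw [Set.not_nonempty_iff_eq_empty] at h
    have : p ∈ (⋃ x ∈ s, (extChartAt (𝓡 N) x).source) := hsU ▸ Set.mem_univ p
    simp [h] at this
  obtain ⟨q, rfl⟩ := hs.exists_eq_range hne
  exact ⟨q, by simpa using! hsU⟩

/-- The Riemannian measure is given by the volume density in every chart. -/
theorem restrict_vol (g : Metric N M) (p : M) :
    (vol g).restrict (extChartAt (𝓡 N) p).source =
      (coordVolume g p).map (extChartAt (𝓡 N) p).symm := by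
  obtain ⟨q, hq⟩ := exists_seq_iUnion_source (N := N) p
  exact restrict_iSup_of_compatible (fun i => measurableSet_source (N := N) i)
    (chartVolume_compl g) (fun i j A hA hi hj => chartVolume_compatible g hA hi hj) hq p

/-- By compactness it suffices that every point has a neighbourhood of finite volume: one whose
image lies in a compact subset of the chart target, on which the density is bounded. -/
theorem isFiniteMeasure_vol (g : Metric N M) : IsFiniteMeasure (vol g) := by
  refine ⟨isCompact_univ.measure_lt_top_of_nhdsWithin fun p _ => ?_⟩
  rw [nhdsWithin_univ]
  obtain ⟨K, hK, hpK, hKT⟩ := exists_compact_between (isCompact_singleton (x := extChartAt (𝓡 N) p p))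
    (isOpen_target p) (Set.singleton_subset_iff.2 (mem_extChartAt_target p))
  have hmem : (extChartAt (𝓡 N) p).source ∩ extChartAt (𝓡 N) p ⁻¹' interior K ∈ 𝓝 p :=
    ((continuousOn_extChartAt p).isOpen_inter_preimage (isOpen_source p) isOpen_interior).mem_nhds
      ⟨mem_extChartAt_source p, hpK rfl⟩
  refine ⟨_, hmem, ?_⟩
  have hmeas : MeasurableSet ((extChartAt (𝓡 N) p).source ∩ extChartAt (𝓡 N) p ⁻¹' interior K) :=
    ((continuousOn_extChartAt p).isOpen_inter_preimage (isOpen_source p)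
      isOpen_interior).measurableSet
  have h1 : vol g ((extChartAt (𝓡 N) p).source ∩ extChartAt (𝓡 N) p ⁻¹' interior K) =
      (vol g).restrict (extChartAt (𝓡 N) p).source
        ((extChartAt (𝓡 N) p).source ∩ extChartAt (𝓡 N) p ⁻¹' interior K) := by
    rw [Measure.restrict_apply hmeas, Set.inter_right_comm, Set.inter_self]
  rw [h1, restrict_vol, ← chartVolume_eq_map, chartVolume_apply g p hmeas]
  obtain ⟨C, hC⟩ := hK.exists_bound_of_continuousOn ((continuousOn_density g p).mono hKT)
  calc _ ≤ ∫⁻ z in K, ENNReal.ofReal (density g p z) := by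
        refine lintegral_mono_set fun z hz => ?_
        have := hz.2.2
        rw [Set.mem_preimage, (extChartAt (𝓡 N) p).right_inv hz.1] at this
        exact interior_subset this
    _ ≤ ∫⁻ _ in K, ENNReal.ofReal C := setLIntegral_mono' hK.measurableSet fun z hz =>
        ENNReal.ofReal_le_ofReal ((le_abs_self _).trans (hC z hz))
    _ < ⊤ := by
        rw [setLIntegral_const]
        exact ENNReal.mul_lt_top ENNReal.ofReal_lt_top hK.measure_lt_top

theorem aemeasurable_comp_symm (g : Metric N M) {p : M} {β : Type*} [MeasurableSpace β]
    {f : M → β} (hf : AEMeasurable f ((vol g).restrict (extChartAt (𝓡 N) p).source)) :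
    AEMeasurable (fun z => f ((extChartAt (𝓡 N) p).symm z))
      ((volume : Measure 𝔼).restrict (extChartAt (𝓡 N) p).target) := by
  rw [restrict_vol] at hf
  exact (hf.comp_aemeasurable (aemeasurable_symm_coordVolume g p)).mono_ac
    (absolutelyContinuous_coordVolume g p)

theorem lintegral_source (g : Metric N M) {p : M} {f : M → ℝ≥0∞}
    (hf : AEMeasurable f ((vol g).restrict (extChartAt (𝓡 N) p).source)) :
    ∫⁻ x in (extChartAt (𝓡 N) p).source, f x ∂(vol g) =
      ∫⁻ z in (extChartAt (𝓡 N) p).target,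
        ENNReal.ofReal (density g p z) * f ((extChartAt (𝓡 N) p).symm z) := by
  have hf' := aemeasurable_comp_symm g hf
  rw [restrict_vol] at hf ⊢
  rw [lintegral_map' hf (aemeasurable_symm_coordVolume g p), coordVolume,
    lintegral_withDensity_eq_lintegral_mul₀ (aemeasurable_density g p) hf']
  rfl

theorem integral_source (g : Metric N M) {p : M} {f : M → ℝ}
    (hf : AEMeasurable f ((vol g).restrict (extChartAt (𝓡 N) p).source)) :
    ∫ x in (extChartAt (𝓡 N) p).source, f x ∂(vol g) =
      ∫ z in (extChartAt (𝓡 N) p).target,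
        density g p z * f ((extChartAt (𝓡 N) p).symm z) := by
  rw [restrict_vol] at hf ⊢
  rw [integral_map (aemeasurable_symm_coordVolume g p) hf.aestronglyMeasurable, coordVolume,
    integral_withDensity_eq_integral_toReal_smul₀ (aemeasurable_density g p)
      (Eventually.of_forall fun _ => ENNReal.ofReal_lt_top)]
  refine setIntegral_congr_fun (measurableSet_target p) fun z hz => ?_
  simp only [ENNReal.toReal_ofReal (density_pos g hz).le, smul_eq_mul]

end Volume

/-! ### Covector components and test fields supported in a chart. -/

section Fields

variable {N : ℕ} {M : Type*} [TopologicalSpace M] [ChartedSpace (EuclideanSpace ℝ (Fin N)) M]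
  [IsManifold (𝓡 N) ∞ M]

local notation "𝔼" => EuclideanSpace ℝ (Fin N)

theorem inner_self_nonneg (g : Metric N M) (x : M) (v : TangentSpace (𝓡 N) x) :
    0 ≤ g.inner x v v := by
  by_cases h : v = 0
  · simp [h]
  · exact (g.pos x v h).le

/-- The Cauchy–Schwarz inequality for a Riemannian metric. -/
theorem abs_inner_le (g : Metric N M) (x : M) (v w : TangentSpace (𝓡 N) x) :
    |g.inner x v w| ≤ Real.sqrt (g.inner x v v) * Real.sqrt (g.inner x w w) := by
  have h := LinearMap.BilinForm.apply_mul_apply_le_of_forall_zero_le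
    (LinearMap.mk₂ ℝ (fun v w => g.inner x v w) (by simp) (by simp) (by simp) (by simp))
    (fun v => inner_self_nonneg g x v) v w
  simp only [LinearMap.mk₂_apply, g.symm x w v] at h
  rw [← Real.sqrt_mul (inner_self_nonneg g x v), ← Real.sqrt_mul_self_eq_abs]
  exact Real.sqrt_le_sqrt h

theorem components_of_eq_zero (p : M) {X : VectorField N M} {x : M} (hx : X x = 0) :
    components p X x = 0 := by
  rw [components, hx]; exact map_zero _

theorem divergence_eq_zero (g : Metric N M) {X : VectorField N M} {x : M}
    (hX : ∀ᶠ y in 𝓝 x, X y = 0) : divergence g X x = 0 := by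
  have hc := continuousAt_extChartAt_symm (I := 𝓡 N) x
  have h0 : ∀ᶠ z in 𝓝 (extChartAt (𝓡 N) x x), X ((extChartAt (𝓡 N) x).symm z) = 0 := by
    refine hc.tendsto.eventually (p := fun y => X y = 0) ?_
    rwa [extChartAt_to_inv]
  rw [divergence]
  refine mul_eq_zero_of_right _ (Finset.sum_eq_zero fun i _ => ?_)
  have : (fun z => density g x z * components x X ((extChartAt (𝓡 N) x).symm z) i) =ᶠ[𝓝
      (extChartAt (𝓡 N) x x)] fun _ => 0 := by
    filter_upwards [h0] with z hz
    rw [components_of_eq_zero x hz]; simp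
  rw [this.fderiv_eq]; simp

theorem smul_flux (g : Metric N M) {p : M} {z : 𝔼} (hz : z ∈ (extChartAt (𝓡 N) p).target)
    (X : VectorField N M) :
    density g p z • X ((extChartAt (𝓡 N) p).symm z) =
      frame p ((extChartAt (𝓡 N) p).symm z) (flux g p X z) := by
  rw [flux, map_smul, frame_components ((extChartAt (𝓡 N) p).map_target hz)]

/-- The components of the covector `g(Y, ·)` in the chart centred at `p`. -/
noncomputable def lowered (g : Metric N M) (p : M) (Y : VectorField N M) (i : Fin N) (z : 𝔼) : ℝ :=
  g.inner ((extChartAt (𝓡 N) p).symm z) (Y ((extChartAt (𝓡 N) p).symm z))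
    (frame p ((extChartAt (𝓡 N) p).symm z) (EuclideanSpace.single i 1))

/-- The density times `X` has the flux as its coordinates in the frame. The flux thus serves as test
function on both sides of the weak gradient identity. -/
theorem density_mul_inner (g : Metric N M) {p : M} {z : 𝔼}
    (hz : z ∈ (extChartAt (𝓡 N) p).target) (X Y : VectorField N M) :
    density g p z * g.inner ((extChartAt (𝓡 N) p).symm z) (Y ((extChartAt (𝓡 N) p).symm z))
      (X ((extChartAt (𝓡 N) p).symm z)) = ∑ i, lowered g p Y i z * flux g p X z i := by
  rw [← smul_eq_mul, ← map_smul, smul_flux g hz]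
  conv_lhs => rw [← (EuclideanSpace.basisFun (Fin N) ℝ).sum_repr (flux g p X z)]
  simp only [map_sum, map_smul, EuclideanSpace.basisFun_repr, EuclideanSpace.basisFun_apply,
    smul_eq_mul, lowered]
  exact Finset.sum_congr rfl fun i _ => mul_comm _ _

/-- The flux of a vector field, extended by zero outside the chart. -/
noncomputable def fluxExt (g : Metric N M) (p : M) (X : VectorField N M) (i : Fin N) : 𝔼 → ℝ :=
  (extChartAt (𝓡 N) p).target.indicator fun z => flux g p X z i

theorem contDiff_indicator {T K : Set 𝔼} (hT : IsOpen T) (hK : IsCompact K) (hKT : K ⊆ T)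
    {F : 𝔼 → ℝ} (hF : ContDiffOn ℝ ∞ F T) (h0 : ∀ z ∈ T, z ∉ K → F z = 0) :
    ContDiff ℝ ∞ (T.indicator F) ∧ HasCompactSupport (T.indicator F) ∧
      tsupport (T.indicator F) ⊆ K := by
  have hz : ∀ z ∉ K, T.indicator F z = 0 := fun z hz => by
    by_cases hzT : z ∈ T
    · rw [Set.indicator_of_mem hzT, h0 z hzT hz]
    · rw [Set.indicator_of_notMem hzT]
  have hts : tsupport (T.indicator F) ⊆ K :=
    closure_minimal (fun z hz' => by_contra fun h => hz' (hz z h)) hK.isClosed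
  refine ⟨contDiff_iff_contDiffAt.2 fun z => ?_,
    hK.of_isClosed_subset (isClosed_tsupport _) hts, hts⟩
  by_cases hzT : z ∈ T
  · refine (hF.contDiffAt (hT.mem_nhds hzT)).congr_of_eventuallyEq ?_
    filter_upwards [hT.mem_nhds hzT] with w hw using Set.indicator_of_mem hw _
  · refine (contDiffAt_const (c := (0 : ℝ))).congr_of_eventuallyEq ?_
    filter_upwards [hK.isClosed.isOpen_compl.mem_nhds fun h => hzT (hKT h)] with w hw using hz w hw

theorem fluxExt_spec (g : Metric N M) {p : M} {X : VectorField N M} (hX : IsSmoothField X)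
    {K : Set M} (hK : IsCompact K) (hKp : K ⊆ (extChartAt (𝓡 N) p).source)
    (hXK : ∀ x ∉ K, X x = 0) (i : Fin N) :
    ContDiff ℝ ∞ (fluxExt g p X i) ∧ HasCompactSupport (fluxExt g p X i) ∧
      tsupport (fluxExt g p X i) ⊆ (extChartAt (𝓡 N) p).target := by
  have hsub : extChartAt (𝓡 N) p '' K ⊆ (extChartAt (𝓡 N) p).target := by
    rintro _ ⟨x, hx, rfl⟩; exact (extChartAt (𝓡 N) p).map_source (hKp hx)
  have := contDiff_indicator (isOpen_target p)
    (hK.image_of_continuousOn ((continuousOn_extChartAt p).mono hKp)) hsub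
    (F := fun z => flux g p X z i)
    ((EuclideanSpace.proj (𝕜 := ℝ) i).contDiff.comp_contDiffOn (contDiffOn_flux g hX p))
    fun z hz hzK => ?_
  · exact ⟨this.1, this.2.1, this.2.2.trans hsub⟩
  · have h1 : (extChartAt (𝓡 N) p).symm z ∉ K := fun h =>
      hzK ⟨_, h, (extChartAt (𝓡 N) p).right_inv hz⟩
    simp only [flux, components_of_eq_zero p (hXK _ h1), smul_zero, PiLp.zero_apply]

theorem fderiv_fluxExt (g : Metric N M) {p : M} (X : VectorField N M) {z : 𝔼}
    (hz : z ∈ (extChartAt (𝓡 N) p).target) (i : Fin N) :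
    fderiv ℝ (fluxExt g p X i) z = fderiv ℝ (fun y => flux g p X y i) z := by
  refine Filter.EventuallyEq.fderiv_eq ?_
  filter_upwards [(isOpen_target p).mem_nhds hz] with w hw using Set.indicator_of_mem hw _

variable [T2Space M]

/-- The smooth vector field whose flux in the chart centred at `p` is `η eᵢ`. -/
noncomputable def chartField (g : Metric N M) (p : M) (i : Fin N) (η : 𝔼 → ℝ) : VectorField N M :=
  fun x => ((extChartAt (𝓡 N) p).source.indicator
    (fun x => η (extChartAt (𝓡 N) p x) / density g p (extChartAt (𝓡 N) p x)) x) •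
      frame p x (EuclideanSpace.single i 1)

theorem isCompact_symm_image {p : M} {K : Set 𝔼} (hK : IsCompact K)
    (hKT : K ⊆ (extChartAt (𝓡 N) p).target) : IsCompact ((extChartAt (𝓡 N) p).symm '' K) :=
  hK.image_of_continuousOn ((continuousOn_extChartAt_symm p).mono hKT)

theorem symm_image_subset {p : M} {K : Set 𝔼} (hKT : K ⊆ (extChartAt (𝓡 N) p).target) :
    (extChartAt (𝓡 N) p).symm '' K ⊆ (extChartAt (𝓡 N) p).source := by
  rintro _ ⟨z, hz, rfl⟩; exact (extChartAt (𝓡 N) p).map_target (hKT hz)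

theorem indicator_source_eq_zero {p : M} {K : Set 𝔼} {f : 𝔼 → ℝ} (hf : ∀ z ∉ K, f z = 0) {x : M}
    (hx : x ∉ (extChartAt (𝓡 N) p).symm '' K) :
    (extChartAt (𝓡 N) p).source.indicator (fun x => f (extChartAt (𝓡 N) p x)) x = 0 := by
  by_cases h : x ∈ (extChartAt (𝓡 N) p).source
  · rw [Set.indicator_of_mem h]
    exact hf _ fun hK => hx ⟨_, hK, (extChartAt (𝓡 N) p).left_inv h⟩
  · rw [Set.indicator_of_notMem h]

/-- The image of `K` in `M` is compact, hence closed as `M` is Hausdorff, so the function vanishes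
near every point outside the chart domain. -/
theorem contMDiff_indicator_source {p : M} {K : Set 𝔼} (hK : IsCompact K)
    (hKT : K ⊆ (extChartAt (𝓡 N) p).target) {f : 𝔼 → ℝ}
    (hf : ContDiffOn ℝ ∞ f (extChartAt (𝓡 N) p).target) (h0 : ∀ z ∉ K, f z = 0) :
    ContMDiff (𝓡 N) 𝓘(ℝ, ℝ) ∞
      ((extChartAt (𝓡 N) p).source.indicator fun x => f (extChartAt (𝓡 N) p x)) := by
  intro x
  by_cases hx : x ∈ (extChartAt (𝓡 N) p).source
  · have h1 : ContMDiffOn (𝓡 N) 𝓘(ℝ, ℝ) ∞ (fun x => f (extChartAt (𝓡 N) p x))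
        (extChartAt (𝓡 N) p).source :=
      hf.contMDiffOn.comp (by rw [extChartAt_source]; exact contMDiffOn_extChartAt)
        fun y hy => (extChartAt (𝓡 N) p).map_source hy
    refine (h1.contMDiffAt ((isOpen_source p).mem_nhds hx)).congr_of_eventuallyEq ?_
    filter_upwards [(isOpen_source p).mem_nhds hx] with y hy using Set.indicator_of_mem hy _
  · refine (contMDiffAt_const (c := (0 : ℝ))).congr_of_eventuallyEq ?_
    have hcl := (isCompact_symm_image hK hKT).isClosed
    filter_upwards [hcl.isOpen_compl.mem_nhds fun h => hx (symm_image_subset hKT h)] with y hy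
    exact indicator_source_eq_zero h0 hy

theorem isSmoothField_chartField (g : Metric N M) (p : M) (i : Fin N) {η : 𝔼 → ℝ}
    (hη : ContDiff ℝ ∞ η) (hs : HasCompactSupport η)
    (hT : tsupport η ⊆ (extChartAt (𝓡 N) p).target) : IsSmoothField (chartField g p i η) := by
  have h0 : ∀ z ∉ tsupport η, η z / density g p z = 0 := fun z hz => by
    rw [image_eq_zero_of_notMem_tsupport hz, zero_div]
  refine ContMDiffOn.smul_section_of_tsupport (V := fun x : M => TangentSpace (𝓡 N) x) (n := ∞)
    (contMDiff_indicator_source (p := p) hs hT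
    (hη.contDiffOn.div (contDiffOn_density g p) fun z hz => (density_pos g hz).ne') h0).contMDiffOn
    (isOpen_source p) ?_ (contMDiffOn_frame p _)
  have hsub : Function.support ((extChartAt (𝓡 N) p).source.indicator fun x =>
      η (extChartAt (𝓡 N) p x) / density g p (extChartAt (𝓡 N) p x)) ⊆
      (extChartAt (𝓡 N) p).symm '' tsupport η := fun x hx =>
    by_contra fun h => hx (indicator_source_eq_zero h0 h)
  exact (closure_minimal hsub (isCompact_symm_image hs hT).isClosed).trans (symm_image_subset hT)

theorem chartField_eq_zero (g : Metric N M) (p : M) (i : Fin N) {η : 𝔼 → ℝ} {x : M}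
    (hx : x ∉ (extChartAt (𝓡 N) p).symm '' tsupport η) : chartField g p i η x = 0 := by
  rw [chartField, indicator_source_eq_zero (f := fun z => η z / density g p z) (K := tsupport η)
    (fun z hz => by rw [image_eq_zero_of_notMem_tsupport hz, zero_div]) hx, zero_smul]

theorem flux_chartField (g : Metric N M) {p : M} (i : Fin N) (η : 𝔼 → ℝ) {z : 𝔼}
    (hz : z ∈ (extChartAt (𝓡 N) p).target) :
    flux g p (chartField g p i η) z = η z • EuclideanSpace.single i (1 : ℝ) := by
  have hx := (extChartAt (𝓡 N) p).map_target hz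
  have h := components_eq_of_frame hx (X := chartField g p i η)
    (v := (η z / density g p z) • EuclideanSpace.single i (1 : ℝ)) (by
      rw [chartField, Set.indicator_of_mem hx, (extChartAt (𝓡 N) p).right_inv hz, map_smul])
  rw [flux, h, smul_smul, mul_div_cancel₀ _ (density_pos g hz).ne']

/-- Testing with such a field isolates a single partial derivative. -/
theorem fluxExt_chartField (g : Metric N M) {p : M} (i j : Fin N) {η : 𝔼 → ℝ}
    (hT : tsupport η ⊆ (extChartAt (𝓡 N) p).target) :
    fluxExt g p (chartField g p i η) j = if j = i then η else fun _ => 0 := by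
  ext z
  by_cases hz : z ∈ (extChartAt (𝓡 N) p).target
  · rw [fluxExt, Set.indicator_of_mem hz, flux_chartField g i η hz]
    split_ifs with h <;> simp [h]
  · rw [fluxExt, Set.indicator_of_notMem hz]
    have : η z = 0 := image_eq_zero_of_notMem_tsupport fun h => hz (hT h)
    split_ifs <;> simp [this]

end Fields

/-! ### Weak gradients in coordinates and their chain rule. -/

section WeakGradient

variable {N : ℕ} {M : Type*} [TopologicalSpace M] [ChartedSpace (EuclideanSpace ℝ (Fin N)) M]
  [IsManifold (𝓡 N) ∞ M] [MeasurableSpace M] [BorelSpace M] [CompactSpace M]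

local notation "𝔼" => EuclideanSpace ℝ (Fin N)

/-- Measurable vector fields with integrable norm. -/
structure IsIntegrableField (g : Metric N M) (Y : VectorField N M) : Prop where
  aemeasurable : ∀ p : M,
    AEMeasurable (components p Y) ((vol g).restrict (extChartAt (𝓡 N) p).source)
  lintegral_lt_top : ∫⁻ x, ENNReal.ofReal (Real.sqrt (g.inner x (Y x) (Y x))) ∂(vol g) < ⊤

/-- The quotient of `c` by the density is bounded on the compact set `K`. The constant does not
depend on `h`, which makes the later estimates uniform along a sequence of fields. -/
theorem exists_lintegral_chart_le (g : Metric N M) {p : M} {K : Set 𝔼} (hK : IsCompact K)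
    (hKT : K ⊆ (extChartAt (𝓡 N) p).target) {c : 𝔼 → ℝ}
    (hc : ContinuousOn c (extChartAt (𝓡 N) p).target) :
    ∃ C : ℝ≥0∞, C ≠ ⊤ ∧ ∀ h : M → ℝ≥0∞,
      AEMeasurable h ((vol g).restrict (extChartAt (𝓡 N) p).source) →
      ∫⁻ z in K, ‖c z‖ₑ * h ((extChartAt (𝓡 N) p).symm z) ≤ C * ∫⁻ x, h x ∂(vol g) := by
  obtain ⟨B, hB⟩ := hK.exists_bound_of_continuousOn (f := fun z => c z / density g p z)
    ((hc.div (continuousOn_density g p) fun z hz => (density_pos g hz).ne').mono hKT)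
  refine ⟨ENNReal.ofReal B, ENNReal.ofReal_ne_top, fun h hh => ?_⟩
  calc ∫⁻ z in K, ‖c z‖ₑ * h ((extChartAt (𝓡 N) p).symm z)
      ≤ ∫⁻ z in K, ENNReal.ofReal B *
          (ENNReal.ofReal (density g p z) * h ((extChartAt (𝓡 N) p).symm z)) := by
        refine setLIntegral_mono' hK.measurableSet fun z hz => ?_
        have hd := density_pos g (hKT hz)
        rw [← mul_assoc]
        gcongr
        rw [← ENNReal.ofReal_mul' hd.le, ← ofReal_norm]
        refine ENNReal.ofReal_le_ofReal ?_
        have := hB z hz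
        rwa [norm_div, Real.norm_of_nonneg hd.le, div_le_iff₀ hd] at this
    _ = ENNReal.ofReal B * ∫⁻ z in K,
          ENNReal.ofReal (density g p z) * h ((extChartAt (𝓡 N) p).symm z) :=
        lintegral_const_mul' _ _ ENNReal.ofReal_ne_top
    _ ≤ ENNReal.ofReal B * ∫⁻ x, h x ∂(vol g) := by
        gcongr
        refine (lintegral_mono_set hKT).trans ?_
        rw [← lintegral_source g hh]
        exact setLIntegral_le_lintegral _ _

theorem aemeasurable_components_of_contMDiffOn (g : Metric N M) {p : M} {X : VectorField N M}
    (hX : ContMDiffOn (𝓡 N) (𝓡 N).tangent ∞ (fun x => (⟨x, X x⟩ : TangentBundle (𝓡 N) M))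
      (extChartAt (𝓡 N) p).source) :
    AEMeasurable (components p X) ((vol g).restrict (extChartAt (𝓡 N) p).source) :=
  (contMDiffOn_components hX).continuousOn.aemeasurable (measurableSet_source p)

/-- In the chart the pairing is a polynomial in the components and the continuous entries of the
Gram matrix. -/
theorem aemeasurable_inner (g : Metric N M) {p : M} {X Y : VectorField N M}
    (hX : AEMeasurable (components p X) ((vol g).restrict (extChartAt (𝓡 N) p).source))
    (hY : AEMeasurable (components p Y) ((vol g).restrict (extChartAt (𝓡 N) p).source)) :
    AEMeasurable (fun x => g.inner x (Y x) (X x))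
      ((vol g).restrict (extChartAt (𝓡 N) p).source) := by
  have h : AEMeasurable (fun x => ∑ i, ∑ j, components p Y x i * components p X x j *
      gram g p (extChartAt (𝓡 N) p x) i j) ((vol g).restrict (extChartAt (𝓡 N) p).source) := by
    refine Finset.aemeasurable_fun_sum _ fun i _ => Finset.aemeasurable_fun_sum _ fun j _ => ?_
    have hc : ∀ (Z : VectorField N M) (i : Fin N),
        AEMeasurable (components p Z) ((vol g).restrict (extChartAt (𝓡 N) p).source) →
        AEMeasurable (fun x => components p Z x i)
          ((vol g).restrict (extChartAt (𝓡 N) p).source) := fun Z i hZ =>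
      (EuclideanSpace.proj (𝕜 := ℝ) i).continuous.measurable.comp_aemeasurable hZ
    refine ((hc Y i hY).mul (hc X j hX)).mul ?_
    exact ((contDiffOn_gram g p i j).continuousOn.comp (continuousOn_extChartAt p)
      fun x hx => (extChartAt (𝓡 N) p).map_source hx).aemeasurable (measurableSet_source p)
  refine h.congr ?_
  filter_upwards [ae_restrict_mem (measurableSet_source p)] with x hx
  rw [← inner_frame g hx, frame_components hx, frame_components hx]

theorem IsIntegrableField.aemeasurable_norm {g : Metric N M} {Y : VectorField N M}
    (hY : IsIntegrableField g Y) (p : M) :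
    AEMeasurable (fun x => ENNReal.ofReal (Real.sqrt (g.inner x (Y x) (Y x))))
      ((vol g).restrict (extChartAt (𝓡 N) p).source) :=
  (aemeasurable_inner g (hY.aemeasurable p) (hY.aemeasurable p)).sqrt.ennreal_ofReal

theorem locallyIntegrableOn_comp_symm (g : Metric N M) {u : M → ℝ} (hu : Integrable u (vol g))
    (p : M) : LocallyIntegrableOn (fun z => u ((extChartAt (𝓡 N) p).symm z))
      (extChartAt (𝓡 N) p).target volume := by
  rw [locallyIntegrableOn_iff (isOpen_target p).isLocallyClosed]
  intro K hKT hK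
  have hm : AEMeasurable u ((vol g).restrict (extChartAt (𝓡 N) p).source) :=
    hu.1.aemeasurable.restrict
  refine ⟨((aemeasurable_comp_symm g hm).mono_measure
    (Measure.restrict_mono hKT le_rfl)).aestronglyMeasurable, ?_⟩
  obtain ⟨C, hC, h⟩ := exists_lintegral_chart_le g hK hKT (c := fun _ => 1) continuousOn_const
  have := h (fun x => ‖u x‖ₑ) hm.enorm
  simp only [enorm_one, one_mul] at this
  exact this.trans_lt (ENNReal.mul_lt_top hC.lt_top hu.2)

theorem aemeasurable_lowered (g : Metric N M) {p : M} {Y : VectorField N M}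
    (hY : AEMeasurable (components p Y) ((vol g).restrict (extChartAt (𝓡 N) p).source))
    (i : Fin N) : AEMeasurable (lowered g p Y i)
      ((volume : Measure 𝔼).restrict (extChartAt (𝓡 N) p).target) :=
  aemeasurable_comp_symm g (aemeasurable_inner g
    (aemeasurable_components_of_contMDiffOn g (contMDiffOn_frame p _)) hY)

theorem enorm_lowered_le (g : Metric N M) {p : M} (Y : VectorField N M) (i : Fin N) {z : 𝔼}
    (hz : z ∈ (extChartAt (𝓡 N) p).target) :
    ‖lowered g p Y i z‖ₑ ≤ ‖Real.sqrt (gram g p z i i)‖ₑ *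
      ENNReal.ofReal (Real.sqrt (g.inner ((extChartAt (𝓡 N) p).symm z)
        (Y ((extChartAt (𝓡 N) p).symm z)) (Y ((extChartAt (𝓡 N) p).symm z)))) := by
  have h := gram_apply g ((extChartAt (𝓡 N) p).map_target hz) i i
  rw [(extChartAt (𝓡 N) p).right_inv hz] at h
  rw [h, ← ofReal_norm, ← ofReal_norm, Real.norm_of_nonneg (Real.sqrt_nonneg _),
    ← ENNReal.ofReal_mul (Real.sqrt_nonneg _), mul_comm]
  exact ENNReal.ofReal_le_ofReal (abs_inner_le g _ _ _)

/-- On compact subsets of a chart, the lowered components of a field are bounded in `L¹` by the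
norm of the field, with a constant that does not depend on the field. -/
theorem exists_lintegral_lowered_le (g : Metric N M) {p : M} {K : Set 𝔼} (hK : IsCompact K)
    (hKT : K ⊆ (extChartAt (𝓡 N) p).target) (i : Fin N) :
    ∃ C : ℝ≥0∞, C ≠ ⊤ ∧ ∀ Y : VectorField N M, IsIntegrableField g Y →
      ∫⁻ z in K, ‖lowered g p Y i z‖ₑ ≤
        C * ∫⁻ x, ENNReal.ofReal (Real.sqrt (g.inner x (Y x) (Y x))) ∂(vol g) := by
  obtain ⟨C, hC, h⟩ := exists_lintegral_chart_le g hK hKT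
    (c := fun z => Real.sqrt (gram g p z i i)) (contDiffOn_gram g p i i).continuousOn.sqrt
  refine ⟨C, hC, fun Y hY => le_trans ?_ (h _ (hY.aemeasurable_norm p))⟩
  exact setLIntegral_mono' hK.measurableSet fun z hz => enorm_lowered_le g Y i (hKT hz)

theorem IsIntegrableField.locallyIntegrableOn_lowered {g : Metric N M} {Y : VectorField N M}
    (hY : IsIntegrableField g Y) (p : M) (i : Fin N) :
    LocallyIntegrableOn (lowered g p Y i) (extChartAt (𝓡 N) p).target volume := by
  rw [locallyIntegrableOn_iff (isOpen_target p).isLocallyClosed]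
  intro K hKT hK
  refine ⟨((aemeasurable_lowered g (hY.aemeasurable p) i).mono_measure
    (Measure.restrict_mono hKT le_rfl)).aestronglyMeasurable, ?_⟩
  obtain ⟨C, hC, h⟩ := exists_lintegral_lowered_le g hK hKT i
  exact (h Y hY).trans_lt (ENNReal.mul_lt_top hC.lt_top hY.lintegral_lt_top)

/-- The divergence of a vector field supported in a chart, tested in coordinates. -/
theorem integral_mul_divergence (g : Metric N M) {u : M → ℝ} (hu : Integrable u (vol g)) {p : M}
    {X : VectorField N M} (hX : IsSmoothField X) {K : Set M} (hK : IsCompact K)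
    (hKc : IsClosed K) (hKp : K ⊆ (extChartAt (𝓡 N) p).source) (hXK : ∀ x ∉ K, X x = 0) :
    ∫ x, u x * divergence g X x ∂(vol g) =
      ∑ i, ∫ z, u ((extChartAt (𝓡 N) p).symm z) *
        fderiv ℝ (fluxExt g p X i) z (EuclideanSpace.single i 1) := by
  have hdiv : ∀ x ∉ K, divergence g X x = 0 := fun x hx => divergence_eq_zero g <| by
    filter_upwards [hKc.isOpen_compl.mem_nhds hx] with y hy using hXK y hy
  have hF := fluxExt_spec g hX hK hKp hXK
  have hm : AEMeasurable (fun x => u x * divergence g X x)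
      ((vol g).restrict (extChartAt (𝓡 N) p).source) :=
    (hu.1.aemeasurable.mul (continuous_divergence g hX).measurable.aemeasurable).restrict
  rw [← setIntegral_eq_integral_of_forall_compl_eq_zero
    (s := (extChartAt (𝓡 N) p).source) (fun x hx => by rw [hdiv x fun h => hx (hKp h), mul_zero]),
    integral_source g hm, ← integral_finsetSum]
  · symm
    rw [← setIntegral_eq_integral_of_forall_compl_eq_zero (s := (extChartAt (𝓡 N) p).target)]
    · refine setIntegral_congr_fun (measurableSet_target p) fun z hz => Eq.symm ?_
      have hd := density_pos g hz
      rw [divergence_eq g hX ((extChartAt (𝓡 N) p).map_target hz),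
        (extChartAt (𝓡 N) p).right_inv hz, ← sum_fderiv_coord (differentiableAt_flux g hX hz),
        ← Finset.mul_sum]
      simp only [fderiv_fluxExt g X hz]
      field_simp
    · intro z hz
      refine Finset.sum_eq_zero fun i _ => ?_
      rw [image_eq_zero_of_notMem_tsupport
        (f := fun z => fderiv ℝ (fluxExt g p X i) z (EuclideanSpace.single i 1)) fun h =>
          hz ((hF i).2.2 (tsupport_fderiv_apply_subset _ _ h)), mul_zero]
  · exact fun i _ => integrable_mul_of_tsupport_subset (locallyIntegrableOn_comp_symm g hu p)
      (continuous_fderiv_apply (hF i).1 _) (hasCompactSupport_fderiv_apply (hF i).2.1 _)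
      ((tsupport_fderiv_apply_subset _ _).trans (hF i).2.2)

/-- The pairing with a vector field supported in a chart, in coordinates. -/
theorem integral_inner (g : Metric N M) {Y : VectorField N M} (hY : IsIntegrableField g Y) {p : M}
    {X : VectorField N M} (hX : IsSmoothField X) {K : Set M} (hK : IsCompact K)
    (hKp : K ⊆ (extChartAt (𝓡 N) p).source) (hXK : ∀ x ∉ K, X x = 0) :
    ∫ x, g.inner x (Y x) (X x) ∂(vol g) =
      ∑ i, ∫ z, lowered g p Y i z * fluxExt g p X i z := by
  have hF := fluxExt_spec g hX hK hKp hXK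
  have h0 : ∀ x ∉ (extChartAt (𝓡 N) p).source, g.inner x (Y x) (X x) = 0 := fun x hx => by
    rw [hXK x fun h => hx (hKp h), map_zero]
  rw [← setIntegral_eq_integral_of_forall_compl_eq_zero h0,
    integral_source g (aemeasurable_inner g
      (aemeasurable_components_of_contMDiffOn g hX.contMDiffOn) (hY.aemeasurable p)),
    ← integral_finsetSum]
  · symm
    rw [← setIntegral_eq_integral_of_forall_compl_eq_zero (s := (extChartAt (𝓡 N) p).target)]
    · refine setIntegral_congr_fun (measurableSet_target p) fun z hz => Eq.symm ?_
      rw [density_mul_inner g hz]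
      exact Finset.sum_congr rfl fun i _ => by rw [fluxExt, Set.indicator_of_mem hz]
    · intro z hz
      refine Finset.sum_eq_zero fun i _ => ?_
      rw [fluxExt, Set.indicator_of_notMem hz, mul_zero]
  · exact fun i _ => integrable_mul_of_tsupport_subset (hY.locallyIntegrableOn_lowered p i)
      (hF i).1.continuous (hF i).2.1 (hF i).2.2

/-- The volume is finite, and `√s ≤ 1 + s` for `s ≥ 0`. -/
theorem IsWeakGradient.isIntegrableField {g : Metric N M} {u : M → ℝ} {Y : VectorField N M}
    (h : IsWeakGradient g u Y) : IsIntegrableField g Y := by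
  have := isFiniteMeasure_vol g
  refine ⟨h.aemeasurable, ?_⟩
  calc ∫⁻ x, ENNReal.ofReal (Real.sqrt (g.inner x (Y x) (Y x))) ∂(vol g)
      ≤ ∫⁻ x, (1 + ENNReal.ofReal (g.inner x (Y x) (Y x))) ∂(vol g) := by
        refine lintegral_mono fun x => ?_
        rw [← ENNReal.ofReal_one, ← ENNReal.ofReal_add zero_le_one (inner_self_nonneg g x _)]
        refine ENNReal.ofReal_le_ofReal ?_
        have h0 := inner_self_nonneg g x (Y x)
        rw [Real.sqrt_le_left (by positivity)]
        nlinarith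
    _ = vol g Set.univ + ∫⁻ x, ENNReal.ofReal (g.inner x (Y x) (Y x)) ∂(vol g) := by
        rw [lintegral_add_left measurable_const, lintegral_one]
    _ < ⊤ := ENNReal.add_lt_top.2 ⟨measure_lt_top _ _, h.sq_integrable⟩

theorem components_smul (p : M) (φ : M → ℝ) (Y : VectorField N M) (x : M) :
    components p (fun x => φ x • Y x) x = φ x • components p Y x :=
  map_smul (mfderiv (𝓡 N) 𝓘(ℝ, 𝔼) (extChartAt (𝓡 N) p) x) (φ x) (Y x)

theorem sqrt_inner_smul (g : Metric N M) (x : M) (a : ℝ) (v : TangentSpace (𝓡 N) x) :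
    Real.sqrt (g.inner x (a • v) (a • v)) = |a| * Real.sqrt (g.inner x v v) := by
  have : g.inner x (a • v) (a • v) = a * a * g.inner x v v := by
    simp [mul_assoc]
  rw [this, Real.sqrt_mul (mul_self_nonneg a), Real.sqrt_mul_self_eq_abs]

theorem IsIntegrableField.smul {g : Metric N M} {Y : VectorField N M}
    (hY : IsIntegrableField g Y) {φ : M → ℝ} (hφ : AEMeasurable φ (vol g)) {C : ℝ}
    (hC : ∀ x, |φ x| ≤ C) : IsIntegrableField g fun x => φ x • Y x := by
  refine ⟨fun p => ?_, ?_⟩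
  · exact (hφ.restrict.smul (hY.aemeasurable p)).congr
      (Eventually.of_forall fun x => (components_smul p φ Y x).symm)
  · simp only [sqrt_inner_smul]
    calc _ ≤ ∫⁻ x, ENNReal.ofReal C *
          ENNReal.ofReal (Real.sqrt (g.inner x (Y x) (Y x))) ∂(vol g) := by
          refine lintegral_mono fun x => ?_
          rw [ENNReal.ofReal_mul (abs_nonneg _)]
          gcongr
          exact hC x
      _ < ⊤ := by
          rw [lintegral_const_mul' _ _ ENNReal.ofReal_ne_top]
          exact ENNReal.mul_lt_top ENNReal.ofReal_lt_top hY.lintegral_lt_top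

theorem lowered_smul (g : Metric N M) (p : M) (φ : M → ℝ) (Y : VectorField N M) (i : Fin N)
    (z : 𝔼) : lowered g p (fun x => φ x • Y x) i z =
      φ ((extChartAt (𝓡 N) p).symm z) * lowered g p Y i z := by
  rw [lowered, lowered, map_smul]
  rfl

variable [T2Space M]

/-- The weak gradient gives weak partial derivatives in charts. -/
theorem IsWeakGradient.hasWeakDerivOn {g : Metric N M} {u : M → ℝ} {Y : VectorField N M}
    (h : IsWeakGradient g u Y) (hu : Integrable u (vol g)) (p : M) (i : Fin N) :
    HasWeakDerivOn volume (extChartAt (𝓡 N) p).target (EuclideanSpace.single i 1)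
      (fun z => u ((extChartAt (𝓡 N) p).symm z)) (lowered g p Y i) := by
  intro η hη hηs hηT
  have hX := isSmoothField_chartField g p i hη hηs hηT
  have hK := isCompact_symm_image hηs hηT
  have hKp := symm_image_subset hηT
  have hXK := fun x hx => chartField_eq_zero g p i (η := η) (x := x) hx
  have key := h.integral_eq _ hX
  rw [integral_mul_divergence g hu hX hK hK.isClosed hKp hXK,
    integral_inner g h.isIntegrableField hX hK hKp hXK,
    Finset.sum_eq_single i, Finset.sum_eq_single i] at key
  · simp only [fluxExt_chartField g i i hηT, if_pos] at key
    rw [key, neg_neg]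
  · intro j _ hj
    simp [fluxExt_chartField g i j hηT, hj]
  · simp
  · intro j _ hj
    simp [fluxExt_chartField g i j hηT, hj]
  · simp

theorem exists_partition_of_unity (N : ℕ) (M : Type*) [TopologicalSpace M]
    [ChartedSpace (EuclideanSpace ℝ (Fin N)) M] [IsManifold (𝓡 N) ∞ M] [CompactSpace M]
    [T2Space M] :
    ∃ (t : Finset M) (ρ : t → M → ℝ), (∀ k, ContMDiff (𝓡 N) 𝓘(ℝ, ℝ) ∞ (ρ k)) ∧
      (∀ k, tsupport (ρ k) ⊆ (extChartAt (𝓡 N) (k : M)).source) ∧ (∀ k x, 0 ≤ ρ k x) ∧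
      ∀ x, ∑ k, ρ k x = 1 := by
  obtain ⟨t, -, ht⟩ := isCompact_univ.elim_nhds_subcover
    (fun x : M => (extChartAt (𝓡 N) x).source) fun x _ => extChartAt_source_mem_nhds x
  obtain ⟨f, hf⟩ := SmoothPartitionOfUnity.exists_isSubordinate (𝓡 N) (isClosed_univ (X := M))
    (fun k : t => (extChartAt (𝓡 N) (k : M)).source) (fun k => isOpen_source _)
    (fun x hx => by simpa using! ht hx)
  refine ⟨t, fun k => f k, fun k => (f k).contMDiff, hf, fun k x => f.nonneg k x, fun x => ?_⟩
  rw [← finsum_eq_sum_of_fintype]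
  exact f.sum_eq_one (Set.mem_univ x)

/-- The chain rule for weak gradients. -/
theorem IsWeakGradient.comp {g : Metric N M} {u : M → ℝ} {Y : VectorField N M}
    (h : IsWeakGradient g u Y) (hu : Integrable u (vol g)) {ψ ψ' : ℝ → ℝ} {C : ℝ}
    (hψ : ∀ t, HasDerivAt ψ (ψ' t) t) (hψ' : Continuous ψ') (hC : ∀ t, |ψ t| ≤ C)
    (hC' : ∀ t, |ψ' t| ≤ C) {X : VectorField N M} (hX : IsSmoothField X) :
    ∫ x, g.inner x (ψ' (u x) • Y x) (X x) ∂(vol g) =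
      -∫ x, ψ (u x) * divergence g X x ∂(vol g) := by
  have := isFiniteMeasure_vol g
  have hψc : Continuous ψ := continuous_iff_continuousAt.2 fun t => (hψ t).continuousAt
  have hψu : Integrable (fun x => ψ (u x)) (vol g) :=
    Integrable.of_bound (hψc.comp_aestronglyMeasurable hu.1) C (Eventually.of_forall fun x => hC _)
  have hY := h.isIntegrableField
  have hψY : IsIntegrableField g fun x => ψ' (u x) • Y x :=
    hY.smul (hψ'.measurable.comp_aemeasurable hu.1.aemeasurable) fun x => hC' _
  obtain ⟨t, ρ, hρ, hρs, -, hρ1⟩ := exists_partition_of_unity N M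
  have hXk : ∀ k, IsSmoothField fun x => ρ k x • X x := fun k => (hρ k).smul_section hX
  have hcpt : ∀ k, IsCompact (tsupport (ρ k)) := fun k => (isClosed_tsupport _).isCompact
  have hzero : ∀ k, ∀ x ∉ tsupport (ρ k), ρ k x • X x = 0 := fun k x hx => by
    rw [image_eq_zero_of_notMem_tsupport hx, zero_smul]
  have hsum : (fun x => ∑ k, ρ k x • X x) = X := by
    ext1 x; rw [← Finset.sum_smul, hρ1, one_smul]
  -- The field `ρ k • X` is supported in one chart, so both sides are coordinate integrals against
  -- the components of its flux and the Euclidean chain rule applies to each.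
  have local_eq : ∀ k : t, ∫ x, g.inner x (ψ' (u x) • Y x) (ρ k x • X x) ∂(vol g) =
      -∫ x, ψ (u x) * divergence g (fun x => ρ k x • X x) x ∂(vol g) := fun k => by
    have hF := fluxExt_spec g (hXk k) (hcpt k) (hρs k) (hzero k)
    rw [integral_mul_divergence g hψu (hXk k) (hcpt k) (isClosed_tsupport _) (hρs k) (hzero k),
      integral_inner g hψY (hXk k) (hcpt k) (hρs k) (hzero k), ← Finset.sum_neg_distrib]
    refine Finset.sum_congr rfl fun i _ => ?_
    have hw := (h.hasWeakDerivOn hu k i).comp (isOpen_target (k : M))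
      (locallyIntegrableOn_comp_symm g hu k) (hY.locallyIntegrableOn_lowered k i) hψ hψ' hC hC'
      _ (hF i).1 (hF i).2.1 (hF i).2.2
    rw [hw, neg_neg]
    simp only [lowered_smul]
  have hdivsum : ∀ x, divergence g X x = ∑ k, divergence g (fun x => ρ k x • X x) x := fun x => by
    conv_lhs => rw [← hsum]
    exact divergence_sum _ g hXk (by rw [hsum]; exact hX) x
  have hinsum : ∀ x, g.inner x (ψ' (u x) • Y x) (X x) =
      ∑ k, g.inner x (ψ' (u x) • Y x) (ρ k x • X x) := fun x => by
    rw [← map_sum, congrFun hsum x]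
  -- Integrability is needed to split the integral over the partition. Cauchy–Schwarz bounds the
  -- integrand by a constant times the norm of the field, and it vanishes off the chart.
  have hi1 : ∀ k, Integrable (fun x => g.inner x (ψ' (u x) • Y x) (ρ k x • X x)) (vol g) :=
    fun k => by
      have hm := aemeasurable_inner g
        (aemeasurable_components_of_contMDiffOn g (p := (k : M)) (hXk k).contMDiffOn)
        (hψY.aemeasurable k)
      have hcont : Continuous fun x => Real.sqrt (g.inner x (ρ k x • X x) (ρ k x • X x)) := by
        have := contMDiffOn_inner g (hXk k).contMDiffOn (hXk k).contMDiffOn (S := Set.univ)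
        exact (contMDiffOn_univ.1 this).continuous.sqrt
      obtain ⟨B, hB⟩ := isCompact_univ.exists_bound_of_continuousOn hcont.continuousOn
      have hon : IntegrableOn (fun x => g.inner x (ψ' (u x) • Y x) (ρ k x • X x))
          (extChartAt (𝓡 N) (k : M)).source (vol g) := by
        refine ⟨hm.aestronglyMeasurable, ?_⟩
        refine lt_of_le_of_lt (setLIntegral_le_lintegral _ _) (lt_of_le_of_lt
          (b := ∫⁻ x, ENNReal.ofReal (Real.sqrt (g.inner x (ψ' (u x) • Y x) (ψ' (u x) • Y x))) *
            ENNReal.ofReal B ∂(vol g)) (lintegral_mono fun x => ?_) ?_)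
        · rw [← ofReal_norm, ← ENNReal.ofReal_mul (Real.sqrt_nonneg _)]
          refine ENNReal.ofReal_le_ofReal ((abs_inner_le g x _ _).trans ?_)
          exact mul_le_mul_of_nonneg_left ((le_abs_self _).trans (hB x (Set.mem_univ x)))
            (Real.sqrt_nonneg _)
        · rw [lintegral_mul_const' _ _ ENNReal.ofReal_ne_top]
          exact ENNReal.mul_lt_top hψY.lintegral_lt_top ENNReal.ofReal_lt_top
      refine (integrableOn_iff_integrable_of_support_subset fun x hx => ?_).1 hon
      refine hρs k (by_contra fun h => hx ?_)
      simp only [hzero k x h, map_zero]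
  have hi2 : ∀ k, Integrable (fun x => ψ (u x) * divergence g (fun x => ρ k x • X x) x) (vol g) :=
    fun k => by
      obtain ⟨B, hB⟩ := isCompact_univ.exists_bound_of_continuousOn
        (continuous_divergence g (hXk k)).continuousOn
      exact hψu.mul_bdd (continuous_divergence g (hXk k)).measurable.aestronglyMeasurable
        (Eventually.of_forall fun x => hB x (Set.mem_univ x))
  simp only [hinsum, hdivsum, Finset.mul_sum]
  rw [integral_finsetSum _ fun k _ => hi1 k, integral_finsetSum _ fun k _ => hi2 k,
    ← Finset.sum_neg_distrib]
  exact Finset.sum_congr rfl fun k _ => local_eq k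

end WeakGradient

/-! ### Weak sequential compactness in `L²`. -/

section WeakLimit

variable {α : Type*} [MeasurableSpace α]

/-- Uniformly bounded sequences of functions on a finite measure space have subsequences that
converge weakly in `L²`. -/
theorem exists_subseq_tendsto_integral_mul [MeasurableSpace.CountablyGenerated α] {μ : Measure α}
    [IsFiniteMeasure μ] {w : ℕ → α → ℝ} (hw : ∀ i, AEStronglyMeasurable (w i) μ) {B : ℝ}
    (hB : ∀ i x, |w i x| ≤ B) :
    ∃ (k : ℕ → ℕ) (v : α → ℝ), StrictMono k ∧ MemLp v 2 μ ∧ ∀ θ : α → ℝ, MemLp θ 2 μ →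
      Tendsto (fun i => ∫ x, w (k i) x * θ x ∂μ) atTop (𝓝 (∫ x, v x * θ x ∂μ)) := by
  have hL : ∀ i, MemLp (w i) 2 μ := fun i => MemLp.of_bound (hw i) B (Eventually.of_forall (hB i))
  let e := InnerProductSpace.toDual ℝ (Lp ℝ 2 μ)
  let φ : ℕ → WeakDual ℝ (Lp ℝ 2 μ) := fun i => StrongDual.toWeakDual (e (hL i).toLp)
  have hφ : ∀ i, φ i ∈ WeakDual.toStrongDual ⁻¹' Metric.closedBall (0 : StrongDual ℝ (Lp ℝ 2 μ))
      (μ.real Set.univ ^ (2 : ℝ≥0∞).toReal⁻¹ * |B|) := fun i => by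
    rw [Set.mem_preimage, mem_closedBall_zero_iff]
    change ‖e (hL i).toLp‖ ≤ _
    rw [LinearIsometryEquiv.norm_map]
    refine Lp.norm_le_of_ae_bound (abs_nonneg B) ?_
    filter_upwards [(hL i).coeFn_toLp] with x hx
    rw [hx]; exact (hB i x).trans (le_abs_self B)
  -- For a finite exponent and a countably generated σ-algebra, `L²` is separable, so balls of its
  -- dual are weak-* sequentially compact.
  have : Fact ((2 : ℝ≥0∞) ≠ ⊤) := ⟨ENNReal.ofNat_ne_top⟩
  obtain ⟨a, -, k, hk, hlim⟩ := WeakDual.isSeqCompact_closedBall ℝ _ _ _ hφ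
  let v : Lp ℝ 2 μ := e.symm (WeakDual.toStrongDual a)
  refine ⟨k, v, hk, Lp.memLp v, fun θ hθ => ?_⟩
  have h1 : Tendsto (fun i => φ (k i) hθ.toLp) atTop (𝓝 (a hθ.toLp)) :=
    ((WeakDual.eval_continuous (hθ.toLp)).tendsto a).comp hlim
  have h2 : ∀ z : Lp ℝ 2 μ, inner ℝ z hθ.toLp = ∫ x, z x * θ x ∂μ := fun z => by
    rw [L2.inner_def]
    refine integral_congr_ae ?_
    filter_upwards [hθ.coeFn_toLp] with x hx
    rw [hx]; simp [mul_comm]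
  have h3 : a hθ.toLp = ∫ x, v x * θ x ∂μ := by
    rw [← h2]
    change WeakDual.toStrongDual a _ = _
    rw [← e.apply_symm_apply (WeakDual.toStrongDual a)]
    rfl
  rw [← h3]
  refine h1.congr fun i => ?_
  change inner ℝ (hL (k i)).toLp hθ.toLp = _
  rw [h2]
  refine integral_congr_ae ?_
  filter_upwards [(hL (k i)).coeFn_toLp] with x hx
  rw [hx]

end WeakLimit

/-! ### Compactness in `L¹` on the manifold. -/

section Compactness

variable {N : ℕ} {M : Type*} [TopologicalSpace M] [ChartedSpace (EuclideanSpace ℝ (Fin N)) M]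
  [IsManifold (𝓡 N) ∞ M] [MeasurableSpace M] [BorelSpace M] [CompactSpace M] [T2Space M]

local notation "𝔼" => EuclideanSpace ℝ (Fin N)

/-- After multiplication by a function supported in a chart, the problem is Euclidean: `L¹` bounds
on the fields bound the weak derivatives, and weak convergence gives convergence of every
mollification. -/
theorem tendsto_lintegral_localized (g : Metric N M) {w : ℕ → M → ℝ} {Y : ℕ → VectorField N M}
    {v : M → ℝ} {B : ℝ} {C : ℝ≥0∞} (hw : ∀ i, Integrable (w i) (vol g))
    (hB : ∀ i x, |w i x| ≤ B) (hY : ∀ i, IsIntegrableField g (Y i)) {p : M}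
    (hwY : ∀ i j, HasWeakDerivOn volume (extChartAt (𝓡 N) p).target (EuclideanSpace.single j 1)
      (fun z => w i ((extChartAt (𝓡 N) p).symm z)) (lowered g p (Y i) j)) (hC : C ≠ ⊤)
    (hYC : ∀ i, ∫⁻ x, ENNReal.ofReal (Real.sqrt (g.inner x (Y i x) (Y i x))) ∂(vol g) ≤ C)
    (hv : Integrable v (vol g))
    (hlim : ∀ θ : M → ℝ, MemLp θ 2 (vol g) →
      Tendsto (fun i => ∫ x, w i x * θ x ∂(vol g)) atTop (𝓝 (∫ x, v x * θ x ∂(vol g))))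
    {ρ : M → ℝ} (hρ : ContMDiff (𝓡 N) 𝓘(ℝ, ℝ) ∞ ρ)
    (hρs : tsupport ρ ⊆ (extChartAt (𝓡 N) p).source) :
    Tendsto (fun i => ∫⁻ x, ‖ρ x * (w i x - v x)‖ₑ ∂(vol g)) atTop (𝓝 0) := by
  have := isFiniteMeasure_vol g
  have hsc := measurableSet_source (N := N) p
  set φ := extChartAt (𝓡 N) p with hφ
  set T := φ.target
  have hT : IsOpen T := isOpen_target p
  let K : Set 𝔼 := φ '' tsupport ρ
  have hK : IsCompact K := (isClosed_tsupport ρ).isCompact.image_of_continuousOn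
    ((continuousOn_extChartAt p).mono hρs)
  have hKT : K ⊆ T := by rintro _ ⟨x, hx, rfl⟩; exact φ.map_source (hρs hx)
  -- The cut-off includes the density, so Lebesgue integrals of `w χ` are volume integrals of `w ρ`.
  let χ : 𝔼 → ℝ := T.indicator fun z => density g p z * ρ (φ.symm z)
  obtain ⟨hχ, hχs, hχK⟩ := contDiff_indicator hT hK hKT
    (F := fun z => density g p z * ρ (φ.symm z))
    ((contDiffOn_density g p).mul (contMDiffOn_comp_symm hρ.contMDiffOn)) fun z hz hzK => by
      rw [image_eq_zero_of_notMem_tsupport (f := ρ) fun h => hzK ⟨_, h, φ.right_inv hz⟩, mul_zero]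
  change ContDiff ℝ ∞ χ at hχ
  change HasCompactSupport χ at hχs
  change tsupport χ ⊆ K at hχK
  have hχT := hχK.trans hKT
  have hdχ := fun j : Fin N => continuous_fderiv_apply hχ (EuclideanSpace.single j 1)
  have hdχs := fun j : Fin N => hasCompactSupport_fderiv_apply hχs (EuclideanSpace.single j 1)
  have hdχT := fun j : Fin N => tsupport_fderiv_apply_subset χ (EuclideanSpace.single j 1)
  obtain ⟨D₀, hD₀⟩ := hχs.exists_bound_of_continuous hχ.continuous
  choose D₁ hD₁ using fun j => (hdχs j).exists_bound_of_continuous (hdχ j)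
  have hB0 : ∀ z, 0 ≤ B := fun z : 𝔼 => (abs_nonneg _).trans (hB 0 (φ.symm z))
  have hloc := fun i => locallyIntegrableOn_comp_symm g (hw i) p
  have hlocv := locallyIntegrableOn_comp_symm g hv p
  have hlocY := fun i j => (hY i).locallyIntegrableOn_lowered p j
  have hfi := fun i => integrable_mul_of_tsupport_subset (hloc i) hχ.continuous hχs hχT
  have hFi := integrable_mul_of_tsupport_subset hlocv hχ.continuous hχs hχT
  choose A hA hAle using fun j => exists_lintegral_lowered_le g hK hKT j
  let G : ℕ → Fin N → 𝔼 → ℝ := fun i j z => lowered g p (Y i) j z * χ z +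
    w i (φ.symm z) * fderiv ℝ χ z (EuclideanSpace.single j 1)
  have hGi : ∀ i j, Integrable (G i j) := fun i j =>
    (integrable_mul_of_tsupport_subset (hlocY i j) hχ.continuous hχs hχT).add
      (integrable_mul_of_tsupport_subset (hloc i) (hdχ j) (hdχs j) ((hdχT j).trans hχT))
  have hGle : ∀ i j, ∫⁻ z, ‖G i j z‖ₑ ≤
      ENNReal.ofReal D₀ * (A j * C) + ENNReal.ofReal (B * D₁ j) * volume K := fun i j => by
    have h1 : (Set.indicator K (G i j)) = G i j := by
      refine Set.indicator_eq_self.2 fun z hz => by_contra fun h => hz ?_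
      simp only [G]
      rw [image_eq_zero_of_notMem_tsupport fun h' => h (hχK h'),
        image_eq_zero_of_notMem_tsupport (f := fun z => fderiv ℝ χ z (EuclideanSpace.single j 1))
          fun h' => h (hχK (hdχT j h')), mul_zero, mul_zero, add_zero]
    calc ∫⁻ z, ‖G i j z‖ₑ = ∫⁻ z in K, ‖G i j z‖ₑ := by
          rw [← lintegral_indicator hK.measurableSet]
          refine lintegral_congr fun z => ?_
          rw [← h1, enorm_indicator_eq_indicator_enorm, h1]
      _ ≤ ∫⁻ z in K, (ENNReal.ofReal D₀ * ‖lowered g p (Y i) j z‖ₑ +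
            ENNReal.ofReal (B * D₁ j)) := by
          refine lintegral_mono fun z => (enorm_add_le _ _).trans (add_le_add ?_ ?_)
          · rw [enorm_mul, mul_comm]
            gcongr
            rw [← ofReal_norm]
            exact ENNReal.ofReal_le_ofReal (hD₀ z)
          · rw [← ofReal_norm, norm_mul]
            exact ENNReal.ofReal_le_ofReal
              (mul_le_mul (hB i _) (hD₁ j z) (norm_nonneg _) (hB0 z))
      _ = ENNReal.ofReal D₀ * (∫⁻ z in K, ‖lowered g p (Y i) j z‖ₑ) +
            ENNReal.ofReal (B * D₁ j) * volume K := by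
          rw [lintegral_add_right _ measurable_const, lintegral_const_mul' _ _ ENNReal.ofReal_ne_top,
            setLIntegral_const]
      _ ≤ _ := by
          gcongr
          exact (hAle j (Y i) (hY i)).trans (by gcongr; exact hYC i)
  have key := tendsto_lintegral_sub_of_weakDeriv (f := fun i z => w i (φ.symm z) * χ z) (G := G)
    (F := fun z => v (φ.symm z) * χ z) hK (B := B * D₀)
    (fun i z => by
      rw [abs_mul]; exact mul_le_mul (hB i _) (hD₀ z) (abs_nonneg _) (hB0 z))
    (fun i z hz => by rw [image_eq_zero_of_notMem_tsupport fun h' => hz (hχK h'), mul_zero])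
    hfi hGi (fun i j => (hwY i j).mul_cutoff (hloc i) (hlocY i j) hχ hχs hχT)
    (C := ∑ j, (ENNReal.ofReal D₀ * (A j * C) + ENNReal.ofReal (B * D₁ j) * volume K))
    (by
      refine (ENNReal.sum_lt_top.2 fun j _ => ?_).ne
      exact ENNReal.add_lt_top.2 ⟨ENNReal.mul_lt_top ENNReal.ofReal_lt_top
        (ENNReal.mul_lt_top (hA j).lt_top hC.lt_top),
        ENNReal.mul_lt_top ENNReal.ofReal_lt_top hK.measure_lt_top⟩)
    (fun i => Finset.sum_le_sum fun j _ => hGle i j) hFi ?_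
  · refine key.congr fun i => ?_
    have hm : AEMeasurable (fun x => ‖ρ x * (w i x - v x)‖ₑ) ((vol g).restrict φ.source) :=
      (hρ.continuous.measurable.aemeasurable.mul
        ((hw i).1.aemeasurable.sub hv.1.aemeasurable)).enorm.restrict
    have hs : ∫⁻ x, ‖ρ x * (w i x - v x)‖ₑ ∂(vol g) =
        ∫⁻ x in φ.source, ‖ρ x * (w i x - v x)‖ₑ ∂(vol g) := by
      rw [← lintegral_indicator hsc]
      refine lintegral_congr fun x => ?_
      by_cases hx : x ∈ φ.source
      · rw [Set.indicator_of_mem hx]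
      · rw [Set.indicator_of_notMem hx, image_eq_zero_of_notMem_tsupport fun h => hx (hρs h),
          zero_mul, enorm_zero]
    rw [hs, lintegral_source g hm, ← lintegral_indicator (measurableSet_target p)]
    refine lintegral_congr fun z => ?_
    by_cases hz : z ∈ T
    · rw [Set.indicator_of_mem hz, ← sub_mul]
      simp only [χ]
      rw [Set.indicator_of_mem hz, ← Real.enorm_of_nonneg (density_pos g hz).le, ← enorm_mul]
      congr 1
      ring
    · rw [Set.indicator_of_notMem hz]
      simp only [χ]
      rw [Set.indicator_of_notMem hz, mul_zero, mul_zero, sub_zero, enorm_zero]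
  · intro n z
    let m : 𝔼 → ℝ := (mollifier 𝔼 n).normed volume
    have hmc : Continuous m := (mollifier 𝔼 n).continuous_normed
    obtain ⟨D₂, hD₂⟩ := (mollifier 𝔼 n).hasCompactSupport_normed (μ := volume)
      |>.exists_bound_of_continuous hmc
    obtain ⟨D₃, hD₃⟩ := isCompact_univ.exists_bound_of_continuousOn (f := ρ) hρ.continuous.continuousOn
    -- The mollification at `z` is the pairing with this bounded function, to which weak convergence
    -- applies.
    let θ : M → ℝ := φ.source.indicator fun x => m (z - φ x) * ρ x
    have hθm : AEStronglyMeasurable θ (vol g) := by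
      refine (aestronglyMeasurable_indicator_iff hsc).2 ?_
      refine ContinuousOn.aestronglyMeasurable ?_ hsc
      exact (hmc.comp_continuousOn (continuousOn_const.sub (continuousOn_extChartAt p))).mul
        hρ.continuous.continuousOn
    have hD₂0 : 0 ≤ D₂ := (norm_nonneg _).trans (hD₂ 0)
    have hθ : MemLp θ 2 (vol g) := by
      refine MemLp.of_bound hθm (D₂ * D₃) (Eventually.of_forall fun x => ?_)
      have hD₃0 : 0 ≤ D₃ := (norm_nonneg _).trans (hD₃ x (Set.mem_univ x))
      refine (norm_indicator_le_norm_self _ _).trans ?_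
      rw [norm_mul]
      exact mul_le_mul (hD₂ _) (hD₃ x (Set.mem_univ x)) (norm_nonneg _) hD₂0
    have hval : ∀ h : M → ℝ, Integrable h (vol g) →
        ∫ x, h x * θ x ∂(vol g) = mollify volume n (fun t => h (φ.symm t) * χ t) z := fun h hh => by
      have hm : AEMeasurable (fun x => h x * θ x) ((vol g).restrict φ.source) :=
        (hh.1.aemeasurable.mul hθm.aemeasurable).restrict
      have h0 : ∀ x ∉ φ.source, h x * θ x = 0 := fun x hx => by
        simp only [θ]; rw [Set.indicator_of_notMem hx, mul_zero]
      rw [← setIntegral_eq_integral_of_forall_compl_eq_zero h0, integral_source g hm,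
        mollify_apply_swap,
        ← integral_indicator (measurableSet_target p)]
      refine integral_congr_ae (Eventually.of_forall fun t => ?_)
      by_cases ht : t ∈ T
      · simp only [Set.indicator_of_mem (show t ∈ (extChartAt (𝓡 N) p).target from ht), θ, χ,
          Set.indicator_of_mem ht]
        rw [Set.indicator_of_mem (φ.map_target ht), φ.right_inv ht]
        simp only [m]
        ring
      · simp only [Set.indicator_of_notMem (show t ∉ (extChartAt (𝓡 N) p).target from ht), χ,
          Set.indicator_of_notMem ht, mul_zero]
    rw [← hval v hv]
    exact (hlim θ hθ).congr fun i => hval (w i) (hw i)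

/-- Compactness in `L¹` of bounded sequences of functions whose weak gradients are bounded in
`L¹`. -/
theorem exists_subseq_tendsto_of_weakDeriv (g : Metric N M) {w : ℕ → M → ℝ}
    {Y : ℕ → VectorField N M} {B : ℝ} {C : ℝ≥0∞} (hw : ∀ i, Integrable (w i) (vol g))
    (hB : ∀ i x, |w i x| ≤ B) (hY : ∀ i, IsIntegrableField g (Y i))
    (hwY : ∀ i p j, HasWeakDerivOn volume (extChartAt (𝓡 N) p).target (EuclideanSpace.single j 1)
      (fun z => w i ((extChartAt (𝓡 N) p).symm z)) (lowered g p (Y i) j)) (hC : C ≠ ⊤)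
    (hYC : ∀ i, ∫⁻ x, ENNReal.ofReal (Real.sqrt (g.inner x (Y i x) (Y i x))) ∂(vol g) ≤ C) :
    ∃ (k : ℕ → ℕ) (v : M → ℝ), StrictMono k ∧ Integrable v (vol g) ∧
      Tendsto (fun i => ∫⁻ x, ‖w (k i) x - v x‖ₑ ∂(vol g)) atTop (𝓝 0) := by
  have := isFiniteMeasure_vol g
  have := secondCountable N M
  obtain ⟨k, v, hk, hv2, hlim⟩ := exists_subseq_tendsto_integral_mul (fun i => (hw i).1) hB
  have hv : Integrable v (vol g) := hv2.integrable (by norm_num)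
  refine ⟨k, v, hk, hv, ?_⟩
  obtain ⟨t, ρ, hρ, hρs, -, hρ1⟩ := exists_partition_of_unity N M
  have hloc := fun c : t => tendsto_lintegral_localized g (fun i => hw (k i)) (fun i => hB (k i))
    (fun i => hY (k i)) (p := (c : M)) (fun i j => hwY (k i) c j) hC (fun i => hYC (k i)) hv hlim
    (hρ c) (hρs c)
  have hsum := tendsto_finsetSum Finset.univ fun c _ => hloc c
  rw [Finset.sum_const_zero] at hsum
  refine tendsto_of_tendsto_of_tendsto_of_le_of_le tendsto_const_nhds hsum (fun _ => zero_le)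
    fun i => ?_
  have hm : ∀ c : t, AEMeasurable (fun x => ‖ρ c x * (w (k i) x - v x)‖ₑ) (vol g) := fun c =>
    ((hρ c).continuous.measurable.aemeasurable.mul
      ((hw (k i)).1.aemeasurable.sub hv.1.aemeasurable)).enorm
  rw [← lintegral_finsetSum' _ fun c _ => hm c]
  refine lintegral_mono fun x => ?_
  refine le_trans ?_ (enorm_sum_le _ _)
  rw [← Finset.sum_mul, hρ1, one_mul]

end Compactness

/-! ### The Modica–Mortola estimates. -/

section Energy

variable {N : ℕ} {M : Type*} [TopologicalSpace M] [ChartedSpace (EuclideanSpace ℝ (Fin N)) M]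
  [IsManifold (𝓡 N) ∞ M] [MeasurableSpace M] [BorelSpace M] [CompactSpace M] [T2Space M]
  {g : Metric N M} {W : ℝ → ℝ} {u : M → ℝ}

theorem MemH1.isWeakGradient (h : MemH1 g u) : IsWeakGradient g u (weakGradient g u) := by
  rw [weakGradient, dif_pos h.2]
  exact h.2.choose_spec

theorem MemH1.integrable (h : MemH1 g u) : Integrable u (vol g) := by
  have := isFiniteMeasure_vol g
  exact h.1.integrable (by norm_num)

theorem MemH1.aemeasurable_potential (h : MemH1 g u) (hW : IsDoubleWell W) :
    AEMeasurable (fun x => W (u x)) (vol g) :=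
  hW.continuous.measurable.comp_aemeasurable h.1.1.aemeasurable

/-- The trick of Modica and Mortola: the energy controls the total variation of the primitive of
`√(2 W)` along `u`. -/
theorem MemH1.lintegral_wellSlope_smul_le (h : MemH1 g u) (hW : IsDoubleWell W) {ε : ℝ}
    (hε : 0 < ε) :
    ∫⁻ x, ENNReal.ofReal (Real.sqrt (g.inner x (wellSlope W (u x) • weakGradient g u x)
      (wellSlope W (u x) • weakGradient g u x))) ∂(vol g) ≤ energy g W ε u := by
  rw [energy, ← lintegral_const_mul' _ _ ENNReal.ofReal_ne_top,
    ← lintegral_const_mul' _ _ ENNReal.ofReal_ne_top,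
    ← lintegral_add_right' _ ((h.aemeasurable_potential hW).ennreal_ofReal.const_mul _)]
  refine lintegral_mono fun x => ?_
  have hs := inner_self_nonneg g x (weakGradient g u x)
  have hV := wellSlope_nonneg (W := W) (u x)
  have hVW : wellSlope W (u x) ^ 2 ≤ 2 * W (u x) :=
    (Real.le_sqrt hV (mul_nonneg zero_le_two (hW.nonneg _))).1 (hW.wellSlope_le _)
  rw [sqrt_inner_smul, abs_of_nonneg hV, ← ENNReal.ofReal_mul (by positivity),
    ← ENNReal.ofReal_mul (by positivity), ← ENNReal.ofReal_add (by positivity)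
      (mul_nonneg (by positivity) (hW.nonneg _))]
  refine ENNReal.ofReal_le_ofReal ?_
  set s := Real.sqrt (g.inner x (weakGradient g u x) (weakGradient g u x))
  rw [← Real.sq_sqrt hs]
  -- The square expresses `a b ≤ ε/2 a² + b²/(2ε)` with `a = |∇u|` and `b = Φ'(u)`; then `b² ≤ 2
  -- W(u)` brings in the potential.
  have h1 : 0 ≤ (ε * s - wellSlope W (u x)) ^ 2 := sq_nonneg _
  have h2 : ε / 2 * s ^ 2 + 1 / ε * W (u x) - wellSlope W (u x) * s =
    ((ε * s - wellSlope W (u x)) ^ 2 + (2 * W (u x) - wellSlope W (u x) ^ 2)) / (2 * ε) := by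
    field_simp
    ring
  have h3 : 0 ≤ ((ε * s - wellSlope W (u x)) ^ 2 + (2 * W (u x) - wellSlope W (u x) ^ 2)) /
    (2 * ε) := div_nonneg (by linarith) (by positivity)
  linarith

theorem lintegral_potential_le {ε : ℝ} (hε : 0 < ε) {E : ℝ}
    (hE : energy g W ε u ≤ ENNReal.ofReal E) :
    ∫⁻ x, ENNReal.ofReal (W (u x)) ∂(vol g) ≤ ENNReal.ofReal (ε * E) := by
  have h1 : ENNReal.ofReal (1 / ε) * ∫⁻ x, ENNReal.ofReal (W (u x)) ∂(vol g) ≤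
    ENNReal.ofReal E := le_add_self.trans hE
  calc ∫⁻ x, ENNReal.ofReal (W (u x)) ∂(vol g)
      = ENNReal.ofReal ε *
          (ENNReal.ofReal (1 / ε) * ∫⁻ x, ENNReal.ofReal (W (u x)) ∂(vol g)) := by
        rw [← mul_assoc, ← ENNReal.ofReal_mul hε.le, mul_one_div_cancel hε.ne',
          ENNReal.ofReal_one, one_mul]
    _ ≤ ENNReal.ofReal ε * ENNReal.ofReal E := by gcongr
    _ = _ := (ENNReal.ofReal_mul hε.le).symm

/-- The chain rule moves the divergence onto `Φ ∘ u`; Cauchy–Schwarz with `|X| ≤ 1` leaves the `L¹`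
norm of its gradient, which the energy bounds. -/
theorem MemH1.integral_wellPrimitive_mul_divergence_le (h : MemH1 g u) (hW : IsDoubleWell W)
    {ε : ℝ} (hε : 0 < ε) {E : ℝ} (hE0 : 0 ≤ E) (hE : energy g W ε u ≤ ENNReal.ofReal E)
    {X : VectorField N M} (hX : IsSmoothField X)
    (hX1 : ∀ x, Real.sqrt (g.inner x (X x) (X x)) ≤ 1) :
    ∫ x, wellPrimitive W (u x) * divergence g X x ∂(vol g) ≤ E := by
  obtain ⟨C, hC⟩ := hW.exists_wellSlope_le
  have hcomp := h.isWeakGradient.comp h.integrable hW.hasDerivAt_wellPrimitive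
    hW.continuous_wellSlope (C := max (surfaceTension W) C)
    (fun t => (hW.abs_wellPrimitive_le t).trans (le_max_left _ _))
    (fun t => (hC t).trans (le_max_right _ _)) hX
  rw [← neg_eq_iff_eq_neg] at hcomp
  rw [← hcomp]
  refine (neg_le_abs _).trans ((ENNReal.ofReal_le_ofReal_iff hE0).1 ?_)
  rw [← Real.norm_eq_abs, ofReal_norm]
  refine (enorm_integral_le_lintegral_enorm _).trans
    (le_trans (lintegral_mono fun x => ?_) ((h.lintegral_wellSlope_smul_le hW hε).trans hE))
  rw [← ofReal_norm]
  exact ENNReal.ofReal_le_ofReal ((abs_inner_le g x _ _).trans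
    (mul_le_of_le_one_right (Real.sqrt_nonneg _) (hX1 x)))

theorem exists_subseq_tendsto_wellPrimitive (hW : IsDoubleWell W) {u : ℕ → M → ℝ} {ε : ℕ → ℝ}
    (hε : ∀ i, 0 < ε i) (hu : ∀ i, MemH1 g (u i)) {E : ℝ}
    (hE : ∀ i, energy g W (ε i) (u i) ≤ ENNReal.ofReal E) :
    ∃ (k : ℕ → ℕ) (v : M → ℝ), StrictMono k ∧ Integrable v (vol g) ∧
      Tendsto (fun i => ∫⁻ x, ‖wellPrimitive W (u (k i) x) - v x‖ₑ ∂(vol g)) atTop (𝓝 0) := by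
  have := isFiniteMeasure_vol g
  obtain ⟨C, hC⟩ := hW.exists_wellSlope_le
  have hint : ∀ i, Integrable (fun x => wellPrimitive W (u i x)) (vol g) := fun i =>
    Integrable.of_bound (hW.continuous_wellPrimitive.comp_aestronglyMeasurable (hu i).1.1)
      (surfaceTension W) (Eventually.of_forall fun x => hW.abs_wellPrimitive_le _)
  have hYi : ∀ i, IsIntegrableField g (fun x => wellSlope W (u i x) • weakGradient g (u i) x) :=
    fun i => (hu i).isWeakGradient.isIntegrableField.smul
      (hW.continuous_wellSlope.measurable.comp_aemeasurable (hu i).1.1.aemeasurable) fun x => hC _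
  have hwd : ∀ i p j, HasWeakDerivOn volume (extChartAt (𝓡 N) p).target
      (EuclideanSpace.single j 1)
      (fun z => wellPrimitive W (u i ((extChartAt (𝓡 N) p).symm z)))
      (lowered g p (fun x => wellSlope W (u i x) • weakGradient g (u i) x) j) := fun i p j => by
    have hcomp := ((hu i).isWeakGradient.hasWeakDerivOn (hu i).integrable p j).comp
      (isOpen_target p) (locallyIntegrableOn_comp_symm g (hu i).integrable p)
      ((hu i).isWeakGradient.isIntegrableField.locallyIntegrableOn_lowered p j)
      hW.hasDerivAt_wellPrimitive hW.continuous_wellSlope (C := max (surfaceTension W) C)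
      (fun t => (hW.abs_wellPrimitive_le t).trans (le_max_left _ _))
      (fun t => (hC t).trans (le_max_right _ _))
    rwa [show lowered g p (fun x => wellSlope W (u i x) • weakGradient g (u i) x) j = fun z =>
      wellSlope W (u i ((extChartAt (𝓡 N) p).symm z)) * lowered g p (weakGradient g (u i)) j z from
      funext fun z => lowered_smul g p (fun x => wellSlope W (u i x)) _ j z]
  exact exists_subseq_tendsto_of_weakDeriv g hint (fun i x => hW.abs_wellPrimitive_le _) hYi hwd
    ENNReal.ofReal_ne_top fun i => ((hu i).lintegral_wellSlope_smul_le hW (hε i)).trans (hE i)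

end Energy

/-! ### Passage to the limit. -/

theorem exists_subseq_ae_tendsto {α : Type*} [MeasurableSpace α] {μ : Measure α}
    {f : ℕ → α → ℝ} {F : α → ℝ} (hf : ∀ i, AEStronglyMeasurable (f i) μ)
    (hF : AEStronglyMeasurable F μ)
    (h : Tendsto (fun i => ∫⁻ x, ‖f i x - F x‖ₑ ∂μ) atTop (𝓝 0)) :
    ∃ k : ℕ → ℕ, StrictMono k ∧ ∀ᵐ x ∂μ, Tendsto (fun i => f (k i) x) atTop (𝓝 (F x)) :=
  (tendstoInMeasure_of_tendsto_eLpNorm one_ne_zero hf hF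
    (by simpa [eLpNorm_one_eq_lintegral_enorm] using h)).exists_seq_tendsto_ae

end AllenCahn

theorem proposition4p13 {N : ℕ} (hN : 1 ≤ N)
    {M : Type*} [TopologicalSpace M] [T2Space M] [CompactSpace M]
    [ChartedSpace (EuclideanSpace ℝ (Fin N)) M] [IsManifold (𝓡 N) ∞ M]
    [MeasurableSpace M] [BorelSpace M]
    (g : AllenCahn.Metric N M)
    (W : ℝ → ℝ) (hW : AllenCahn.IsDoubleWell W) (hgrowth : AllenCahn.GrowthCondition N W)
    (Estar : ℝ) (hEstar : 0 < Estar)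
    (ε : ℕ → ℝ) (hεpos : ∀ i, 0 < ε i) (hε : Tendsto ε atTop (𝓝 0))
    (u : ℕ → M → ℝ) (hu : ∀ i, AllenCahn.MemH1 g (u i))
    (hE : ∀ i, AllenCahn.energy g W (ε i) (u i) ≤ ENNReal.ofReal Estar) :
    ∃ (k : ℕ → ℕ) (uinf : M → ℝ) (Ω : Set M),
      StrictMono k ∧
      AllenCahn.MemBV g uinf ∧
      Tendsto (fun j => eLpNorm (fun x => u (k j) x - uinf x) 1 (AllenCahn.vol g))
        atTop (𝓝 0) ∧
      AllenCahn.HasFinitePerimeter g Ω ∧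
      uinf = Ω.indicator (fun _ => (1 : ℝ)) ∧
      AllenCahn.variation g uinf ≤
        ENNReal.ofReal (Estar / AllenCahn.surfaceTension W) := by
  have hfin := AllenCahn.isFiniteMeasure_vol g
  have hσ := hW.surfaceTension_pos
  obtain ⟨k₁, v, hk₁, hv, hv₁⟩ := AllenCahn.exists_subseq_tendsto_wellPrimitive hW hεpos hu hE
  have hwm : ∀ i, AEStronglyMeasurable (fun x => AllenCahn.wellPrimitive W (u i x)) (AllenCahn.vol g) := fun i =>
    hW.continuous_wellPrimitive.comp_aestronglyMeasurable (hu i).1.1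
  obtain ⟨k₂, hk₂, hv₂⟩ := AllenCahn.exists_subseq_ae_tendsto (fun i => hwm (k₁ i)) hv.1 hv₁
  have hpot : Tendsto (fun i => ∫⁻ x, ENNReal.ofReal (W (u i x)) ∂(AllenCahn.vol g)) atTop (𝓝 0) := by
    refine tendsto_of_tendsto_of_tendsto_of_le_of_le tendsto_const_nhds ?_ (fun _ => zero_le)
      fun i => AllenCahn.lintegral_potential_le (hεpos i) (hE i)
    simpa using ENNReal.tendsto_ofReal (hε.mul_const Estar)
  obtain ⟨k₃, hk₃, hv₃⟩ := AllenCahn.exists_subseq_ae_tendsto (μ := AllenCahn.vol g) (F := fun _ => 0)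
    (f := fun i x => W (u (k₁ (k₂ i)) x))
    (fun i => ((hu _).aemeasurable_potential hW).aestronglyMeasurable)
    aestronglyMeasurable_const (by
      simp only [sub_zero, Real.enorm_of_nonneg (hW.nonneg _)]
      exact hpot.comp (hk₁.comp hk₂).tendsto_atTop)
  let k : ℕ → ℕ := fun i => k₁ (k₂ (k₃ i))
  have hk : StrictMono k := hk₁.comp (hk₂.comp hk₃)
  -- Almost everywhere `v` is `0` or `σ`, so any threshold strictly between these values would do.
  let Ω : Set M := {x | AllenCahn.surfaceTension W / 2 < v x}
  have hΩ : NullMeasurableSet Ω (AllenCahn.vol g) := nullMeasurableSet_lt aemeasurable_const hv.1.aemeasurable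
  let χ : M → ℝ := Ω.indicator fun _ => (1 : ℝ)
  have hχ1 : ∀ x, |χ x| ≤ 1 := fun x => by
    by_cases hx : x ∈ Ω
    · simp [χ, hx]
    · simp [χ, hx]
  have hχ : Integrable χ (AllenCahn.vol g) := (integrable_const (1 : ℝ)).indicator₀ hΩ
  have hw_ae : ∀ᵐ x ∂(AllenCahn.vol g), Tendsto (fun i => AllenCahn.wellPrimitive W (u (k i) x)) atTop (𝓝 (v x)) := by
    filter_upwards [hv₂] with x hx using hx.comp hk₃.tendsto_atTop
  have hlim : ∀ᵐ x ∂(AllenCahn.vol g), Tendsto (fun i => u (k i) x) atTop (𝓝 (χ x)) ∧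
      v x = AllenCahn.surfaceTension W * χ x := by
    filter_upwards [hw_ae, hv₃] with x hx hx'
    obtain ⟨a, ha, ⟨rfl, h0⟩ | ⟨rfl, h1⟩⟩ := hW.tendsto_well hgrowth hx' hx
    · have hxΩ : x ∉ Ω := by simp only [Ω, Set.mem_ofPred_eq, h0]; linarith
      have : χ x = 0 := Set.indicator_of_notMem hxΩ _
      rw [this, mul_zero]
      exact ⟨ha, h0⟩
    · have hxΩ : x ∈ Ω := by simp only [Ω, Set.mem_ofPred_eq, h1]; linarith
      have : χ x = 1 := Set.indicator_of_mem hxΩ _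
      rw [this, mul_one]
      exact ⟨ha, h1⟩
  have hvar : AllenCahn.variation g χ ≤ ENNReal.ofReal (Estar / AllenCahn.surfaceTension W) := by
    refine iSup_le fun X => iSup_le fun hX => iSup_le fun hX1 => ENNReal.ofReal_le_ofReal ?_
    have hdc := AllenCahn.continuous_divergence g hX
    obtain ⟨D, hD⟩ := isCompact_univ.exists_bound_of_continuousOn hdc.continuousOn
    have hconv : Tendsto (fun i => ∫ x, AllenCahn.wellPrimitive W (u (k i) x) * AllenCahn.divergence g X x ∂(AllenCahn.vol g))
        atTop (𝓝 (∫ x, v x * AllenCahn.divergence g X x ∂(AllenCahn.vol g))) := by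
      refine tendsto_integral_of_dominated_convergence (fun _ => AllenCahn.surfaceTension W * D)
        (fun i => (hwm _).mul hdc.aestronglyMeasurable) (integrable_const _)
        (fun i => Eventually.of_forall fun x => ?_) ?_
      · rw [norm_mul]
        exact mul_le_mul (hW.abs_wellPrimitive_le _) (hD x (Set.mem_univ x)) (norm_nonneg _) hσ.le
      · filter_upwards [hw_ae] with x hx using hx.mul_const _
    have hle := le_of_tendsto' hconv fun i => (hu _).integral_wellPrimitive_mul_divergence_le hW
      (hεpos _) hEstar.le (hE _) hX hX1
    -- The bound holds for the integral of `v div X`, and `v = σ χ` almost everywhere, so the factor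
    -- `σ` can be divided out.
    rw [le_div_iff₀ hσ, mul_comm, ← integral_const_mul]
    refine le_of_eq_of_le (integral_congr_ae ?_) hle
    filter_upwards [hlim] with x hx
    rw [hx.2, mul_assoc]
  have hvar_top := hvar.trans_lt ENNReal.ofReal_lt_top
  refine ⟨k, χ, Ω, hk, ⟨hχ, hvar_top⟩, ?_, ⟨hΩ, hvar_top⟩, rfl, hvar⟩
  obtain ⟨R, c, hR, hc, hRc, -⟩ := hgrowth.exists_abs_le hW
  simp only [eLpNorm_one_eq_lintegral_enorm]
  have hm : ∀ i, AEMeasurable (fun x => |u (k i) x - χ x|) (AllenCahn.vol g) := fun i =>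
    ((hu _).1.1.aemeasurable.sub hχ.1.aemeasurable).norm
  -- Truncation at `R + 1` gives a constant majorant on a space of finite measure. The excess is at
  -- most `c W(u)`, because `|u - χ| ≤ |u| + 1 ≤ R + 1 + c W(u)`.
  have hmin : Tendsto (fun i => ∫⁻ x, ENNReal.ofReal (min |u (k i) x - χ x| (R + 1)) ∂(AllenCahn.vol g))
      atTop (𝓝 0) := by
    have := tendsto_lintegral_of_dominated_convergence' (μ := AllenCahn.vol g) (f := fun _ => 0)
      (F := fun i x => ENNReal.ofReal (min |u (k i) x - χ x| (R + 1)))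
      (fun _ => ENNReal.ofReal (R + 1))
      (fun i => ((hm i).min aemeasurable_const).ennreal_ofReal)
      (fun i => Eventually.of_forall fun x => ENNReal.ofReal_le_ofReal (min_le_right _ _))
      (by
        rw [lintegral_const]
        exact (ENNReal.mul_lt_top ENNReal.ofReal_lt_top (measure_lt_top _ _)).ne)
      (by
        filter_upwards [hlim] with x hx
        have h1 : Tendsto (fun i => min |u (k i) x - χ x| (R + 1)) atTop (𝓝 0) := by
          have := ((hx.1.sub_const (χ x)).abs).min (tendsto_const_nhds (x := R + 1))
          rwa [sub_self, abs_zero, min_eq_left (by linarith)] at this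
        simpa using ENNReal.tendsto_ofReal h1)
    simpa using this
  have hsum := hmin.add (ENNReal.Tendsto.const_mul (hpot.comp hk.tendsto_atTop)
    (Or.inr (ENNReal.ofReal_ne_top (r := c))))
  rw [mul_zero, add_zero] at hsum
  refine tendsto_of_tendsto_of_tendsto_of_le_of_le tendsto_const_nhds hsum (fun _ => zero_le)
    fun i => ?_
  simp only [Function.comp_apply]
  rw [← lintegral_const_mul' _ _ ENNReal.ofReal_ne_top,
    ← lintegral_add_left' ((hm i).min aemeasurable_const).ennreal_ofReal]
  refine lintegral_mono fun x => ?_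
  have hW0 := mul_nonneg hc.le (hW.nonneg (u (k i) x))
  rw [← ofReal_norm, ← ENNReal.ofReal_mul hc.le,
    ← ENNReal.ofReal_add (le_min (abs_nonneg _) (by linarith)) hW0]
  refine ENNReal.ofReal_le_ofReal ?_
  rw [Real.norm_eq_abs]
  rcases le_total |u (k i) x - χ x| (R + 1) with h | h
  · rw [min_eq_left h]; linarith
  · rw [min_eq_right h]
    linarith [abs_sub (u (k i) x) (χ x), hRc (u (k i) x), hχ1 x]
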